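/- Let $\gamma>0$ and let $f\in C^2(\mathbb R)$ satisfy $f(u)=u^5+h(u)$, $h(0)=0$, $|h''(u)|\le C_h(1+|u|^q)$ for some $C_h$ and some $0\le q<3$. Write $\xi_u=(u,\partial_t u)$, let $B^R_{x_0}\subset\mathbb R^3$ be the ball of radius $R$ centred at $x_0$, and set $$\|(a,b)\|_{\mathcal E(B)}=\big(\|a\|_{L^2(B)}^2+\|\nabla a\|_{L^2(B)}^2+\|b\|_{L^2(B)}^2\big)^{1/2},\qquad \mathcal E_{loc}=H^1_{loc}(\mathbb R^3)\times L^2_{loc}(\mathbb R^3).$$ For $g\in L^1_{loc}([0,\infty);L^2_{loc}(\mathbb R^3))$ and $\xi_0\in\mathcal E_{loc}$, a Shatah–Struwe (SS) solution of $$\partial_t^2u+\gamma\,\partial_tu+(-\Delta+1)u+f(u)=g,\qquad \xi_u|_{t=0}=\xi_0,\qquad x\in\mathbb R^3,\qquad(*)$$ is a function $u$ with $\xi_u\in C([0,\infty);\mathcal E_{loc})$, $\xi_u(0)=\xi_0$ and $u\in L^4_{loc}([0,\infty);L^{12}_{loc}(\mathbb R^3))$ such that, for all $\varphi\in C_0^\infty((0,\infty)\times\mathbb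 R^3)$, with $(\cdot,\cdot)$ the inner product of $L^2(\mathbb R^3)$, $$\int_0^\infty\big[-(\partial_tu,\partial_t\varphi)+\gamma(\partial_tu,\varphi)+(\nabla u,\nabla\varphi)+(u,\varphi)+(f(u),\varphi)\big]dt=\int_0^\infty(g,\varphi)\,dt .$$ **Proposition.** Let $R>0$, $x_0\in\mathbb R^3$ and $M\ge0$. There is a constant $C$, depending only on $\gamma$, $f$, $R$, $x_0$ and $M$, such that for any two SS solutions $u_1,u_2$ of $(*)$, with possibly different initial data and external forces $g_1,g_2$, whose Strichartz norms over the cone satisfy $$\Big(\int_0^R\|u_i(s)\|_{L^{12}(B^{R-s}_{x_0})}^4\,ds\Big)^{1/4}\le M,\qquad i=1,2,$$ and for all $0<t<R$, $$\|\xi_{u_1}(t)-\xi_{u_2}(t)\|_{\mathcal E(B^{R-t}_{x_0})}\le C\|\xi_{u_1}(0)-\xi_{u_2}(0)\|_{\mathcal E(B^R_{x_0})}+C\int_0^t\|g_1(s)-g_2(s)\|_{L^2(B^{R-s}_{x_0})}\,ds .$$ In particular, SS solutions are unique: two SS solutions of $(*)$ with the same $g$ and the same $\xi_0$ satisfy $\xi_{u_1}(t)=\xi_{u_2}(t)$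 for all $t\ge0$. -/

import Mathlib

open MeasureTheory Filter Topology Set
open scoped ENNReal NNReal ContDiff

namespace WaveR3

/-- Three-dimensional Euclidean space. -/
abbrev E3 : Type := EuclideanSpace ℝ (Fin 3)

/-- Lebesgue measure on the open ball of radius `R` centred at `x₀`
(the zero measure if `R ≤ 0`). -/
noncomputable def ballMeasure (x₀ : E3) (R : ℝ) : Measure E3 :=
  (volume : Measure E3).restrict (Metric.ball x₀ R)

/-- The assumption on the nonlinearity: `f` is `C²`, `f(z) = z⁵ + h(z)`, `h(0) = 0` and
`|h''(z)| ≤ C (1 + |z|^q)` for some exponent `0 ≤ q < 3`. -/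
def QuinticNonlinearity (f : ℝ → ℝ) : Prop :=
  ContDiff ℝ 2 f ∧
    ∃ (h : ℝ → ℝ) (C q : ℝ), 0 ≤ q ∧ q < 3 ∧
      (∀ z, f z = z ^ 5 + h z) ∧
      (∀ z, |iteratedDeriv 2 h z| ≤ C * (1 + |z| ^ q)) ∧
      h 0 = 0

/-- `D` is the weak (distributional) gradient of `w` on the whole space. -/
structure IsWeakGradient (w : E3 → ℝ) (D : E3 → E3) : Prop where
  locallyIntegrable : LocallyIntegrable w volume
  locallyIntegrable_grad : LocallyIntegrable D volume
  integral_eq : ∀ φ : E3 → ℝ, ContDiff ℝ ∞ φ → HasCompactSupport φ →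
    ∫ x, w x • gradient φ x = -∫ x, φ x • D x

open Classical in
/-- The weak gradient of `w`, unique up to null sets when it exists
(and `0` by convention when there is none). -/
noncomputable def weakGradient (w : E3 → ℝ) : E3 → E3 :=
  if h : ∃ D, IsWeakGradient w D then h.choose else 0

/-- The local energy space: `(a, b) ∈ H¹_loc(ℝ³) × L²_loc(ℝ³)`. -/
structure MemEnergyLoc (a b : E3 → ℝ) : Prop where
  hasWeakGradient : ∃ D, IsWeakGradient a D
  memLp : ∀ R : ℝ, MemLp a 2 (ballMeasure 0 R)
  memLp_grad : ∀ R : ℝ, MemLp (weakGradient a) 2 (ballMeasure 0 R)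
  memLp_snd : ∀ R : ℝ, MemLp b 2 (ballMeasure 0 R)

/-- The local energy norm of `(a, b)`, i.e. the norm of `H¹(B) × L²(B)` on the ball
`B` of radius `R` centred at `x₀`:
`(‖a‖²_{L²(B)} + ‖∇a‖²_{L²(B)} + ‖b‖²_{L²(B)})^{1/2}`. It is used for pairs in the local
energy space only. -/
noncomputable def energyNorm (x₀ : E3) (R : ℝ) (a b : E3 → ℝ) : ℝ≥0∞ :=
  (eLpNorm a 2 (ballMeasure x₀ R) ^ 2 + eLpNorm (weakGradient a) 2 (ballMeasure x₀ R) ^ 2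
    + eLpNorm b 2 (ballMeasure x₀ R) ^ 2) ^ (1 / 2 : ℝ)

/-- The curve `t ↦ (u(t), v(t))` belongs to `C([0,∞); H¹_loc × L²_loc)`. -/
structure ContinuousEnergyLoc (u v : ℝ → E3 → ℝ) : Prop where
  mem : ∀ t : ℝ, 0 ≤ t → MemEnergyLoc (u t) (v t)
  continuous : ∀ R t₀ : ℝ, 0 ≤ t₀ →
    Tendsto (fun t => energyNorm 0 R (u t - u t₀) (v t - v t₀)) (𝓝[Ici 0] t₀) (𝓝 0)

/-- `w ∈ L^p_loc([0,∞); L^q_loc(ℝ³))`. -/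
structure MemLpLoc (p q : ℝ≥0∞) (w : ℝ → E3 → ℝ) : Prop where
  aestronglyMeasurable : AEStronglyMeasurable (fun z : ℝ × E3 => w z.1 z.2)
    ((volume : Measure (ℝ × E3)).restrict (Ioi 0 ×ˢ univ))
  norm_lt_top : ∀ T R : ℝ,
    eLpNorm (fun t => eLpNorm (w t) q (ballMeasure 0 R)) p (volume.restrict (Ioo 0 T)) < ⊤

/-- Test functions: `φ ∈ C₀^∞((0,∞) × ℝ³)`. -/
structure IsTest (φ : ℝ × E3 → ℝ) : Prop where
  contDiff : ContDiff ℝ ∞ φ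
  hasCompactSupport : HasCompactSupport φ
  tsupport_subset : tsupport φ ⊆ Ioi 0 ×ˢ univ

/-- The partial derivative `∂ₜ φ (t, x)`. -/
noncomputable def dt (φ : ℝ × E3 → ℝ) (t : ℝ) (x : E3) : ℝ := deriv (fun s => φ (s, x)) t

/-- The spatial gradient `∇ₓ φ (t, x)`. -/
noncomputable def gradx (φ : ℝ × E3 → ℝ) (t : ℝ) (x : E3) : E3 := gradient (fun y => φ (t, y)) x

/-- `v = ∂ₜ u` in the sense of distributions on `(0,∞) × ℝ³`. -/
def IsTimeDerivative (u v : ℝ → E3 → ℝ) : Prop :=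
  ∀ φ, IsTest φ →
    ∫ t in Ioi (0 : ℝ), ∫ x, u t x * dt φ t x = -∫ t in Ioi (0 : ℝ), ∫ x, v t x * φ (t, x)

/-- The weak form of `∂ₜ² u + γ ∂ₜ u - Δ u + u + f(u) = g` on `(0,∞) × ℝ³`, with `v = ∂ₜ u`. -/
def IsWeakSolution (γ : ℝ) (f : ℝ → ℝ) (g u v : ℝ → E3 → ℝ) : Prop :=
  ∀ φ, IsTest φ →
    -(∫ t in Ioi (0 : ℝ), ∫ x, v t x * dt φ t x)
      + γ * (∫ t in Ioi (0 : ℝ), ∫ x, v t x * φ (t, x))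
      + (∫ t in Ioi (0 : ℝ), ∫ x, inner ℝ (weakGradient (u t) x) (gradx φ t x))
      + (∫ t in Ioi (0 : ℝ), ∫ x, u t x * φ (t, x))
      + (∫ t in Ioi (0 : ℝ), ∫ x, f (u t x) * φ (t, x))
      = ∫ t in Ioi (0 : ℝ), ∫ x, g t x * φ (t, x)

/-- `u`, with time derivative `v = ∂ₜ u`, is a Shatah-Struwe solution of
`∂ₜ² u + γ ∂ₜ u + (-Δ + 1) u + f(u) = g`, `(u, ∂ₜ u)|_{t=0} = (a, b)`, where
`g ∈ L¹_loc([0,∞); L²_loc)`. -/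
structure IsSSSolution (γ : ℝ) (f : ℝ → ℝ) (g : ℝ → E3 → ℝ) (a b : E3 → ℝ)
    (u v : ℝ → E3 → ℝ) : Prop where
  force_mem : MemLpLoc 1 2 g
  continuous : ContinuousEnergyLoc u v
  timeDerivative : IsTimeDerivative u v
  initial_fst : u 0 =ᵐ[volume] a
  initial_snd : v 0 =ᵐ[volume] b
  weak : IsWeakSolution γ f g u v
  strichartz : MemLpLoc 4 12 u

/-- The Strichartz norm `L⁴(0,R; L¹²(B^{R-s}_{x₀}))` of `u` over the cone with base
`B^R_{x₀}`. -/
noncomputable def coneStrichartzNorm (x₀ : E3) (R : ℝ) (u : ℝ → E3 → ℝ) : ℝ≥0∞ :=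
  eLpNorm (fun s => eLpNorm (u s) 12 (ballMeasure x₀ (R - s))) 4 (volume.restrict (Ioo 0 R))

end WaveR3

/-! The difference w = u₁ - u₂ solves a linear damped Klein–Gordon equation with force G = (g₁ - g₂)
- (f(u₁) - f(u₂)). Finite speed of propagation gives an energy inequality in the backward cone
(`IntegratedWave.eLpNorm_le`): the L² norms of w, ∂ₜw, ∇w over the slice B^{R-t} are bounded by
their initial values over B^R plus 2∫‖G(s)‖_{L²(B^{R-s})} ds. Since f' grows at most like 1 + |u|⁴,
Hölder with 1/2 = 1/3 + 1/6 bounds f(u₁) - f(u₂) in L² of a slice by C(‖w‖₂ + (‖u₁‖₁₂⁴ +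
‖u₂‖₁₂⁴)‖w‖₆), and the Strichartz hypothesis says that the time integral of ‖uᵢ‖₁₂⁴ is at most M⁴.
Once ‖w‖₆ is bounded by the energy, Grönwall with an integrable kernel closes the argument.

The delicate point is that the constants must not degenerate at the tip of the cone. Sobolev on a
ball of radius r reads ‖w‖₆ ≤ C(‖∇w‖₂ + ‖w‖₂/r), and r = R - t tends to 0. The remedy is
`IntegratedWave.eLpNorm_fst_le`: the L² norm of w over the slice is itself O(R - t). In the variable
y = (x - x₀)/(R - t), the function W(t, y) = w(t, x) satisfies ∂ₜW = ∂ₜw - y·∇w with |y| ≤ 1. An L²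
norm in y is (R - t)^{-3/2} times the one in x, and the integral of (R - s)^{-3/2} over (0, t) is at
most 2(R - t)^{-1/2}. Scaling back leaves exactly one power of R - t, which cancels the 1/r.

Both estimates follow one scheme. After mollification in space the equation holds pointwise in x,
with components absolutely continuous in time, so the square integrated against a C¹ weight ψ can be
differentiated (`weighted_identity`, `sqrt_weighted_le`). The energy estimate takes ψ to be a
smoothed indicator of the cone with |∇ψ| ≤ -∂ₜψ; the estimate at the tip takes (R - t)^{-3} cut off
to the cone, for which ∂ₜψ = div(ψ y). Fatou's lemma removes the mollifier
(`eLpNorm_le_of_mollify_le`).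

An SS solution enters this scheme because f(u) lies in L¹_loc(L²_loc) by the same Hölder and Sobolev
bounds, and because testing with products θ(t)k(x) turns the weak formulation into a time-integrated
one (`IsSSSolution.integratedWave`). Uniqueness applies the cone estimate to arbitrarily wide cones;
the local Strichartz norms are finite, so some M is always available. -/

namespace WaveR3

/-! ### Scale-invariant Sobolev inequality on balls, smooth case -/

/-- The fundamental theorem of calculus from 0 to s, averaged over s in [0, δ]. No decay of α is
needed; the price is the term α/δ. -/
theorem enorm_le_lintegral_segment {α : ℝ → ℝ} (hα : ContDiff ℝ 1 α) {δ : ℝ} (hδ : 0 < δ) :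
    ‖α 0‖ₑ ≤ ∫⁻ s in Icc 0 δ, (‖deriv α s‖ₑ + ‖α s‖ₑ / ENNReal.ofReal δ) := by
  have hδ0 : ENNReal.ofReal δ ≠ 0 := by simpa using hδ
  have hmd : Measurable fun s => ‖deriv α s‖ₑ := (hα.continuous_deriv le_rfl).measurable.enorm
  have h1 : ∀ s ∈ Icc 0 δ, ‖α 0‖ₑ ≤ ‖α s‖ₑ + ∫⁻ τ in Icc 0 δ, ‖deriv α τ‖ₑ := by
    intro s hs
    have h2 : α s - α 0 = ∫ τ in (0 : ℝ)..s, deriv α τ :=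
      (intervalIntegral.integral_deriv_eq_sub
        (fun x _ => (hα.differentiable one_ne_zero).differentiableAt)
        ((hα.continuous_deriv le_rfl).intervalIntegrable _ _)).symm
    have h3 : ‖α s - α 0‖ₑ ≤ ∫⁻ τ in Icc 0 δ, ‖deriv α τ‖ₑ := by
      rw [h2, intervalIntegral.integral_of_le hs.1]
      refine (enorm_integral_le_lintegral_enorm _).trans (lintegral_mono_set ?_)
      exact fun x hx => ⟨hx.1.le, hx.2.trans hs.2⟩
    calc ‖α 0‖ₑ = ‖α s - (α s - α 0)‖ₑ := by ring_nf
      _ ≤ ‖α s‖ₑ + ‖α s - α 0‖ₑ := enorm_sub_le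
      _ ≤ _ := by gcongr
  have h4 : ENNReal.ofReal δ * ‖α 0‖ₑ ≤ (∫⁻ s in Icc 0 δ, ‖α s‖ₑ)
      + ENNReal.ofReal δ * ∫⁻ τ in Icc 0 δ, ‖deriv α τ‖ₑ := by
    have h5 := setLIntegral_mono' (μ := volume) measurableSet_Icc h1
    rw [lintegral_add_right _ measurable_const] at h5
    simpa [mul_comm] using h5
  rw [lintegral_add_left hmd]
  simp_rw [div_eq_mul_inv]
  rw [lintegral_mul_const' _ _ (by simp [hδ])]
  calc ‖α 0‖ₑ = (ENNReal.ofReal δ * ‖α 0‖ₑ) * (ENNReal.ofReal δ)⁻¹ := by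
        rw [mul_comm (ENNReal.ofReal δ), mul_assoc, ENNReal.mul_inv_cancel hδ0 (by simp), mul_one]
    _ ≤ ((∫⁻ s in Icc 0 δ, ‖α s‖ₑ)
      + ENNReal.ofReal δ * ∫⁻ τ in Icc 0 δ, ‖deriv α τ‖ₑ) * (ENNReal.ofReal δ)⁻¹ := by gcongr
    _ = _ := by
        rw [add_mul, mul_comm (ENNReal.ofReal δ), mul_assoc _ (ENNReal.ofReal δ),
          ENNReal.mul_inv_cancel hδ0 (by simp), mul_one, add_comm]

/-- The Gagliardo–Nirenberg argument in the linear coordinates of `T`: at a point of S, |b| is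
bounded by the integral of one function G, supported in B, along each of the three coordinate lines.
The grid-lines inequality `lintegral_prod_lintegral_pow_le` bounds the integral of the product of
the three square roots by (∫ G)^{3/2}. Only short segments starting in S must lie in B, so no
extension operator is involved. -/
theorem sobolev_sector (T : (Fin 3 → ℝ) ≃L[ℝ] E3) :
    ∃ C : ℝ≥0, ∀ (b : E3 → ℝ), ContDiff ℝ 1 b → ∀ (S B : Set E3), MeasurableSet S →
      MeasurableSet B → ∀ δ : ℝ, 0 < δ →
      (∀ x ∈ S, ∀ i, ∀ s ∈ Icc 0 δ, x + s • T (Pi.single i 1) ∈ B) →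
      ∫⁻ x in S, ‖b x‖ₑ ^ (3 / 2 : ℝ) ≤ C * (∫⁻ x in B, (‖fderiv ℝ b x‖ₑ
        * ‖(T : (Fin 3 → ℝ) →L[ℝ] E3)‖ₑ + ‖b x‖ₑ / ENNReal.ofReal δ)) ^ (3 / 2 : ℝ) := by
  let ν : Measure E3 := Measure.map T volume
  -- Haar uniqueness gives constants of proportionality in both directions, which avoids computing
  -- the determinant of `T`.
  have hν : ν.IsAddHaarMeasure := T.isAddHaarMeasure_map volume
  let c := Measure.addHaarScalarFactor volume ν
  let c' := Measure.addHaarScalarFactor ν volume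
  have hc : (volume : Measure E3) = c • ν := Measure.isAddLeftInvariant_eq_smul _ _
  have hc' : ν = c' • (volume : Measure E3) := Measure.isAddLeftInvariant_eq_smul _ _
  have hT : MeasurableEmbedding T := T.toHomeomorph.measurableEmbedding
  have hc1 : ∀ (S : Set E3) (F : E3 → ℝ≥0∞),
      ∫⁻ x in S, F x = c * ∫⁻ y in T ⁻¹' S, F (T y) := by
    intro S F
    conv_lhs => rw [hc]
    rw [Measure.restrict_smul, hT.restrict_map, ← hT.lintegral_map]
    exact lintegral_smul_measure _ _
  have hc2 : ∀ F : E3 → ℝ≥0∞, ∫⁻ y, F (T y) = c' * ∫⁻ x, F x := by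
    intro F
    rw [← hT.lintegral_map]
    change ∫⁻ x, F x ∂ν = _
    rw [hc']
    exact lintegral_smul_measure _ _
  refine ⟨c * c' ^ (3 / 2 : ℝ), fun b hb S B hS hB δ hδ hSB => ?_⟩
  set K : ℝ≥0∞ := ‖(T : (Fin 3 → ℝ) →L[ℝ] E3)‖ₑ
  have hbm : Measurable b := hb.continuous.measurable
  have hdm : Measurable fun x => ‖fderiv ℝ b x‖ₑ :=
    (hb.continuous_fderiv one_ne_zero).measurable.enorm
  set G : E3 → ℝ≥0∞ :=
    B.indicator fun x => ‖fderiv ℝ b x‖ₑ * K + ‖b x‖ₑ / ENNReal.ofReal δ with hG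
  have hGm : Measurable G := by
    refine Measurable.indicator ?_ hB
    exact (hdm.mul_const _).add (hbm.enorm.div_const _)
  have hline : ∀ y : Fin 3 → ℝ, T y ∈ S → ∀ i,
      ‖b (T y)‖ₑ ≤ ∫⁻ s, G (T (Function.update y i s)) := by
    intro y hy i
    have hupd : ∀ s, T (Function.update y i (s + y i)) = T y + s • T (Pi.single i 1) := by
      intro s
      rw [← map_smul, ← map_add]
      congr 1
      ext j
      by_cases hj : j = i
      · subst hj; simp [add_comm]
      · simp [hj]
    have hα : ContDiff ℝ 1 fun s : ℝ => b (T y + s • T (Pi.single i 1)) :=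
      hb.comp (contDiff_const.add (contDiff_id.smul contDiff_const))
    have h1 := enorm_le_lintegral_segment hα hδ
    simp only [zero_smul, add_zero] at h1
    rw [← lintegral_add_right_eq_self _ (y i)]
    simp_rw [hupd]
    refine h1.trans (le_trans ?_ (setLIntegral_le_lintegral (Icc 0 δ) _))
    refine setLIntegral_mono' measurableSet_Icc fun s hs => ?_
    have hm : T y + s • T (Pi.single i 1) ∈ B := hSB _ hy i s hs
    simp only [hG, indicator_of_mem hm]
    gcongr
    have hder : HasDerivAt (fun s : ℝ => b (T y + s • T (Pi.single i 1)))
        (fderiv ℝ b (T y + s • T (Pi.single i 1)) (T (Pi.single i 1))) s := by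
      have h2 : HasDerivAt (fun s : ℝ => T y + s • T (Pi.single i 1)) (T (Pi.single i 1)) s := by
        simpa using ((hasDerivAt_id s).smul_const (T (Pi.single i 1))).const_add (T y)
      exact ((hb.differentiable one_ne_zero).differentiableAt.hasFDerivAt).comp_hasDerivAt s h2
    rw [hder.deriv]
    refine (ContinuousLinearMap.le_opENorm _ _).trans ?_
    gcongr
    refine (ContinuousLinearMap.le_opENorm (T : (Fin 3 → ℝ) →L[ℝ] E3) (Pi.single i 1)).trans ?_
    simp [K, Pi.enorm_single]
  have hp : Real.HolderConjugate (Fintype.card (Fin 3)) (3 / 2) := by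
    rw [Real.holderConjugate_iff]; norm_num
  have hgrid := lintegral_prod_lintegral_pow_le (fun _ : Fin 3 => (volume : Measure ℝ)) hp
    (hGm.comp T.continuous.measurable)
  calc ∫⁻ x in S, ‖b x‖ₑ ^ (3 / 2 : ℝ)
      = c * ∫⁻ y in T ⁻¹' S, ‖b (T y)‖ₑ ^ (3 / 2 : ℝ) := by
        rw [hc1]
    _ ≤ c * ∫⁻ y, ∏ i, (∫⁻ s, G (T (Function.update y i s))) ^ ((1 : ℝ) / ((3 : ℕ) - 1 : ℝ)) := by
        refine mul_le_mul_right ?_ _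
        refine le_trans ?_ (setLIntegral_le_lintegral (T ⁻¹' S) _)
        refine setLIntegral_mono' (T.continuous.measurable hS) fun y hy => ?_
        rw [Fin.prod_univ_three]
        have h := hline y hy
        calc ‖b (T y)‖ₑ ^ (3 / 2 : ℝ) = ‖b (T y)‖ₑ ^ ((1 : ℝ) / ((3 : ℕ) - 1 : ℝ))
              * ‖b (T y)‖ₑ ^ ((1 : ℝ) / ((3 : ℕ) - 1 : ℝ))
              * ‖b (T y)‖ₑ ^ ((1 : ℝ) / ((3 : ℕ) - 1 : ℝ)) := by
              rw [← ENNReal.rpow_add_of_nonneg _ _ (by norm_num) (by norm_num),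
                ← ENNReal.rpow_add_of_nonneg _ _ (by norm_num) (by norm_num)]
              norm_num
          _ ≤ _ := by
            have := h 0; have := h 1; have := h 2
            gcongr
    _ ≤ c * (∫⁻ y, G (T y)) ^ (3 / 2 : ℝ) := by
        refine mul_le_mul_right ?_ _
        rw [← volume_pi] at hgrid
        simpa using hgrid
    _ = c * (c' * ∫⁻ x, G x) ^ (3 / 2 : ℝ) := by
        rw [hc2]
    _ = _ := by
        rw [ENNReal.mul_rpow_of_nonneg _ _ (by norm_num), ← mul_assoc, lintegral_indicator hB]
        rw [ENNReal.coe_mul, ENNReal.coe_rpow_of_nonneg _ (by norm_num)]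


/-- The directions are independent: if ∑ yᵢ(eᵢ/2 - σeⱼ) = 0, summing coordinates gives (∑ y)/2 = σ ∑
y, so ∑ y = 0 because |σ| = 1, and then every yᵢ vanishes. All three point inward where σzⱼ is the
dominant coordinate. -/
theorem exists_sector_equiv (j : Fin 3) (σ : ℝ) (hσ : |σ| = 1) :
    ∃ T : (Fin 3 → ℝ) ≃L[ℝ] E3, ∀ i, T (Pi.single i 1) =
      EuclideanSpace.single i (1 / 2 : ℝ) - EuclideanSpace.single j σ := by
  let L : (Fin 3 → ℝ) →ₗ[ℝ] E3 :=
    { toFun := fun y => WithLp.toLp 2 fun k => y k / 2 - (∑ i, y i) * (Pi.single j σ : Fin 3 → ℝ) k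
      map_add' := by
        intro y z
        ext k
        simp only [Pi.add_apply, PiLp.add_apply, Finset.sum_add_distrib]
        ring
      map_smul' := by
        intro c y
        ext k
        simp only [Pi.smul_apply, PiLp.smul_apply, smul_eq_mul, ← Finset.mul_sum, RingHom.id_apply]
        ring }
  have hL : ∀ y k, L y k = y k / 2 - (∑ i, y i) * (Pi.single j σ : Fin 3 → ℝ) k := fun _ _ => rfl
  have hinj : Function.Injective L := by
    rw [← LinearMap.ker_eq_bot, LinearMap.ker_eq_bot']
    intro y hy
    have h1 : ∀ k, y k / 2 = (∑ i, y i) * Pi.single (M := fun _ => ℝ) j σ k := by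
      intro k
      have := hL y k
      rw [hy] at this
      simp only [PiLp.zero_apply] at this
      linarith
    have h2 : (∑ i, y i) / 2 = (∑ i, y i) * σ := by
      rw [Finset.sum_div, Finset.sum_congr rfl fun k _ => h1 k, ← Finset.mul_sum]
      simp
    have h3 : ∑ i, y i = 0 := by
      rcases eq_or_eq_neg_of_abs_eq hσ with h | h <;> rw [h] at h2 <;> linarith
    ext k
    have := h1 k
    rw [h3] at this
    simpa using this
  let e : (Fin 3 → ℝ) ≃ₗ[ℝ] E3 := LinearEquiv.ofInjectiveOfFinrankEq L hinj (by simp)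
  refine ⟨e.toContinuousLinearEquiv, fun i => ?_⟩
  ext k
  have h1 : e.toContinuousLinearEquiv (Pi.single i 1) k = L (Pi.single i 1) k := rfl
  rw [h1, hL]
  by_cases h : k = i <;> by_cases h' : k = j <;> simp [Pi.single_apply, h, h'] <;> ring_nf <;> simp_all

/-- With m = σzⱼ and d the direction, z·d ≤ m/2 - m = -m/2 and |d|² ≤ 9/4, so |z + sd|² ≤ |z|² - sm
+ (9/4)s². If (9/4)s ≤ m this does not exceed |z|². Otherwise |z|² ≤ 3m² is itself O(s²), and s ≤
r/6 makes the whole smaller than r². -/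
theorem add_smul_mem_ball {x₀ x : E3} {r : ℝ} (hx : x ∈ Metric.ball x₀ r) {j : Fin 3} {σ : ℝ}
    (hσ : |σ| = 1) (hS : ∀ k, |x k - x₀ k| ≤ σ * (x j - x₀ j)) (i : Fin 3) {s : ℝ}
    (hs : s ∈ Icc 0 (r / 6)) :
    x + s • (EuclideanSpace.single i (1 / 2 : ℝ) - EuclideanSpace.single j σ) ∈
      Metric.ball x₀ r := by
  rw [mem_ball_iff_norm] at hx ⊢
  set z := x - x₀ with hz
  set d : E3 := EuclideanSpace.single i (1 / 2 : ℝ) - EuclideanSpace.single j σ with hd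
  have hr : 0 < r := (norm_nonneg _).trans_lt hx
  rw [show x + s • d - x₀ = z + s • d by rw [hz]; abel]
  set m := σ * (x j - x₀ j) with hm
  have hm0 : 0 ≤ m := (abs_nonneg _).trans (hS j)
  have hzk : ∀ k, z k ^ 2 ≤ m ^ 2 := fun k => sq_le_sq' (abs_le.1 (hS k)).1 (abs_le.1 (hS k)).2
  have hz2 : ‖z‖ ^ 2 ≤ 3 * m ^ 2 := by
    rw [EuclideanSpace.real_norm_sq_eq, Fin.sum_univ_three]
    linarith [hzk 0, hzk 1, hzk 2]
  have hd2 : ‖d‖ ≤ 3 / 2 := by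
    refine (norm_sub_le _ _).trans ?_
    simp [hσ]
    norm_num
  have hin : inner ℝ z d ≤ -(m / 2) := by
    rw [hd, inner_sub_right, EuclideanSpace.inner_single_right, EuclideanSpace.inner_single_right]
    simp only [conj_trivial]
    have h1 : z i ≤ m := (abs_le.1 (hS i)).2
    have h2 : σ * z j = m := rfl
    linarith
  have hexp : ‖z + s • d‖ ^ 2 = ‖z‖ ^ 2 + 2 * (s * inner ℝ z d) + s ^ 2 * ‖d‖ ^ 2 := by
    rw [norm_add_sq_real, inner_smul_right, norm_smul, mul_pow, Real.norm_eq_abs, sq_abs]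
  have hd3 : ‖d‖ ^ 2 ≤ 9 / 4 := by nlinarith [norm_nonneg d]
  have hsd : s ^ 2 * ‖d‖ ^ 2 ≤ s ^ 2 * (9 / 4) := by gcongr
  have hsi : s * inner ℝ z d ≤ s * (-(m / 2)) := mul_le_mul_of_nonneg_left hin hs.1
  refine lt_of_pow_lt_pow_left₀ 2 hr.le ?_
  by_cases hcase : 9 / 4 * s ≤ m
  · have : ‖z‖ ^ 2 < r ^ 2 := by gcongr
    nlinarith [hs.1]
  · push Not at hcase
    have h1 : m ^ 2 ≤ (9 / 4 * s) ^ 2 := by gcongr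
    have h2 : s ^ 2 ≤ (r / 6) ^ 2 := by have := hs.1; have := hs.2; gcongr
    nlinarith [hs.1, mul_nonneg hs.1 hm0]

theorem exists_sector (z : E3) : ∃ (j : Fin 3) (σ : ℝ), σ ∈ ({1, -1} : Finset ℝ) ∧
    ∀ k, |z k| ≤ σ * z j := by
  obtain ⟨j, -, hj⟩ := Finset.exists_max_image Finset.univ (fun k => |z k|) ⟨0, Finset.mem_univ _⟩
  rcases le_total 0 (z j) with h | h
  · exact ⟨j, 1, by simp, fun k => by simpa [abs_of_nonneg h] using hj k (Finset.mem_univ _)⟩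
  · exact ⟨j, -1, by simp, fun k => by simpa [abs_of_nonpos h] using hj k (Finset.mem_univ _)⟩

theorem lintegral_biUnion_finset_le {α ι : Type*} [MeasurableSpace α] {μ : Measure α}
    (s : Finset ι) (t : ι → Set α) (f : α → ℝ≥0∞) :
    ∫⁻ x in ⋃ i ∈ s, t i, f x ∂μ ≤ ∑ i ∈ s, ∫⁻ x in t i, f x ∂μ := by
  classical
  induction s using Finset.induction_on with
  | empty => simp
  | insert a s ha ih =>
    rw [Finset.set_biUnion_insert, Finset.sum_insert ha]
    exact (lintegral_union_le _ _ _).trans (by gcongr)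

/-- The embedding of W^{1,1} into L^{3/2}. Six sectors, one for each dominant coordinate and sign,
cover the ball, and from each of them segments with parameter up to r/6 in three independent
directions stay inside. The directions do not depend on r, so neither does the constant. -/
theorem sobolev_ball_one : ∃ C : ℝ≥0, ∀ (b : E3 → ℝ), ContDiff ℝ 1 b → ∀ (x₀ : E3) (r : ℝ), 0 < r →
    ∫⁻ x in Metric.ball x₀ r, ‖b x‖ₑ ^ (3 / 2 : ℝ) ≤ C * (∫⁻ x in Metric.ball x₀ r,
      (‖fderiv ℝ b x‖ₑ + ‖b x‖ₑ / ENNReal.ofReal r)) ^ (3 / 2 : ℝ) := by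
  have key : ∀ (j : Fin 3) (σ : ℝ), σ ∈ ({1, -1} : Finset ℝ) → ∃ C : ℝ≥0, ∀ (b : E3 → ℝ),
      ContDiff ℝ 1 b → ∀ (x₀ : E3) (r : ℝ), 0 < r →
      ∫⁻ x in {x ∈ Metric.ball x₀ r | ∀ k, |x k - x₀ k| ≤ σ * (x j - x₀ j)}, ‖b x‖ₑ ^ (3 / 2 : ℝ)
      ≤ C * (∫⁻ x in Metric.ball x₀ r,
      (‖fderiv ℝ b x‖ₑ + ‖b x‖ₑ / ENNReal.ofReal r)) ^ (3 / 2 : ℝ) := by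
    intro j σ hσ
    have hσ' : |σ| = 1 := by
      simp only [Finset.mem_insert, Finset.mem_singleton] at hσ
      rcases hσ with rfl | rfl <;> simp
    obtain ⟨T, hT⟩ := exists_sector_equiv j σ hσ'
    obtain ⟨C, hC⟩ := sobolev_sector T
    set K := ‖(T : (Fin 3 → ℝ) →L[ℝ] E3)‖₊ with hK
    -- `K` is the operator norm multiplying the gradient, and 6 comes from dividing by δ = r/6.
    refine ⟨C * (K + 6) ^ (3 / 2 : ℝ), fun b hb x₀ r hr => ?_⟩
    refine (hC b hb _ (Metric.ball x₀ r) ?_ measurableSet_ball (r / 6) (by positivity) ?_).trans ?_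
    · refine measurableSet_ball.inter ?_
      have h : {x : E3 | ∀ k, |x k - x₀ k| ≤ σ * (x j - x₀ j)} =
          ⋂ k, {x : E3 | |x k - x₀ k| ≤ σ * (x j - x₀ j)} := by ext; simp
      refine IsClosed.measurableSet ?_
      change IsClosed {x : E3 | ∀ k, |x k - x₀ k| ≤ σ * (x j - x₀ j)}
      rw [h]
      exact isClosed_iInter fun k => isClosed_le (by fun_prop) (by fun_prop)
    · intro x hx i s hs
      rw [hT]
      exact add_smul_mem_ball hx.1 hσ' hx.2 i hs
    · rw [ENNReal.coe_mul, ENNReal.coe_rpow_of_nonneg _ (by norm_num), mul_assoc,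
        ← ENNReal.mul_rpow_of_nonneg _ _ (by norm_num)]
      gcongr
      rw [← lintegral_const_mul' _ _ ENNReal.coe_ne_top]
      refine lintegral_mono fun x => ?_
      have h6 : ENNReal.ofReal (r / 6) = ENNReal.ofReal r / 6 := by
        rw [ENNReal.ofReal_div_of_pos (by norm_num)]; simp
      have hr0 : ENNReal.ofReal r ≠ 0 := by simpa using hr
      have h7 : ‖b x‖ₑ / ENNReal.ofReal (r / 6) = 6 * (‖b x‖ₑ / ENNReal.ofReal r) := by
        rw [h6, div_eq_mul_inv, ENNReal.inv_div (by simp) (by simp)]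
        rw [div_eq_mul_inv, div_eq_mul_inv]; ring
      simp only [h7]
      rw [mul_add]
      refine add_le_add ?_ ?_
      · rw [mul_comm]; gcongr
        simp [hK, enorm_eq_nnnorm]
      · gcongr; simp
  choose! C hC using key
  refine ⟨∑ j : Fin 3, ∑ σ ∈ ({1, -1} : Finset ℝ), C j σ, fun b hb x₀ r hr => ?_⟩
  have hcover : Metric.ball x₀ r ⊆ ⋃ p ∈ (Finset.univ : Finset (Fin 3)) ×ˢ ({1, -1} : Finset ℝ),
      {x ∈ Metric.ball x₀ r | ∀ k, |x k - x₀ k| ≤ p.2 * (x p.1 - x₀ p.1)} := by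
    intro x hx
    obtain ⟨j, σ, hσ, h⟩ := exists_sector (x - x₀)
    simp only [mem_iUnion]
    exact ⟨(j, σ), Finset.mem_product.2 ⟨Finset.mem_univ _, hσ⟩, hx, h⟩
  refine (lintegral_mono_set hcover).trans ?_
  have hsum := lintegral_biUnion_finset_le (μ := volume)
    ((Finset.univ : Finset (Fin 3)) ×ˢ ({1, -1} : Finset ℝ))
    (fun p => {x ∈ Metric.ball x₀ r | ∀ k, |x k - x₀ k| ≤ p.2 * (x p.1 - x₀ p.1)})
    (fun x => ‖b x‖ₑ ^ (3 / 2 : ℝ))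
  refine hsum.trans ?_
  rw [ENNReal.ofNNReal_finsetSum]
  simp_rw [ENNReal.ofNNReal_finsetSum]
  rw [← Finset.sum_product', Finset.sum_mul]
  refine Finset.sum_le_sum fun p hp => ?_
  exact hC p.1 p.2 (Finset.mem_product.1 hp).2 b hb x₀ r hr


/-- The Sobolev inequality on balls, with constant independent of the radius. -/
theorem sobolev_ball : ∃ C : ℝ≥0, ∀ (a : E3 → ℝ), ContDiff ℝ 1 a → ∀ (x₀ : E3) (r : ℝ), 0 < r →
    eLpNorm a 6 (ballMeasure x₀ r) ≤ C * (eLpNorm (fderiv ℝ a) 2 (ballMeasure x₀ r)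
      + eLpNorm a 2 (ballMeasure x₀ r) / ENNReal.ofReal r) := by
  obtain ⟨C, hC⟩ := sobolev_ball_one
  refine ⟨(C * 4 ^ (3 / 2 : ℝ)) ^ (2 / 3 : ℝ), fun a ha x₀ r hr => ?_⟩
  set μ := ballMeasure x₀ r with hμ
  have hr0 : ENNReal.ofReal r ≠ 0 := by simpa using hr
  have ham : Measurable a := ha.continuous.measurable
  have hdm : Measurable fun x => ‖fderiv ℝ a x‖ₑ :=
    (ha.continuous_fderiv one_ne_zero).measurable.enorm
  set X := ∫⁻ x, ‖a x‖ₑ ^ (6 : ℝ) ∂μ with hX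
  set g : E3 → ℝ≥0∞ := fun x => ‖fderiv ℝ a x‖ₑ + ‖a x‖ₑ / ENNReal.ofReal r with hg
  have hgm : Measurable g := hdm.add (ham.enorm.div_const _)
  set N := (∫⁻ x, g x ^ (2 : ℝ) ∂μ) ^ (1 / 2 : ℝ) with hN
  -- Finiteness is what allows the cancellation of X^{3/4} below.
  have hXtop : X ≠ ⊤ := by
    obtain ⟨M, hM⟩ := (isCompact_closedBall x₀ r).exists_bound_of_continuousOn
      ha.continuous.continuousOn
    have h1 : X ≤ ∫⁻ x, ENNReal.ofReal M ^ (6 : ℝ) ∂μ := by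
      refine setLIntegral_mono' measurableSet_ball fun x hx => ?_
      gcongr
      rw [← ofReal_norm]
      exact ENNReal.ofReal_le_ofReal (hM x (Metric.ball_subset_closedBall hx))
    refine ne_top_of_le_ne_top ?_ h1
    rw [lintegral_const]
    refine ENNReal.mul_ne_top (ENNReal.rpow_ne_top_of_nonneg (by norm_num) (by simp)) ?_
    simp only [hμ, ballMeasure, Measure.restrict_apply_univ]
    exact measure_ball_lt_top.ne
  have hder : ∀ x, ‖fderiv ℝ (fun y => a y ^ 4) x‖ₑ ≤ 4 * (‖a x‖ₑ ^ (3 : ℝ) * ‖fderiv ℝ a x‖ₑ) := by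
    intro x
    have h1 : fderiv ℝ (fun y => a y ^ 4) x = (4 * a x ^ 3) • fderiv ℝ a x := by
      rw [fderiv_fun_pow _ (ha.differentiable one_ne_zero).differentiableAt]
      norm_num
    rw [h1, enorm_smul, enorm_mul, enorm_pow, ← mul_assoc]
    gcongr
    · simp [enorm_eq_nnnorm]
    · exact_mod_cast le_rfl
  have hpow : ∀ x, ‖a x ^ 4‖ₑ = ‖a x‖ₑ ^ (3 : ℝ) * ‖a x‖ₑ := by
    intro x
    rw [enorm_pow]
    have : ‖a x‖ₑ ^ (3 : ℝ) = ‖a x‖ₑ ^ 3 := by exact_mod_cast ENNReal.rpow_natCast _ 3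
    rw [this]; ring
  -- The W^{1,1} inequality is applied to a⁴, because (|a|⁴)^{3/2} = |a|⁶ and |∇a⁴| = 4|a|³|∇a|.
  -- Cauchy–Schwarz then brings back |a|⁶ with the power 1/2, hence X^{3/4} on the right.
  have h1 : X ≤ C * (4 * ∫⁻ x, ‖a x‖ₑ ^ (3 : ℝ) * g x ∂μ) ^ (3 / 2 : ℝ) := by
    have h2 := hC (fun x => a x ^ 4) (ha.pow 4) x₀ r hr
    have h3 : ∫⁻ x in Metric.ball x₀ r, ‖a x ^ 4‖ₑ ^ (3 / 2 : ℝ) = X := by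
      rw [hX]
      refine lintegral_congr fun x => ?_
      rw [enorm_pow, ← ENNReal.rpow_natCast, ← ENNReal.rpow_mul]
      norm_num
    rw [h3] at h2
    refine h2.trans ?_
    rw [← lintegral_const_mul' _ _ (by norm_num)]
    refine mul_le_mul_right (ENNReal.rpow_le_rpow (lintegral_mono fun x => ?_) (by norm_num)) _
    change _ ≤ 4 * (‖a x‖ₑ ^ (3 : ℝ) * (‖fderiv ℝ a x‖ₑ + ‖a x‖ₑ / ENNReal.ofReal r))
    simp only [mul_add]
    gcongr
    · exact hder x
    · rw [hpow, mul_div_assoc]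
      exact le_mul_of_one_le_left' (by norm_num)
  have h2 : ∫⁻ x, ‖a x‖ₑ ^ (3 : ℝ) * g x ∂μ ≤ X ^ (1 / 2 : ℝ) * N := by
    have := ENNReal.lintegral_mul_le_Lp_mul_Lq μ (p := 2) (q := 2)
      (by rw [Real.holderConjugate_iff]; norm_num)
      (f := fun x => ‖a x‖ₑ ^ (3 : ℝ)) (g := g) (ham.enorm.pow_const _).aemeasurable
      hgm.aemeasurable
    refine this.trans_eq ?_
    congr 2
    refine lintegral_congr fun x => ?_
    rw [← ENNReal.rpow_mul]; norm_num
  have h3 : X ≤ (C * 4 ^ (3 / 2 : ℝ)) * X ^ (3 / 4 : ℝ) * N ^ (3 / 2 : ℝ) := by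
    refine h1.trans ?_
    calc (C : ℝ≥0∞) * (4 * ∫⁻ x, ‖a x‖ₑ ^ (3 : ℝ) * g x ∂μ) ^ (3 / 2 : ℝ)
        ≤ C * (4 * (X ^ (1 / 2 : ℝ) * N)) ^ (3 / 2 : ℝ) := by gcongr
      _ = _ := by
        rw [ENNReal.mul_rpow_of_nonneg _ _ (by norm_num),
          ENNReal.mul_rpow_of_nonneg _ _ (by norm_num), ← ENNReal.rpow_mul]
        norm_num [mul_assoc]
  have h4 : X ^ (1 / 4 : ℝ) ≤ (C * 4 ^ (3 / 2 : ℝ)) * N ^ (3 / 2 : ℝ) := by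
    by_cases hX0 : X = 0
    · rw [hX0, ENNReal.zero_rpow_of_pos (by norm_num)]; exact zero_le
    have h5 : X ^ (3 / 4 : ℝ) ≠ 0 := by
      rw [Ne, ENNReal.rpow_eq_zero_iff]; simp [hX0, hXtop]
    have h6 : X ^ (3 / 4 : ℝ) ≠ ⊤ := ENNReal.rpow_ne_top_of_nonneg (by norm_num) hXtop
    rw [← ENNReal.mul_le_mul_iff_right h5 h6, ← ENNReal.rpow_add _ _ hX0 hXtop]
    norm_num
    refine h3.trans_eq ?_
    ring
  have h7 : eLpNorm a 6 μ = X ^ (1 / 6 : ℝ) := by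
    rw [eLpNorm_eq_lintegral_rpow_enorm_toReal (by norm_num) (by norm_num)]
    simp [hX]
  have h8 : N ≤ eLpNorm (fderiv ℝ a) 2 μ + eLpNorm a 2 μ / ENNReal.ofReal r := by
    have h9 := ENNReal.lintegral_Lp_add_le (μ := μ) (p := 2) hdm.aemeasurable
      (ham.enorm.div_const (ENNReal.ofReal r)).aemeasurable (by norm_num)
    refine h9.trans_eq ?_
    rw [eLpNorm_eq_lintegral_rpow_enorm_toReal (by norm_num) (by norm_num),
      eLpNorm_eq_lintegral_rpow_enorm_toReal (by norm_num) (by norm_num)]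
    congr 1
    simp only [ENNReal.toReal_ofNat, div_eq_mul_inv]
    simp_rw [ENNReal.mul_rpow_of_nonneg _ _ (zero_le_two : (0 : ℝ) ≤ 2)]
    rw [lintegral_mul_const' _ _ (ENNReal.rpow_ne_top_of_nonneg (by norm_num) (by simp [hr])),
      ENNReal.mul_rpow_of_nonneg _ _ (by norm_num), ← ENNReal.rpow_mul]
    norm_num
  rw [h7]
  have hcoe : (((C * 4 ^ (3 / 2 : ℝ)) ^ (2 / 3 : ℝ) : ℝ≥0) : ℝ≥0∞) =
      (C * 4 ^ (3 / 2 : ℝ)) ^ (2 / 3 : ℝ) := by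
    rw [ENNReal.coe_rpow_of_nonneg _ (by norm_num), ENNReal.coe_mul,
      ENNReal.coe_rpow_of_nonneg _ (by norm_num)]
    norm_num
  rw [hcoe]
  calc X ^ (1 / 6 : ℝ) = (X ^ (1 / 4 : ℝ)) ^ (2 / 3 : ℝ) := by rw [← ENNReal.rpow_mul]; norm_num
    _ ≤ ((C * 4 ^ (3 / 2 : ℝ)) * N ^ (3 / 2 : ℝ)) ^ (2 / 3 : ℝ) := by gcongr
    _ = (C * 4 ^ (3 / 2 : ℝ)) ^ (2 / 3 : ℝ) * N := by
      rw [ENNReal.mul_rpow_of_nonneg _ _ (by norm_num), ← ENNReal.rpow_mul]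
      norm_num
    _ ≤ _ := by gcongr

/-! ### Mollification in space -/

section Mollification

variable {F : Type*} [NormedAddCommGroup F] [NormedSpace ℝ F]

/-- Convolution of a function with a real kernel. -/
noncomputable def conv (k : E3 → ℝ) (a : E3 → F) (x : E3) : F := ∫ y, k (x - y) • a y

open scoped Convolution in
theorem conv_eq_convolution (k : E3 → ℝ) (a : E3 → F) :
    conv k a = (k ⋆[ContinuousLinearMap.lsmul ℝ ℝ, volume] a) := by
  ext x
  rw [convolution_lsmul_swap]
  rfl

theorem conv_congr {k : E3 → ℝ} {a b : E3 → F} (h : a =ᵐ[volume] b) : conv k a = conv k b := by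
  ext x
  refine integral_congr_ae ?_
  filter_upwards [h] with y hy
  rw [hy]

theorem integrable_smul_kernel {k : E3 → ℝ} {a : E3 → F} (hk : Continuous k)
    (hks : HasCompactSupport k) (ha : LocallyIntegrable a volume) :
    Integrable (fun y => k y • a y) :=
  ha.integrable_smul_left_of_hasCompactSupport hk hks

theorem hasCompactSupport_comp_sub {k : E3 → ℝ} (hks : HasCompactSupport k) (x : E3) :
    HasCompactSupport fun y => k (x - y) :=
  hks.comp_homeomorph (Homeomorph.subLeft x)

theorem integrable_conv_kernel {k : E3 → ℝ} {a : E3 → F} (hk : Continuous k)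
    (hks : HasCompactSupport k) (ha : LocallyIntegrable a volume) (x : E3) :
    Integrable (fun y => k (x - y) • a y) :=
  integrable_smul_kernel (by fun_prop) (hasCompactSupport_comp_sub hks x) ha

theorem contDiff_conv [CompleteSpace F] {k : E3 → ℝ} {a : E3 → F} (hk : ContDiff ℝ ∞ k)
    (hks : HasCompactSupport k) (ha : LocallyIntegrable a volume) : ContDiff ℝ ∞ (conv k a) := by
  rw [conv_eq_convolution]
  exact hks.contDiff_convolution_left _ hk ha

theorem fderiv_conv [CompleteSpace F] {k : E3 → ℝ} {a : E3 → F} (hk : ContDiff ℝ ∞ k)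
    (hks : HasCompactSupport k) (ha : LocallyIntegrable a volume) (x v : E3) :
    fderiv ℝ (conv k a) x v = conv (fun z => fderiv ℝ k z v) a x := by
  have h := hks.hasFDerivAt_convolution_left (ContinuousLinearMap.lsmul ℝ ℝ) (hk.of_le (by simp))
    ha x
  rw [← conv_eq_convolution] at h
  rw [h.fderiv]
  have hk' : Continuous (fderiv ℝ k) := hk.continuous_fderiv (by simp)
  have hex := (hks.fderiv (𝕜 := ℝ)).convolutionExists_left
    ((ContinuousLinearMap.lsmul ℝ ℝ : ℝ →L[ℝ] F →L[ℝ] F).precompL E3) hk' ha x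
  rw [convolution_def, ContinuousLinearMap.integral_apply hex]
  simp only [ContinuousLinearMap.precompL_apply, ContinuousLinearMap.lsmul_apply]
  have := congr_fun (conv_eq_convolution (fun z => fderiv ℝ k z v) a) x
  rw [this]
  rfl

/-- Cauchy–Schwarz for the probability measure k dz. -/
theorem enorm_conv_sq_le {k : E3 → ℝ} (hk : Measurable k) (hk0 : ∀ z, 0 ≤ k z)
    (hk1 : ∫⁻ z, ENNReal.ofReal (k z) = 1) {a : E3 → F} (ha : StronglyMeasurable a) (x : E3) :
    ‖conv k a x‖ₑ ^ (2 : ℝ) ≤ ∫⁻ z, ENNReal.ofReal (k z) * ‖a (x - z)‖ₑ ^ (2 : ℝ) := by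
  set ν := volume.withDensity fun z => ENNReal.ofReal (k z) with hν
  have hm : Measurable fun z => ‖a (x - z)‖ₑ :=
    (ha.comp_measurable (measurable_const.sub measurable_id)).enorm
  have h1 : ‖conv k a x‖ₑ ≤ ∫⁻ z, ‖a (x - z)‖ₑ ∂ν := by
    refine (enorm_integral_le_lintegral_enorm _).trans_eq ?_
    rw [lintegral_withDensity_eq_lintegral_mul₀ hk.ennreal_ofReal.aemeasurable
      hm.aemeasurable]
    rw [← lintegral_sub_left_eq_self _ x]
    refine lintegral_congr fun y => ?_
    simp only [sub_sub_cancel, enorm_smul, Pi.mul_apply]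
    rw [Real.enorm_of_nonneg (hk0 _)]
  have h2 := ENNReal.lintegral_mul_le_Lp_mul_Lq ν (p := 2) (q := 2)
      (by rw [Real.holderConjugate_iff]; norm_num)
      (f := fun z => ‖a (x - z)‖ₑ) (g := fun _ => 1)
      hm.aemeasurable
      aemeasurable_const
  have h3 : ν univ = 1 := by rw [hν, withDensity_apply _ MeasurableSet.univ]; simpa using hk1
  simp only [Pi.mul_def, mul_one, ENNReal.one_rpow, lintegral_const, h3] at h2
  calc ‖conv k a x‖ₑ ^ (2 : ℝ) ≤ ((∫⁻ z, ‖a (x - z)‖ₑ ^ (2 : ℝ) ∂ν) ^ (1 / 2 : ℝ)) ^ (2 : ℝ) := by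
        gcongr; exact h1.trans h2
    _ = ∫⁻ z, ‖a (x - z)‖ₑ ^ (2 : ℝ) ∂ν := by rw [← ENNReal.rpow_mul]; norm_num
    _ = _ := by
        rw [lintegral_withDensity_eq_lintegral_mul₀ hk.ennreal_ofReal.aemeasurable]
        · rfl
        · exact (hm.pow_const _).aemeasurable

/-- Averaging at scale ε sees only the ε-neighbourhood of a point, so the L² contraction is local at
the cost of ε in the radius. This loss is harmless in a cone, where it only shrinks the base. -/
theorem eLpNorm_conv_le {k : E3 → ℝ} (hk : Measurable k) (hk0 : ∀ z, 0 ≤ k z)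
    (hk1 : ∫⁻ z, ENNReal.ofReal (k z) = 1) {ε : ℝ} (hks : ∀ z, k z ≠ 0 → ‖z‖ < ε)
    {a : E3 → F} (ha : AEStronglyMeasurable a volume) (x₀ : E3) (r : ℝ) :
    eLpNorm (conv k a) 2 (ballMeasure x₀ (r - ε)) ≤ eLpNorm a 2 (ballMeasure x₀ r) := by
  wlog ham : StronglyMeasurable a generalizing a
  · rw [conv_congr ha.ae_eq_mk, eLpNorm_congr_ae (μ := ballMeasure x₀ r)
      (ae_restrict_of_ae ha.ae_eq_mk)]
    exact this ha.stronglyMeasurable_mk.aestronglyMeasurable ha.stronglyMeasurable_mk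
  rw [eLpNorm_eq_lintegral_rpow_enorm_toReal (by norm_num) (by norm_num),
    eLpNorm_eq_lintegral_rpow_enorm_toReal (by norm_num) (by norm_num)]
  simp only [ENNReal.toReal_ofNat]
  gcongr ?_ ^ (1 / 2 : ℝ)
  have hm : Measurable fun p : E3 × E3 =>
      ENNReal.ofReal (k p.2) * ‖a (p.1 - p.2)‖ₑ ^ (2 : ℝ) := by
    refine (hk.comp measurable_snd).ennreal_ofReal.mul (Measurable.pow_const ?_ _)
    exact (ham.comp_measurable (measurable_fst.sub measurable_snd)).enorm
  calc ∫⁻ x, ‖conv k a x‖ₑ ^ (2 : ℝ) ∂ballMeasure x₀ (r - ε)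
      ≤ ∫⁻ x, (∫⁻ z, ENNReal.ofReal (k z) * ‖a (x - z)‖ₑ ^ (2 : ℝ)) ∂ballMeasure x₀ (r - ε) :=
        lintegral_mono fun x => enorm_conv_sq_le hk hk0 hk1 ham x
    _ = ∫⁻ z, ∫⁻ x, ENNReal.ofReal (k z) * ‖a (x - z)‖ₑ ^ (2 : ℝ) ∂ballMeasure x₀ (r - ε) :=
        by
        unfold ballMeasure
        exact lintegral_lintegral_swap hm.aemeasurable
    _ ≤ ∫⁻ z, ENNReal.ofReal (k z) * ∫⁻ x, ‖a x‖ₑ ^ (2 : ℝ) ∂ballMeasure x₀ r := by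
        refine lintegral_mono fun z => ?_
        rw [lintegral_const_mul' _ _ ENNReal.ofReal_ne_top]
        by_cases hz : k z = 0
        · simp [hz]
        refine mul_le_mul_right ?_ _
        unfold ballMeasure
        rw [← lintegral_indicator measurableSet_ball, ← lintegral_indicator measurableSet_ball,
          ← lintegral_add_right_eq_self _ z]
        refine lintegral_mono fun x => ?_
        simp only [indicator, add_sub_cancel_right]
        split_ifs with h1 h2
        · exact le_rfl
        · refine absurd ?_ h2
          rw [mem_ball_iff_norm] at h1 ⊢
          calc ‖x - x₀‖ = ‖(x + z - x₀) - z‖ := by congr 1; abel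
            _ ≤ ‖x + z - x₀‖ + ‖z‖ := norm_sub_le _ _
            _ < r := by linarith [hks z hz]
        all_goals simp
    _ = _ := by
        rw [lintegral_mul_const'' _ hk.ennreal_ofReal.aemeasurable, hk1, one_mul]

/-- A standard sequence of mollifiers. -/
noncomputable def bump (n : ℕ) : ContDiffBump (0 : E3) :=
  ⟨1 / (2 * (n + 1)), 1 / (n + 1), by positivity, by
    apply one_div_lt_one_div_of_lt (by positivity); linarith [(n.cast_nonneg : (0 : ℝ) ≤ n)]⟩

/-- The standard mollifier, supported in the ball of radius `1 / (n + 1)`. -/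
noncomputable def mollifier (n : ℕ) : E3 → ℝ := (bump n).normed volume

theorem mollifier_contDiff (n : ℕ) : ContDiff ℝ ∞ (mollifier n) := (bump n).contDiff_normed

theorem mollifier_hasCompactSupport (n : ℕ) : HasCompactSupport (mollifier n) :=
  (bump n).hasCompactSupport_normed

theorem mollifier_nonneg (n : ℕ) (z : E3) : 0 ≤ mollifier n z := (bump n).nonneg_normed z

theorem lintegral_mollifier (n : ℕ) : ∫⁻ z, ENNReal.ofReal (mollifier n z) = 1 := by
  unfold mollifier
  rw [← ofReal_integral_eq_lintegral_ofReal (bump n).integrable_normed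
    (ae_of_all _ (mollifier_nonneg n)), (bump n).integral_normed, ENNReal.ofReal_one]

theorem norm_lt_of_mollifier_ne_zero (n : ℕ) (z : E3) (hz : mollifier n z ≠ 0) :
    ‖z‖ < 1 / (n + 1) := by
  have : z ∈ Function.support ((bump n).normed volume) := hz
  rw [ContDiffBump.support_normed_eq] at this
  simpa [bump] using this

theorem eLpNorm_mollify_le (n : ℕ) {a : E3 → F} (ha : AEStronglyMeasurable a volume) (x₀ : E3)
    (r : ℝ) : eLpNorm (conv (mollifier n) a) 2 (ballMeasure x₀ (r - 1 / (n + 1))) ≤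
      eLpNorm a 2 (ballMeasure x₀ r) :=
  eLpNorm_conv_le (mollifier_contDiff n).continuous.measurable (mollifier_nonneg n)
    (lintegral_mollifier n) (norm_lt_of_mollifier_ne_zero n) ha x₀ r

theorem ae_tendsto_mollify [CompleteSpace F] {a : E3 → F} (ha : LocallyIntegrable a volume) :
    ∀ᵐ x, Tendsto (fun n => conv (mollifier n) a x) atTop (𝓝 (a x)) := by
  have h := ContDiffBump.ae_convolution_tendsto_right_of_locallyIntegrable (φ := bump) (l := atTop)
    (K := 2) (μ := (volume : Measure E3)) (g := a) ?_ ?_ ha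
  · simpa only [conv_eq_convolution, mollifier] using h
  · exact tendsto_one_div_add_atTop_nhds_zero_nat
  · refine Eventually.of_forall fun n => le_of_eq ?_
    simp only [bump]
    field_simp

/-- Fatou along the almost everywhere convergence of mollifications. The radii vary with n, so each
mollification is cut off to its own ball; a point of the limiting open ball eventually lies in all
of them. Every estimate proved for smoothed functions is transferred through this lemma. -/
theorem eLpNorm_le_of_mollify_le [CompleteSpace F] {a : E3 → F} (ha : LocallyIntegrable a volume)
    {p : ℝ≥0∞} {x₀ : E3} {r : ℝ} {ρ : ℕ → ℝ} (hρ : Tendsto ρ atTop (𝓝 r)) {c : ℕ → ℝ≥0∞}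
    {C : ℝ≥0∞} (hc : Tendsto c atTop (𝓝 C))
    (h : ∀ᶠ n : ℕ in atTop, eLpNorm (conv (mollifier n) a) p (ballMeasure x₀ (ρ n)) ≤ c n) :
    eLpNorm a p (ballMeasure x₀ r) ≤ C := by
  set f : ℕ → E3 → F := fun n =>
    (Metric.ball x₀ (ρ n)).indicator (conv (mollifier n) a) with hf
  have hcm : ∀ n, StronglyMeasurable (conv (mollifier n) a) := fun n =>
    (contDiff_conv (mollifier_contDiff n) (mollifier_hasCompactSupport n) ha).continuous.stronglyMeasurable
  have hlim : ∀ᵐ x ∂ballMeasure x₀ r, Tendsto (fun n => f n x) atTop (𝓝 (a x)) := by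
    unfold ballMeasure
    rw [ae_restrict_iff' measurableSet_ball]
    filter_upwards [ae_tendsto_mollify ha] with x hx hxr
    refine hx.congr' ?_
    filter_upwards [hρ.eventually_const_lt (Metric.mem_ball.1 hxr)] with n hn
    rw [hf]
    simp only
    rw [indicator_of_mem (Metric.mem_ball.2 hn)]
  refine (Lp.eLpNorm_lim_le_liminf_eLpNorm
    (fun n => ((hcm n).indicator measurableSet_ball).aestronglyMeasurable) a hlim).trans ?_
  rw [← hc.liminf_eq]
  refine liminf_le_liminf ?_
  filter_upwards [h] with n hn
  refine le_trans ?_ hn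
  rw [eLpNorm_indicator_eq_eLpNorm_restrict measurableSet_ball]
  refine eLpNorm_mono_measure _ ?_
  unfold ballMeasure
  exact Measure.restrict_mono_measure Measure.restrict_le_self _

end Mollification

/-! ### Weak gradients under mollification and the Sobolev inequality for them -/

theorem gradient_comp_sub {k : E3 → ℝ} (hk : ContDiff ℝ ∞ k) (x y : E3) :
    gradient (fun y => k (x - y)) y = -gradient k (x - y) := by
  have h1 : HasFDerivAt (fun y => k (x - y)) (-fderiv ℝ k (x - y)) y := by
    have h2 : HasFDerivAt (fun y : E3 => x - y) (-ContinuousLinearMap.id ℝ E3) y :=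
      (hasFDerivAt_id y).const_sub x
    have h3 := ((hk.differentiable (by simp)) (x - y)).hasFDerivAt.comp y h2
    rw [ContinuousLinearMap.comp_neg, ContinuousLinearMap.comp_id] at h3
    exact h3
  unfold gradient
  rw [h1.fderiv, map_neg]

/-- The weak gradient is tested against y ↦ k(x - y); the sign from integration by parts cancels the
sign from the reflection. -/
theorem IsWeakGradient.gradient_conv {w : E3 → ℝ} {D : E3 → E3} (h : IsWeakGradient w D)
    {k : E3 → ℝ} (hk : ContDiff ℝ ∞ k) (hks : HasCompactSupport k) (x : E3) :
    gradient (conv k w) x = conv k D x := by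
  have h1 := h.integral_eq (fun y => k (x - y)) (hk.comp (contDiff_const.sub contDiff_id))
    (hasCompactSupport_comp_sub hks x)
  simp_rw [gradient_comp_sub hk, smul_neg] at h1
  rw [integral_neg, neg_inj] at h1
  have hgc : Continuous (gradient k) := by
    unfold gradient
    exact (InnerProductSpace.toDual ℝ E3).symm.continuous.comp (hk.continuous_fderiv (by simp))
  have hgs : HasCompactSupport (gradient k) := by
    refine (hks.fderiv (𝕜 := ℝ)).comp_left (g := (InnerProductSpace.toDual ℝ E3).symm) (map_zero _)
  have hint : Integrable fun y => w y • gradient k (x - y) :=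
    h.locallyIntegrable.integrable_smul_right_of_hasCompactSupport (by fun_prop)
      (hgs.comp_homeomorph (Homeomorph.subLeft x))
  unfold conv at *
  rw [← h1]
  refine ext_inner_left ℝ fun v => ?_
  have h2 := fderiv_conv hk hks h.locallyIntegrable x v
  unfold conv at h2
  rw [← integral_inner hint]
  rw [gradient, real_inner_comm, InnerProductSpace.toDual_symm_apply, h2]
  refine integral_congr_ae (ae_of_all _ fun y => ?_)
  simp only [inner_smul_right]
  rw [gradient, real_inner_comm, InnerProductSpace.toDual_symm_apply, smul_eq_mul, mul_comm]

theorem norm_fderiv_eq_norm_gradient (f : E3 → ℝ) (x : E3) : ‖fderiv ℝ f x‖ = ‖gradient f x‖ := by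
  unfold gradient
  rw [LinearIsometryEquiv.norm_map]

/-- The Sobolev inequality on balls for weakly differentiable functions. -/
theorem sobolev_ball_weak : ∃ C : ℝ≥0, ∀ (a : E3 → ℝ) (D : E3 → E3), IsWeakGradient a D →
    ∀ (x₀ : E3) (r : ℝ), 0 < r → eLpNorm a 6 (ballMeasure x₀ r) ≤
      C * (eLpNorm D 2 (ballMeasure x₀ r) + eLpNorm a 2 (ballMeasure x₀ r) / ENNReal.ofReal r) := by
  obtain ⟨C, hC⟩ := sobolev_ball
  refine ⟨C, fun a D h x₀ r hr => ?_⟩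
  have h1 : Tendsto (fun n : ℕ => r - 1 / ((n : ℝ) + 1)) atTop (𝓝 r) := by
    simpa using (tendsto_one_div_add_atTop_nhds_zero_nat (𝕜 := ℝ)).const_sub r
  -- The smooth inequality is used on the ball of radius r - 1/(n+1), so that its right side is
  -- controlled by norms over the full ball; its constant 1/(r - 1/(n+1)) converges to 1/r.
  refine eLpNorm_le_of_mollify_le h.locallyIntegrable h1 (c := fun n =>
    C * (eLpNorm D 2 (ballMeasure x₀ r) + eLpNorm a 2 (ballMeasure x₀ r) /
      ENNReal.ofReal (r - 1 / ((n : ℝ) + 1)))) ?_ ?_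
  · refine ENNReal.Tendsto.const_mul (Tendsto.add tendsto_const_nhds ?_) (Or.inr (by simp))
    refine ENNReal.Tendsto.div tendsto_const_nhds (Or.inr (by simpa using hr))
      ((ENNReal.continuous_ofReal.tendsto r).comp h1) (Or.inl (by simp))
  · filter_upwards [h1.eventually_const_lt hr] with n hn
    refine (hC _ ((contDiff_conv (mollifier_contDiff n) (mollifier_hasCompactSupport n)
      h.locallyIntegrable).of_le (by simp)) x₀ _ hn).trans ?_
    gcongr
    · refine le_trans (le_of_eq ?_)
        (eLpNorm_mollify_le n h.locallyIntegrable_grad.aestronglyMeasurable x₀ r)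
      refine eLpNorm_congr_norm_ae (ae_of_all _ fun x => ?_)
      rw [norm_fderiv_eq_norm_gradient, h.gradient_conv (mollifier_contDiff n)
        (mollifier_hasCompactSupport n)]
    · exact eLpNorm_mollify_le n h.locallyIntegrable.aestronglyMeasurable x₀ r

/-! ### Integrating distributional derivatives in time -/

theorem contDiff_smoothTransition_scale (s η : ℝ) :
    ContDiff ℝ ∞ fun τ : ℝ => Real.smoothTransition ((τ - s) / η) :=
  Real.smoothTransition.contDiff.comp (by fun_prop)

theorem tendsto_smoothTransition_scale (s τ : ℝ) :
    Tendsto (fun n : ℕ => Real.smoothTransition ((τ - s) / (1 / ((n : ℝ) + 1)))) atTop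
      (𝓝 (if s < τ then 1 else 0)) := by
  split_ifs with h
  · refine tendsto_const_nhds.congr' ?_
    filter_upwards [(tendsto_one_div_add_atTop_nhds_zero_nat (𝕜 := ℝ)).eventually_lt_const
      (sub_pos.2 h)] with n hn
    refine (Real.smoothTransition.one_of_one_le ?_).symm
    rw [le_div_iff₀ (by positivity)]
    linarith
  · refine tendsto_const_nhds.congr fun n => ?_
    refine (Real.smoothTransition.zero_of_nonpos ?_).symm
    exact div_nonpos_of_nonpos_of_nonneg (by linarith) (by positivity)

theorem integral_mul_deriv_smoothTransition_scale {A : ℝ → ℝ} {s η b : ℝ} (hη : 0 < η)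
    (hb : s + η ≤ b) :
    ∫ τ in s..b, A τ * deriv (fun τ => Real.smoothTransition ((τ - s) / η)) τ =
      ∫ σ in (0 : ℝ)..1, A (s + η * σ) * deriv Real.smoothTransition σ := by
  have hd : ∀ τ, deriv (fun τ => Real.smoothTransition ((τ - s) / η)) τ =
      deriv Real.smoothTransition ((τ - s) / η) / η := by
    intro τ
    have h1 : HasDerivAt (fun τ : ℝ => (τ - s) / η) (1 / η) τ :=
      ((hasDerivAt_id τ).sub_const s).div_const η
    have h2 := ((Real.smoothTransition.contDiff (n := 1)).differentiable one_ne_zero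
      ((τ - s) / η)).hasDerivAt.comp τ h1
    rw [Function.comp_def] at h2
    rw [h2.deriv]; ring
  have hd0 : ∀ σ : ℝ, 1 < σ → deriv Real.smoothTransition σ = 0 := by
    intro σ hσ
    have : Real.smoothTransition =ᶠ[𝓝 σ] fun _ => 1 := by
      filter_upwards [eventually_gt_nhds hσ] with x hx
      exact Real.smoothTransition.one_of_one_le hx.le
    rw [this.deriv_eq, deriv_const]
  have h1 : ∫ τ in s..b, A τ * deriv (fun τ => Real.smoothTransition ((τ - s) / η)) τ =
      ∫ τ in s..(s + η), A τ * deriv (fun τ => Real.smoothTransition ((τ - s) / η)) τ := by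
    rw [intervalIntegral.integral_of_le (by linarith), intervalIntegral.integral_of_le (by linarith)]
    refine setIntegral_eq_of_subset_of_forall_sdiff_eq_zero measurableSet_Ioc
      (Ioc_subset_Ioc_right hb) ?_
    intro τ hτ
    rw [hd, hd0, zero_div, mul_zero]
    rw [lt_div_iff₀ hη]
    by_contra hcon
    exact hτ.2 ⟨hτ.1.1, by linarith⟩
  rw [h1]
  have h2 := intervalIntegral.smul_integral_comp_add_mul (a := 0) (b := 1)
    (fun τ => A τ * deriv (fun τ => Real.smoothTransition ((τ - s) / η)) τ) η s
  simp only [mul_zero, add_zero, mul_one] at h2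
  rw [← h2, smul_eq_mul, ← intervalIntegral.integral_const_mul]
  refine intervalIntegral.integral_congr fun σ _ => ?_
  simp only [hd, add_sub_cancel_left, mul_div_cancel_left₀ _ hη.ne']
  field_simp

/-- The derivative of a steep step is an approximate identity just to the right of s. After
rescaling, the integral is a continuous function of the width η, equal at η = 0 to A(s) because the
derivative of the step has mass 1. -/
theorem tendsto_integral_mul_deriv_smoothTransition {A : ℝ → ℝ} (hA : Continuous A) {s b : ℝ}
    (hb : s < b) :
    Tendsto (fun n : ℕ => ∫ τ in s..b,
      A τ * deriv (fun τ => Real.smoothTransition ((τ - s) / (1 / ((n : ℝ) + 1)))) τ) atTop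
      (𝓝 (A s)) := by
  have hS : Continuous (deriv Real.smoothTransition) :=
    (Real.smoothTransition.contDiff (n := 1)).continuous_deriv le_rfl
  have h1 : Continuous fun η : ℝ => ∫ σ in (0 : ℝ)..1, A (s + η * σ) * deriv Real.smoothTransition σ :=
    intervalIntegral.continuous_parametric_intervalIntegral_of_continuous' (by fun_prop) _ _
  have h2 := (h1.tendsto 0).comp (tendsto_one_div_add_atTop_nhds_zero_nat (𝕜 := ℝ))
  have h3 : ∫ σ in (0 : ℝ)..1, A (s + 0 * σ) * deriv Real.smoothTransition σ = A s := by
    simp only [zero_mul, add_zero, intervalIntegral.integral_const_mul]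
    rw [intervalIntegral.integral_deriv_eq_sub
      (fun x _ => (Real.smoothTransition.contDiff (n := 1)).differentiable one_ne_zero x)
      (hS.intervalIntegrable _ _)]
    simp
  rw [h3] at h2
  refine h2.congr' ?_
  filter_upwards [(tendsto_one_div_add_atTop_nhds_zero_nat (𝕜 := ℝ)).eventually_lt_const
      (sub_pos.2 hb)] with n hn
  rw [integral_mul_deriv_smoothTransition_scale (by positivity) (by linarith)]
  rfl

/-- A continuous function whose distributional derivative on `(0, ∞)` is a locally integrable
function is the primitive of that function. -/
theorem sub_eq_integral_of_weak_deriv {A F : ℝ → ℝ} (hA : Continuous A)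
    (hF : ∀ T, IntegrableOn F (Ioo 0 T))
    (h : ∀ θ : ℝ → ℝ, ContDiff ℝ ∞ θ → HasCompactSupport θ → tsupport θ ⊆ Ioi 0 →
      ∫ t in Ioi (0 : ℝ), A t * deriv θ t = -∫ t in Ioi (0 : ℝ), F t * θ t) {t : ℝ} (ht : 0 ≤ t) :
    A t - A 0 = ∫ s in (0 : ℝ)..t, F s := by
  have hFi : ∀ T, 0 ≤ T → IntervalIntegrable F volume 0 T := fun T hT => by
    rw [intervalIntegrable_iff_integrableOn_Ioo_of_le hT]; exact hF T
  have key : ∀ s, 0 < s → s < t → A t - A s = ∫ τ in s..t, F τ := by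
    intro s hs hst
    -- A smoothed indicator of (s, t], rising just after s and falling just after t. Its support
    -- lies in [s, t + 1], away from 0, so it is admissible.
    set θ : ℕ → ℝ → ℝ := fun n τ => Real.smoothTransition ((τ - s) / (1 / ((n : ℝ) + 1))) -
      Real.smoothTransition ((τ - t) / (1 / ((n : ℝ) + 1))) with hθ
    have hη : ∀ n : ℕ, 1 / ((n : ℝ) + 1) ≤ 1 := fun n => by
      rw [div_le_one (by positivity)]; linarith [(n.cast_nonneg : (0 : ℝ) ≤ n)]
    have hc : ∀ n, ContDiff ℝ ∞ (θ n) := fun n =>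
      (contDiff_smoothTransition_scale _ _).sub (contDiff_smoothTransition_scale _ _)
    have hz1 : ∀ n τ, τ ≤ s → θ n τ = 0 := by
      intro n τ hτ
      simp only [hθ]
      rw [Real.smoothTransition.zero_of_nonpos, Real.smoothTransition.zero_of_nonpos, sub_zero] <;>
      exact div_nonpos_of_nonpos_of_nonneg (by linarith) (by positivity)
    have hz2 : ∀ n τ, t + 1 ≤ τ → θ n τ = 0 := by
      intro n τ hτ
      simp only [hθ]
      rw [Real.smoothTransition.one_of_one_le, Real.smoothTransition.one_of_one_le, sub_self] <;>
      · rw [le_div_iff₀ (by positivity)]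
        linarith [hη n]
    have hsupp : ∀ n, Function.support (θ n) ⊆ Icc s (t + 1) := by
      intro n τ hτ
      constructor
      · by_contra hcon; exact hτ (hz1 n τ (by linarith))
      · by_contra hcon; exact hτ (hz2 n τ (by linarith))
    have hts : ∀ n, tsupport (θ n) ⊆ Icc s (t + 1) := fun n => closure_minimal (hsupp n) isClosed_Icc
    have hsd : ∀ n, Function.support (deriv (θ n)) ⊆ Icc s (t + 1) := fun n =>
      (support_deriv_subset).trans (hts n)
    have hw := fun n => h (θ n) (hc n) (HasCompactSupport.of_support_subset_isCompact isCompact_Icc (hsupp n))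
      ((hts n).trans fun τ hτ => hs.trans_le hτ.1)
    have hl : ∀ n, ∫ τ in Ioi (0 : ℝ), A τ * deriv (θ n) τ =
        (∫ τ in s..(t + 1), A τ * deriv (fun τ => Real.smoothTransition ((τ - s) / (1 / ((n : ℝ) + 1)))) τ)
        - ∫ τ in t..(t + 1), A τ * deriv (fun τ => Real.smoothTransition ((τ - t) / (1 / ((n : ℝ) + 1)))) τ := by
      intro n
      set α : ℝ → ℝ := fun τ => Real.smoothTransition ((τ - s) / (1 / ((n : ℝ) + 1))) with hα
      set β : ℝ → ℝ := fun τ => Real.smoothTransition ((τ - t) / (1 / ((n : ℝ) + 1))) with hβ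
      have hαc : ContDiff ℝ ∞ α := contDiff_smoothTransition_scale _ _
      have hβc : ContDiff ℝ ∞ β := contDiff_smoothTransition_scale _ _
      have hαd : Continuous (deriv α) := hαc.continuous_deriv (by simp)
      have hβd : Continuous (deriv β) := hβc.continuous_deriv (by simp)
      have h1 : ∫ τ in Ioi (0 : ℝ), A τ * deriv (θ n) τ = ∫ τ in Ioc s (t + 1), A τ * deriv (θ n) τ := by
        rw [← integral_Icc_eq_integral_Ioc]
        refine setIntegral_eq_of_subset_of_forall_sdiff_eq_zero measurableSet_Ioi
          (fun τ hτ => hs.trans_le hτ.1) fun τ hτ => ?_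
        have : deriv (θ n) τ = 0 := by
          by_contra hcon; exact hτ.2 (hsd n hcon)
        rw [this, mul_zero]
      have h2 : ∀ τ, deriv (θ n) τ = deriv α τ - deriv β τ := fun τ =>
        deriv_sub (hαc.differentiable (by simp) τ) (hβc.differentiable (by simp) τ)
      have h3 : ∫ τ in t..(t + 1), A τ * deriv β τ = ∫ τ in s..(t + 1), A τ * deriv β τ := by
        rw [intervalIntegral.integral_of_le (by linarith), intervalIntegral.integral_of_le (by linarith),
          ← integral_Icc_eq_integral_Ioc, ← integral_Icc_eq_integral_Ioc]
        refine (setIntegral_eq_of_subset_of_forall_sdiff_eq_zero measurableSet_Icc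
          (Icc_subset_Icc_left hst.le) fun τ hτ => ?_).symm
        have : β =ᶠ[𝓝 τ] fun _ => 0 := by
          have hτt : τ < t := by
            by_contra hcon; exact hτ.2 ⟨by linarith, hτ.1.2⟩
          filter_upwards [eventually_lt_nhds hτt] with x hx
          exact Real.smoothTransition.zero_of_nonpos
            (div_nonpos_of_nonpos_of_nonneg (by linarith) (by positivity))
        rw [this.deriv_eq, deriv_const, mul_zero]
      rw [h1, h3, ← intervalIntegral.integral_of_le (by linarith), ← intervalIntegral.integral_sub
        (Continuous.intervalIntegrable (by fun_prop) _ _)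
        (Continuous.intervalIntegrable (by fun_prop) _ _)]
      refine intervalIntegral.integral_congr fun τ _ => ?_
      simp only [h2]; ring
    have hlim1 : Tendsto (fun n => ∫ τ in Ioi (0 : ℝ), A τ * deriv (θ n) τ) atTop (𝓝 (A s - A t)) := by
      simp_rw [hl]
      exact (tendsto_integral_mul_deriv_smoothTransition hA (by linarith)).sub
        (tendsto_integral_mul_deriv_smoothTransition hA (by linarith))
    have hlim2 : Tendsto (fun n => ∫ τ in Ioi (0 : ℝ), F τ * θ n τ) atTop
        (𝓝 (∫ τ in Ioi (0 : ℝ), (Ioc s t).indicator F τ)) := by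
      have h1 : ∀ n, ∫ τ in Ioi (0 : ℝ), F τ * θ n τ = ∫ τ in Ioo (0 : ℝ) (t + 2), F τ * θ n τ := by
        intro n
        refine setIntegral_eq_of_subset_of_forall_sdiff_eq_zero measurableSet_Ioi
          (fun τ hτ => hτ.1) fun τ hτ => ?_
        have : θ n τ = 0 := by
          by_contra hcon
          have := hsupp n hcon
          exact hτ.2 ⟨hτ.1, by linarith [this.2]⟩
        rw [this, mul_zero]
      have h2 : ∫ τ in Ioi (0 : ℝ), (Ioc s t).indicator F τ =
          ∫ τ in Ioo (0 : ℝ) (t + 2), (Ioc s t).indicator F τ := by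
        refine setIntegral_eq_of_subset_of_forall_sdiff_eq_zero measurableSet_Ioi
          (fun τ hτ => hτ.1) fun τ hτ => ?_
        refine indicator_of_notMem (fun hcon => hτ.2 ⟨hτ.1, by linarith [hcon.2]⟩) _
      simp_rw [h1]
      rw [h2]
      refine tendsto_integral_of_dominated_convergence (fun τ => ‖F τ‖)
        (fun n => (hF _).aestronglyMeasurable.mul (hc n).continuous.aestronglyMeasurable)
        (hF _).norm ?_ ?_
      · refine fun n => ae_of_all _ fun τ => ?_
        rw [norm_mul]
        refine mul_le_of_le_one_right (norm_nonneg _) ?_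
        rw [Real.norm_eq_abs, abs_le]
        simp only [hθ]
        constructor <;> linarith [Real.smoothTransition.nonneg ((τ - s) / (1 / ((n : ℝ) + 1))),
          Real.smoothTransition.nonneg ((τ - t) / (1 / ((n : ℝ) + 1))),
          Real.smoothTransition.le_one ((τ - s) / (1 / ((n : ℝ) + 1))),
          Real.smoothTransition.le_one ((τ - t) / (1 / ((n : ℝ) + 1)))]
      · refine ae_of_all _ fun τ => ?_
        have h3 := ((tendsto_smoothTransition_scale s τ).sub
          (tendsto_smoothTransition_scale t τ)).const_mul (F τ)
        convert h3 using 2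
        simp only [indicator, mem_Ioc]
        by_cases h1 : s < τ <;> by_cases h2 : t < τ
        · simp [h1, h2, not_le.2 h2]
        · simp [h1, h2, not_lt.1 h2]
        · linarith
        · simp [h1, h2]
    have heq : A s - A t = -∫ τ in Ioi (0 : ℝ), (Ioc s t).indicator F τ := by
      refine tendsto_nhds_unique hlim1 ?_
      simp_rw [hw]
      exact hlim2.neg
    rw [setIntegral_indicator measurableSet_Ioc, inter_eq_right.2
      (show Ioc s t ⊆ Ioi 0 from fun τ hτ => hs.trans hτ.1),
      ← intervalIntegral.integral_of_le hst.le] at heq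
    linarith
  rcases ht.eq_or_lt with rfl | ht0
  · simp
  have hprim : ContinuousOn (fun s => ∫ τ in (0 : ℝ)..s, F τ) (Icc 0 t) := by
    rw [← uIcc_of_le ht]
    refine intervalIntegral.continuousOn_primitive_interval ?_
    rw [uIcc_of_le ht, integrableOn_Icc_iff_integrableOn_Ioo]
    exact hF t
  -- Test functions only reach positive times; the endpoint 0 is recovered from the continuity of A
  -- and the integrability of F up to 0.
  have hlim : Tendsto (fun s => A t - A s + ∫ τ in (0 : ℝ)..s, F τ) (𝓝[>] 0) (𝓝 (A t - A 0)) := by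
    have h1 : Tendsto (fun s => ∫ τ in (0 : ℝ)..s, F τ) (𝓝[>] 0) (𝓝 0) := by
      have := (hprim 0 ⟨le_rfl, ht⟩).tendsto
      rw [intervalIntegral.integral_same] at this
      refine this.mono_left ?_
      rw [← nhdsWithin_Ioo_eq_nhdsGT ht0]
      exact nhdsWithin_mono _ Ioo_subset_Icc_self
    have h2 : Tendsto (fun s => A t - A s) (𝓝[>] 0) (𝓝 (A t - A 0)) :=
      ((hA.tendsto 0).mono_left nhdsWithin_le_nhds).const_sub _
    simpa using h2.add h1
  refine tendsto_nhds_unique hlim (tendsto_const_nhds.congr' ?_)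
  filter_upwards [Ioo_mem_nhdsGT ht0] with s hs
  rw [key s hs.1 hs.2]
  have := intervalIntegral.integral_add_adjacent_intervals (hFi s hs.1.le)
    ((hFi s hs.1.le).symm.trans (hFi t ht))
  linarith

/-! ### Continuous curves in L²_loc -/

instance isFiniteMeasure_ballMeasure (x₀ : E3) (R : ℝ) : IsFiniteMeasure (ballMeasure x₀ R) := by
  unfold ballMeasure
  exact ⟨by rw [Measure.restrict_apply_univ]; exact measure_ball_lt_top⟩

theorem ballMeasure_mono {x₀ y₀ : E3} {r R : ℝ} (h : dist x₀ y₀ + r ≤ R) :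
    ballMeasure x₀ r ≤ ballMeasure y₀ R :=
  Measure.restrict_mono (Metric.ball_subset (by linarith)) le_rfl

theorem ballMeasure_le_zero (x₀ : E3) (r : ℝ) : ballMeasure x₀ r ≤ ballMeasure 0 (‖x₀‖ + r) :=
  ballMeasure_mono (by rw [dist_zero_right])

theorem ae_ballMeasure_of_ae {p : E3 → Prop} (h : ∀ᵐ x, p x) (x₀ : E3) (R : ℝ) :
    ∀ᵐ x ∂ballMeasure x₀ R, p x := ae_restrict_of_ae h

theorem ae_of_forall_ae_ballMeasure {p : E3 → Prop}
    (h : ∀ n : ℕ, ∀ᵐ x ∂ballMeasure 0 n, p x) : ∀ᵐ x, p x := by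
  have h1 : ∀ᵐ x ∂volume.restrict (⋃ n : ℕ, Metric.ball (0 : E3) n), p x :=
    ae_restrict_iUnion_iff _ _ |>.2 h
  rwa [Metric.iUnion_ball_nat, Measure.restrict_univ] at h1

section

variable {F : Type*} [NormedAddCommGroup F]

theorem aestronglyMeasurable_of_ballMeasure {a : E3 → F}
    (h : ∀ R : ℝ, AEStronglyMeasurable a (ballMeasure 0 R)) : AEStronglyMeasurable a volume := by
  have h1 : AEStronglyMeasurable a (volume.restrict (⋃ n : ℕ, Metric.ball (0 : E3) n)) :=
    aestronglyMeasurable_iUnion_iff.2 fun n => h n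
  rwa [Metric.iUnion_ball_nat, Measure.restrict_univ] at h1

theorem locallyIntegrable_of_memLp_ball {a : E3 → F}
    (h : ∀ R : ℝ, MemLp a 2 (ballMeasure 0 R)) : LocallyIntegrable a volume := by
  intro x
  refine ⟨Metric.ball 0 (‖x‖ + 1), Metric.isOpen_ball.mem_nhds (by simp), ?_⟩
  exact (h (‖x‖ + 1)).integrable (by norm_num)

theorem enorm_integral_smul_le [NormedSpace ℝ F] {k : E3 → ℝ} {M : ℝ≥0} {ρ : ℝ} (hM : ∀ x, ‖k x‖₊ ≤ M)
    (hk : ∀ x, k x ≠ 0 → ‖x‖ < ρ) {a : E3 → F} (ha : AEStronglyMeasurable a volume) :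
    ∫⁻ x, ‖k x • a x‖ₑ ≤
      M * volume (Metric.ball (0 : E3) ρ) ^ (1 / 2 : ℝ) * eLpNorm a 2 (ballMeasure 0 ρ) := by
  have h1 : ∫⁻ x, ‖k x • a x‖ₑ ≤ ∫⁻ x, M * ‖a x‖ₑ ∂ballMeasure 0 ρ := by
    unfold ballMeasure
    rw [← lintegral_indicator measurableSet_ball]
    refine lintegral_mono fun x => ?_
    by_cases hx : x ∈ Metric.ball (0 : E3) ρ
    · rw [indicator_of_mem hx, enorm_smul]
      gcongr
      rw [enorm_eq_nnnorm]
      exact ENNReal.coe_le_coe.2 (hM x)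
    · have : k x = 0 := by
        by_contra hcon; exact hx (by simpa using hk x hcon)
      simp [this]
  refine h1.trans ?_
  rw [lintegral_const_mul' _ _ ENNReal.coe_ne_top, mul_assoc]
  refine mul_le_mul_right ?_ _
  have h2 := eLpNorm_le_eLpNorm_mul_rpow_measure_univ (μ := ballMeasure 0 ρ) (p := 1) (q := 2)
    (by norm_num) (f := a) ha.restrict
  rw [eLpNorm_one_eq_lintegral_enorm] at h2
  refine h2.trans_eq ?_
  rw [mul_comm]
  congr 1
  unfold ballMeasure
  rw [Measure.restrict_apply_univ]
  norm_num

theorem exists_kernel_bound {k : E3 → ℝ} (hk : Continuous k) (hks : HasCompactSupport k) :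
    ∃ (M : ℝ≥0) (ρ : ℝ), 0 < ρ ∧ (∀ x, ‖k x‖₊ ≤ M) ∧ ∀ x, k x ≠ 0 → ‖x‖ < ρ := by
  obtain ⟨M, hM⟩ := hks.exists_bound_of_continuous hk
  obtain ⟨ρ, hρ0, hρ⟩ := hks.isBounded.subset_ball_lt 0 0
  refine ⟨M.toNNReal, ρ, hρ0, fun x => ?_, fun x hx => ?_⟩
  · rw [← NNReal.coe_le_coe, coe_nnnorm]
    exact (hM x).trans (Real.le_coe_toNNReal M)
  · simpa using hρ (subset_tsupport k hx)

/-- A continuous curve in `L²_loc(ℝ³)`. -/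
structure L2LocCurve (a : ℝ → E3 → F) : Prop where
  memLp : ∀ t R, MemLp (a t) 2 (ballMeasure 0 R)
  tendsto : ∀ R t₀, Tendsto (fun t => eLpNorm (a t - a t₀) 2 (ballMeasure 0 R)) (𝓝 t₀) (𝓝 0)

namespace L2LocCurve

variable {a b : ℝ → E3 → F}

theorem aestronglyMeasurable (h : L2LocCurve a) (t : ℝ) : AEStronglyMeasurable (a t) volume :=
  aestronglyMeasurable_of_ballMeasure fun R => (h.memLp t R).1

theorem locallyIntegrable (h : L2LocCurve a) (t : ℝ) : LocallyIntegrable (a t) volume :=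
  locallyIntegrable_of_memLp_ball (h.memLp t)

theorem sub (ha : L2LocCurve a) (hb : L2LocCurve b) : L2LocCurve (a - b) where
  memLp t R := (ha.memLp t R).sub (hb.memLp t R)
  tendsto R t₀ := by
    have h1 := (ha.tendsto R t₀).add (hb.tendsto R t₀)
    rw [add_zero] at h1
    refine tendsto_of_tendsto_of_tendsto_of_le_of_le tendsto_const_nhds h1 (fun _ => zero_le)
      fun t => ?_
    have h2 : (a - b) t - (a - b) t₀ = (a t - a t₀) - (b t - b t₀) := by
      simp only [Pi.sub_apply]; abel
    simp only [h2]
    exact eLpNorm_sub_le ((ha.memLp t R).sub (ha.memLp t₀ R)).1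
      ((hb.memLp t R).sub (hb.memLp t₀ R)).1 (by norm_num)

theorem memLp_ball (h : L2LocCurve a) (t : ℝ) (x₀ : E3) (r : ℝ) : MemLp (a t) 2 (ballMeasure x₀ r) :=
  (h.memLp t _).mono_measure (ballMeasure_le_zero x₀ r)

theorem bounded (h : L2LocCurve a) (R T : ℝ) :
    ∃ M : ℝ≥0, ∀ t ∈ Icc 0 T, eLpNorm (a t) 2 (ballMeasure 0 R) ≤ M := by
  have hloc : ∀ t₀ ∈ Icc 0 T, ∃ s ∈ 𝓝[Icc 0 T] t₀, ∃ M : ℝ≥0, ∀ t ∈ s,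
      eLpNorm (a t) 2 (ballMeasure 0 R) ≤ M := by
    intro t₀ _
    refine ⟨{t | eLpNorm (a t - a t₀) 2 (ballMeasure 0 R) < 1},
      mem_nhdsWithin_of_mem_nhds ((h.tendsto R t₀).eventually_lt_const zero_lt_one),
      1 + (eLpNorm (a t₀) 2 (ballMeasure 0 R)).toNNReal, fun t ht => ?_⟩
    rw [ENNReal.coe_add, ENNReal.coe_toNNReal (h.memLp t₀ R).2.ne]
    calc eLpNorm (a t) 2 (ballMeasure 0 R) = eLpNorm ((a t - a t₀) + a t₀) 2 (ballMeasure 0 R) := by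
          rw [sub_add_cancel]
      _ ≤ eLpNorm (a t - a t₀) 2 (ballMeasure 0 R) + eLpNorm (a t₀) 2 (ballMeasure 0 R) :=
          eLpNorm_add_le ((h.memLp t R).sub (h.memLp t₀ R)).1 (h.memLp t₀ R).1 (by norm_num)
      _ ≤ _ := by
          gcongr
          exact le_of_lt (by simpa using ht)
  refine isCompact_Icc.induction_on (p := fun s => ∃ M : ℝ≥0, ∀ t ∈ s,
      eLpNorm (a t) 2 (ballMeasure 0 R) ≤ M) ⟨0, by simp⟩
    (fun s t hst ⟨M, hM⟩ => ⟨M, fun x hx => hM x (hst hx)⟩) ?_ hloc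
  rintro s t ⟨M, hM⟩ ⟨M', hM'⟩
  refine ⟨max M M', fun x hx => ?_⟩
  rcases hx with hx | hx
  · exact (hM x hx).trans (by simp)
  · exact (hM' x hx).trans (by simp)

/-- Joint continuity: Cauchy–Schwarz against the bounded, compactly supported kernel gives
continuity in t uniformly for x near x₀, and at the fixed time t₀ the convolution is smooth in x. -/
theorem continuous_conv [NormedSpace ℝ F] [CompleteSpace F] (h : L2LocCurve a) {k : E3 → ℝ}
    (hk : ContDiff ℝ ∞ k) (hks : HasCompactSupport k) :
    Continuous fun p : ℝ × E3 => conv k (a p.1) p.2 := by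
  obtain ⟨M, ρ, hρ, hM, hρk⟩ := exists_kernel_bound hk.continuous hks
  rw [continuous_iff_continuousAt]
  rintro ⟨t₀, x₀⟩
  set R := ‖x₀‖ + 1 + ρ with hR
  set K : ℝ≥0∞ := M * volume (Metric.ball (0 : E3) R) ^ (1 / 2 : ℝ) with hK
  have hKtop : K ≠ ⊤ := ENNReal.mul_ne_top ENNReal.coe_ne_top
    (ENNReal.rpow_ne_top_of_nonneg (by norm_num) measure_ball_lt_top.ne)
  have hbd : ∀ t x, ‖x - x₀‖ < 1 → ‖conv k (a t) x - conv k (a t₀) x‖ₑ ≤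
      K * eLpNorm (a t - a t₀) 2 (ballMeasure 0 R) := by
    intro t x hx
    have h1 : conv k (a t) x - conv k (a t₀) x = ∫ y, k (x - y) • (a t - a t₀) y := by
      unfold conv
      rw [← integral_sub (integrable_conv_kernel hk.continuous hks (h.locallyIntegrable t) x)
        (integrable_conv_kernel hk.continuous hks (h.locallyIntegrable t₀) x)]
      simp only [Pi.sub_apply, smul_sub]
    rw [h1]
    refine (enorm_integral_le_lintegral_enorm _).trans ?_
    refine enorm_integral_smul_le (fun y => hM (x - y)) (fun y hy => ?_)
      ((h.aestronglyMeasurable t).sub (h.aestronglyMeasurable t₀))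
    calc ‖y‖ = ‖x₀ + (x - x₀) - (x - y)‖ := by congr 1; abel
      _ ≤ ‖x₀‖ + ‖x - x₀‖ + ‖x - y‖ :=
        (norm_sub_le _ _).trans (by gcongr; exact norm_add_le _ _)
      _ < R := by linarith [hρk _ hy]
  have hlim1 : Tendsto (fun p : ℝ × E3 => conv k (a p.1) p.2 - conv k (a t₀) p.2) (𝓝 (t₀, x₀))
      (𝓝 0) := by
    rw [tendsto_zero_iff_norm_tendsto_zero]
    have h2 : Tendsto (fun p : ℝ × E3 => K * eLpNorm (a p.1 - a t₀) 2 (ballMeasure 0 R))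
        (𝓝 (t₀, x₀)) (𝓝 0) := by
      have h3 : Tendsto (fun p : ℝ × E3 => eLpNorm (a p.1 - a t₀) 2 (ballMeasure 0 R))
          (𝓝 (t₀, x₀)) (𝓝 0) := (h.tendsto R t₀).comp continuous_fst.continuousAt
      simpa using ENNReal.Tendsto.const_mul h3 (Or.inr hKtop)
    have h4 : Tendsto (fun p : ℝ × E3 => ‖conv k (a p.1) p.2 - conv k (a t₀) p.2‖ₑ) (𝓝 (t₀, x₀))
        (𝓝 0) := by
      refine tendsto_of_tendsto_of_tendsto_of_le_of_le' tendsto_const_nhds h2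
        (Eventually.of_forall fun _ => zero_le) ?_
      have h5 : ∀ᶠ p : ℝ × E3 in 𝓝 (t₀, x₀), ‖p.2 - x₀‖ < 1 := by
        refine ((by fun_prop : Continuous fun p : ℝ × E3 => ‖p.2 - x₀‖).tendsto
          (t₀, x₀)).eventually_lt_const ?_
        simp
      filter_upwards [h5] with p hp using hbd p.1 p.2 hp
    have h6 := (ENNReal.tendsto_toReal ENNReal.zero_ne_top).comp h4
    simpa [Function.comp_def] using h6
  have hlim2 : Tendsto (fun p : ℝ × E3 => conv k (a t₀) p.2) (𝓝 (t₀, x₀))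
      (𝓝 (conv k (a t₀) x₀)) :=
    ((contDiff_conv hk hks (h.locallyIntegrable t₀)).continuous.comp continuous_snd).tendsto _
  have := hlim1.add hlim2
  simpa [ContinuousAt] using this

theorem continuous_integral_smul [NormedSpace ℝ F] [CompleteSpace F] (h : L2LocCurve a) {k : E3 → ℝ}
    (hk : ContDiff ℝ ∞ k) (hks : HasCompactSupport k) :
    Continuous fun t => ∫ y, k y • a t y := by
  have h1 := (h.continuous_conv (k := fun y => k (-y)) (hk.comp contDiff_neg)
    (hks.comp_homeomorph (Homeomorph.neg E3))).comp (Continuous.prodMk_left (0 : E3))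
  simpa [Function.comp_def, conv] using h1

end L2LocCurve

end

/-! ### Algebra of weak gradients; components of the energy norm -/

theorem weakGradient_spec {w : E3 → ℝ} (h : ∃ D, IsWeakGradient w D) :
    IsWeakGradient w (weakGradient w) := by
  unfold weakGradient
  rw [dif_pos h]
  exact h.choose_spec

namespace IsWeakGradient

variable {w w' : E3 → ℝ} {D D' : E3 → E3}

theorem ae_eq (h : IsWeakGradient w D) (h' : IsWeakGradient w D') : D =ᵐ[volume] D' := by
  refine ae_eq_of_integral_contDiff_smul_eq h.locallyIntegrable_grad h'.locallyIntegrable_grad ?_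
  intro φ hφ hφs
  have h1 := h.integral_eq φ hφ hφs
  rw [h'.integral_eq φ hφ hφs] at h1
  exact (neg_inj.1 h1).symm

theorem congr (h : IsWeakGradient w D) (hw : w =ᵐ[volume] w') : IsWeakGradient w' D where
  locallyIntegrable := h.locallyIntegrable.congr hw
  locallyIntegrable_grad := h.locallyIntegrable_grad
  integral_eq φ hφ hφs := by
    rw [← h.integral_eq φ hφ hφs]
    refine integral_congr_ae ?_
    filter_upwards [hw] with x hx
    rw [hx]

theorem _root_.WaveR3.continuous_gradient {φ : E3 → ℝ} (hφ : ContDiff ℝ ∞ φ) :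
    Continuous (gradient φ) := by
  unfold gradient
  exact (InnerProductSpace.toDual ℝ E3).symm.continuous.comp (hφ.continuous_fderiv (by simp))

theorem _root_.WaveR3.hasCompactSupport_gradient {φ : E3 → ℝ} (hφs : HasCompactSupport φ) :
    HasCompactSupport (gradient φ) :=
  (hφs.fderiv (𝕜 := ℝ)).comp_left (g := (InnerProductSpace.toDual ℝ E3).symm) (map_zero _)

theorem sub (h : IsWeakGradient w D) (h' : IsWeakGradient w' D') :
    IsWeakGradient (w - w') (D - D') where
  locallyIntegrable := h.locallyIntegrable.sub h'.locallyIntegrable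
  locallyIntegrable_grad := h.locallyIntegrable_grad.sub h'.locallyIntegrable_grad
  integral_eq φ hφ hφs := by
    have hg := continuous_gradient hφ
    have hgs := hasCompactSupport_gradient hφs
    simp only [Pi.sub_apply, sub_smul, smul_sub]
    rw [integral_sub (h.locallyIntegrable.integrable_smul_right_of_hasCompactSupport hg hgs)
      (h'.locallyIntegrable.integrable_smul_right_of_hasCompactSupport hg hgs),
      integral_sub (integrable_smul_kernel hφ.continuous hφs h.locallyIntegrable_grad)
      (integrable_smul_kernel hφ.continuous hφs h'.locallyIntegrable_grad),
      h.integral_eq φ hφ hφs, h'.integral_eq φ hφ hφs]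
    abel

theorem weakGradient_ae_eq (h : IsWeakGradient w D) : weakGradient w =ᵐ[volume] D :=
  (weakGradient_spec ⟨D, h⟩).ae_eq h

end IsWeakGradient

theorem le_sqrt_sum_sq {x s : ℝ≥0∞} (h : x ^ 2 ≤ s) : x ≤ s ^ (1 / 2 : ℝ) := by
  rw [one_div, ENNReal.le_rpow_inv_iff two_pos]
  exact_mod_cast h

theorem eLpNorm_fst_le_energyNorm (x₀ : E3) (R : ℝ) (a b : E3 → ℝ) :
    eLpNorm a 2 (ballMeasure x₀ R) ≤ energyNorm x₀ R a b :=
  le_sqrt_sum_sq (by rw [add_assoc]; exact le_self_add)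

theorem eLpNorm_grad_le_energyNorm (x₀ : E3) (R : ℝ) (a b : E3 → ℝ) :
    eLpNorm (weakGradient a) 2 (ballMeasure x₀ R) ≤ energyNorm x₀ R a b :=
  le_sqrt_sum_sq (by rw [add_comm (_ ^ 2), add_assoc]; exact le_self_add)

theorem eLpNorm_snd_le_energyNorm (x₀ : E3) (R : ℝ) (a b : E3 → ℝ) :
    eLpNorm b 2 (ballMeasure x₀ R) ≤ energyNorm x₀ R a b :=
  le_sqrt_sum_sq le_add_self

theorem energyNorm_le_add (x₀ : E3) (R : ℝ) (a b : E3 → ℝ) :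
    energyNorm x₀ R a b ≤ eLpNorm a 2 (ballMeasure x₀ R)
      + eLpNorm (weakGradient a) 2 (ballMeasure x₀ R) + eLpNorm b 2 (ballMeasure x₀ R) := by
  unfold energyNorm
  rw [one_div, ENNReal.rpow_inv_le_iff two_pos]
  have h : ∀ x y z : ℝ≥0∞, x ^ 2 + y ^ 2 + z ^ 2 ≤ (x + y + z) ^ (2 : ℝ) := by
    intro x y z
    rw [ENNReal.rpow_two]
    have : (x + y + z) ^ 2 = x ^ 2 + y ^ 2 + z ^ 2 + 2 * (x * y + y * z + x * z) := by ring
    rw [this]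
    exact le_self_add
  exact h _ _ _

/-- An energy curve solving `∂ₜw = v`, `∂ₜv + γ v - Δw + w = G` weakly, in time-integrated form. -/
structure IntegratedWave (γ : ℝ) (w v : ℝ → E3 → ℝ) (D : ℝ → E3 → E3) (G : ℝ → E3 → ℝ) :
    Prop where
  curve_fst : L2LocCurve w
  curve_snd : L2LocCurve v
  curve_grad : L2LocCurve D
  grad : ∀ t, IsWeakGradient (w t) (D t)
  force : MemLpLoc 1 2 G
  eq_fst : ∀ k : E3 → ℝ, ContDiff ℝ ∞ k → HasCompactSupport k → ∀ t, 0 ≤ t →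
    (∫ y, k y * w t y) - ∫ y, k y * w 0 y = ∫ s in (0 : ℝ)..t, ∫ y, k y * v s y
  eq_snd : ∀ k : E3 → ℝ, ContDiff ℝ ∞ k → HasCompactSupport k → ∀ t, 0 ≤ t →
    (∫ y, k y * v t y) - ∫ y, k y * v 0 y = ∫ s in (0 : ℝ)..t,
      (-γ * (∫ y, k y * v s y) - (∫ y, k y * w s y) - (∫ y, inner ℝ (D s y) (gradient k y))
        + ∫ y, k y * G s y)

/-! ### Forces in L¹_loc(L²_loc) -/

namespace MemLpLoc

variable {G H : ℝ → E3 → ℝ}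

theorem lintegral_lt_top (h : MemLpLoc 1 2 G) (T R : ℝ) :
    ∫⁻ t in Ioo 0 T, eLpNorm (G t) 2 (ballMeasure 0 R) < ⊤ := by
  simpa [eLpNorm_one_eq_lintegral_enorm] using h.norm_lt_top T R

theorem aestronglyMeasurable_prod {p q : ℝ≥0∞} (h : MemLpLoc p q G) :
    AEStronglyMeasurable (fun z : ℝ × E3 => G z.1 z.2)
      ((volume.restrict (Ioi (0 : ℝ))).prod (volume : Measure E3)) := by
  have h1 := h.aestronglyMeasurable
  rwa [Measure.volume_eq_prod, ← Measure.prod_restrict, Measure.restrict_univ] at h1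

theorem ae_aestronglyMeasurable {p q : ℝ≥0∞} (h : MemLpLoc p q G) :
    ∀ᵐ t ∂volume.restrict (Ioi (0 : ℝ)), AEStronglyMeasurable (G t) volume :=
  h.aestronglyMeasurable_prod.prodMk_left

/-- The radius may depend on time, as it does for slices of a cone. The norm is rewritten as an
integral over the sections of one measurable space-time set, and Tonelli applies. -/
theorem aemeasurable_eLpNorm {p q : ℝ≥0∞} (h : MemLpLoc p q G) {r : ℝ≥0∞} (hr : r ≠ 0) (hr' : r ≠ ⊤)
    (x₀ : E3) (R : ℝ → ℝ) (hR : Measurable R) :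
    AEMeasurable (fun t => eLpNorm (G t) r (ballMeasure x₀ (R t))) (volume.restrict (Ioi (0 : ℝ))) := by
  simp_rw [eLpNorm_eq_lintegral_rpow_enorm_toReal hr hr']
  refine AEMeasurable.pow_const ?_ _
  have h1 : ∀ t, ∫⁻ x, ‖G t x‖ₑ ^ r.toReal ∂ballMeasure x₀ (R t) =
      ∫⁻ x, {z : ℝ × E3 | dist z.2 x₀ < R z.1}.indicator (fun z => ‖G z.1 z.2‖ₑ ^ r.toReal) (t, x) := by
    intro t
    unfold ballMeasure
    rw [← lintegral_indicator measurableSet_ball]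
    rfl
  simp_rw [h1]
  refine AEMeasurable.lintegral_prod_right' (f := fun z : ℝ × E3 =>
    {z : ℝ × E3 | dist z.2 x₀ < R z.1}.indicator (fun z => ‖G z.1 z.2‖ₑ ^ r.toReal) z) ?_
  refine AEMeasurable.indicator ?_ ?_
  · exact h.aestronglyMeasurable_prod.enorm.pow_const _
  · exact measurableSet_lt (by fun_prop) (hR.comp measurable_fst)

theorem sub (hG : MemLpLoc 1 2 G) (hH : MemLpLoc 1 2 H) : MemLpLoc 1 2 (G - H) where
  aestronglyMeasurable := hG.aestronglyMeasurable.sub hH.aestronglyMeasurable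
  norm_lt_top T R := by
    rw [eLpNorm_one_eq_lintegral_enorm]
    simp only [enorm_eq_self]
    have h1 : ∫⁻ t in Ioo 0 T, eLpNorm ((G - H) t) 2 (ballMeasure 0 R) ≤
        ∫⁻ t in Ioo 0 T, (eLpNorm (G t) 2 (ballMeasure 0 R) + eLpNorm (H t) 2 (ballMeasure 0 R)) := by
      refine lintegral_mono_ae ?_
      have hle : volume.restrict (Ioo (0 : ℝ) T) ≤ volume.restrict (Ioi 0) :=
        Measure.restrict_mono (fun x hx => hx.1) le_rfl
      filter_upwards [ae_mono hle hG.ae_aestronglyMeasurable,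
        ae_mono hle hH.ae_aestronglyMeasurable] with t h1 h2
      exact eLpNorm_sub_le h1.restrict h2.restrict (by norm_num)
    refine h1.trans_lt ?_
    rw [lintegral_add_left' ((hG.aemeasurable_eLpNorm two_ne_zero (by norm_num) 0 (fun _ => R)
      measurable_const).mono_measure (Measure.restrict_mono (fun x hx => hx.1) le_rfl))]
    exact ENNReal.add_lt_top.2 ⟨hG.lintegral_lt_top T R, hH.lintegral_lt_top T R⟩

/-- Pairing a locally integrable curve with a kernel gives a locally integrable function of time. -/
theorem integrableOn_integral_mul (h : MemLpLoc 1 2 G) {k : E3 → ℝ} (hk : Continuous k)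
    (hks : HasCompactSupport k) (T : ℝ) :
    IntegrableOn (fun t => ∫ y, k y * G t y) (Ioo 0 T) := by
  obtain ⟨M, ρ, hρ, hM, hρk⟩ := exists_kernel_bound hk hks
  have hle : volume.restrict (Ioo (0 : ℝ) T) ≤ volume.restrict (Ioi 0) :=
    Measure.restrict_mono (fun x hx => hx.1) le_rfl
  constructor
  · refine AEStronglyMeasurable.mono_measure ?_ hle
    refine AEStronglyMeasurable.integral_prod_right' (f := fun z : ℝ × E3 => k z.2 * G z.1 z.2) ?_
    exact (hk.comp continuous_snd).aestronglyMeasurable.mul h.aestronglyMeasurable_prod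
  · refine lt_of_le_of_lt (b := ∫⁻ t in Ioo 0 T,
      M * volume (Metric.ball (0 : E3) ρ) ^ (1 / 2 : ℝ) * eLpNorm (G t) 2 (ballMeasure 0 ρ)) ?_ ?_
    · refine lintegral_mono_ae ?_
      filter_upwards [ae_mono hle h.ae_aestronglyMeasurable] with t ht
      exact (enorm_integral_le_lintegral_enorm _).trans (enorm_integral_smul_le hM hρk ht)
    · rw [lintegral_const_mul' _ _ (ENNReal.mul_ne_top ENNReal.coe_ne_top
        (ENNReal.rpow_ne_top_of_nonneg (by norm_num) measure_ball_lt_top.ne))]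
      exact ENNReal.mul_lt_top (ENNReal.mul_lt_top ENNReal.coe_lt_top
        (ENNReal.rpow_lt_top_of_nonneg (by norm_num) measure_ball_lt_top.ne)) (h.lintegral_lt_top T ρ)

end MemLpLoc

/-! ### Bounds on the nonlinearity -/

theorem QuinticNonlinearity.map_zero {f : ℝ → ℝ} (hf : QuinticNonlinearity f) : f 0 = 0 := by
  obtain ⟨-, h, C, q, -, -, hfh, -, h0⟩ := hf
  rw [hfh, h0]; norm_num

/-- Integrating h'' once gives h' = O(1 + |z|^{q+1}) = O(1 + z⁴) because q < 3, so the quintic term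
dictates the growth of f'. The mean value inequality on [-m, m] with m = max(|a|, |b|) then
concludes, since m⁴ ≤ a⁴ + b⁴. -/
theorem QuinticNonlinearity.exists_lipschitz_bound {f : ℝ → ℝ} (hf : QuinticNonlinearity f) :
    ∃ C : ℝ≥0, ∀ a b, |f a - f b| ≤ C * ((1 + a ^ 4 + b ^ 4) * |a - b|) := by
  obtain ⟨hfc, h, C, q, hq0, hq3, hfh, hh, -⟩ := hf
  have hhf : h = fun z => f z - z ^ 5 := by ext z; rw [hfh]; ring
  have hhc : ContDiff ℝ 2 h := by rw [hhf]; exact hfc.sub (contDiff_id.pow 5)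
  have hC : 0 ≤ C := by
    have h1 := (abs_nonneg _).trans (hh 1)
    rw [abs_one, Real.one_rpow] at h1
    linarith
  have hd1 : ContDiff ℝ 1 (deriv h) := by
    have h2 : ContDiff ℝ (1 + 1) h := by simpa [one_add_one_eq_two] using hhc
    exact (contDiff_succ_iff_deriv.1 h2).2.2
  have hder : ∀ z, |deriv h z| ≤ |deriv h 0| + 2 * C * (1 + z ^ 4) := by
    intro z
    have hz4 : |z| ^ 4 = z ^ 4 := by rw [← abs_pow, abs_of_nonneg (by positivity)]
    have h1 : ‖deriv h z - deriv h 0‖ ≤ C * (1 + |z| ^ q) * ‖z - 0‖ := by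
      refine Convex.norm_image_sub_le_of_norm_deriv_le (s := Icc (-|z|) |z|)
        (fun x _ => hd1.differentiable one_ne_zero x) ?_ (convex_Icc _ _)
        ⟨by simp, by simp⟩ ⟨neg_abs_le z, le_abs_self z⟩
      intro x hx
      have h2 := hh x
      rw [iteratedDeriv_succ, iteratedDeriv_one] at h2
      refine h2.trans ?_
      have : |x| ≤ |z| := abs_le.2 hx
      gcongr
    have h2 : (1 + |z| ^ q) * |z| ≤ 2 * (1 + z ^ 4) := by
      rw [← hz4]
      rcases le_total |z| 1 with h3 | h3
      · have : |z| ^ q ≤ 1 := Real.rpow_le_one (abs_nonneg z) h3 hq0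
        have h4 : 0 ≤ |z| ^ 4 := by positivity
        nlinarith [abs_nonneg z, Real.rpow_nonneg (abs_nonneg z) q]
      · have h4 : |z| ^ q ≤ |z| ^ (3 : ℝ) := Real.rpow_le_rpow_of_exponent_le h3 hq3.le
        have h5 : |z| ^ (3 : ℝ) = |z| ^ 3 := by exact_mod_cast Real.rpow_natCast |z| 3
        rw [h5] at h4
        have h6 : |z| ≤ |z| ^ 4 := le_self_pow₀ h3 (by norm_num)
        nlinarith [abs_nonneg z]
    rw [sub_zero, Real.norm_eq_abs, Real.norm_eq_abs] at h1
    have h3 : |deriv h z| ≤ |deriv h 0| + |deriv h z - deriv h 0| := by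
      have := abs_sub_abs_le_abs_sub (deriv h z) (deriv h 0); linarith
    nlinarith
  have hfd : ∀ z, |deriv f z| ≤ (5 + |deriv h 0| + 2 * C) * (1 + z ^ 4) := by
    intro z
    have h1 : f = fun z => z ^ 5 + h z := funext hfh
    have h2 : deriv f z = 5 * z ^ 4 + deriv h z := by
      have h3 := ((hasDerivAt_pow 5 z).add
        ((hhc.differentiable two_ne_zero) z).hasDerivAt).deriv
      rw [h1]
      simpa [Pi.add_def] using h3
    rw [h2]
    refine (abs_add_le _ _).trans ?_
    rw [abs_of_nonneg (by positivity)]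
    have := hder z
    have h4 : 0 ≤ z ^ 4 := by positivity
    nlinarith [abs_nonneg (deriv h 0)]
  set K : ℝ := 5 + |deriv h 0| + 2 * C with hK
  have hK0 : 0 ≤ K := by positivity
  refine ⟨⟨K, hK0⟩, fun a b => ?_⟩
  change _ ≤ K * _
  set m := max |a| |b| with hm
  have hm4 : m ^ 4 ≤ a ^ 4 + b ^ 4 := by
    have ha : |a| ^ 4 = a ^ 4 := by rw [← abs_pow, abs_of_nonneg (by positivity)]
    have hb : |b| ^ 4 = b ^ 4 := by rw [← abs_pow, abs_of_nonneg (by positivity)]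
    have ha0 : 0 ≤ a ^ 4 := by positivity
    have hb0 : 0 ≤ b ^ 4 := by positivity
    rcases max_cases |a| |b| with h1 | h1
    · rw [hm, h1.1]; linarith
    · rw [hm, h1.1]; linarith
  have h1 : ‖f a - f b‖ ≤ K * (1 + a ^ 4 + b ^ 4) * ‖a - b‖ := by
    refine Convex.norm_image_sub_le_of_norm_deriv_le (s := Icc (-m) m)
      (fun x _ => hfc.differentiable two_ne_zero x) ?_ (convex_Icc _ _)
      (abs_le.1 (le_max_right _ _)) (abs_le.1 (le_max_left _ _))
    intro x hx
    refine (hfd x).trans ?_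
    have h2 : |x| ≤ m := abs_le.2 hx
    have h3 : |x| ^ 4 ≤ m ^ 4 := by gcongr
    rw [← abs_pow, abs_of_nonneg (by positivity)] at h3
    have h4 : 1 + x ^ 4 ≤ 1 + a ^ 4 + b ^ 4 := by linarith
    gcongr
  rw [← mul_assoc]
  exact h1

instance holderTriple_three_six_two : ENNReal.HolderTriple 3 6 2 where
  inv_add_inv_eq_inv := by
    have h3 : (3 : ℝ≥0∞)⁻¹ = 2 * 6⁻¹ := by
      rw [show (6 : ℝ≥0∞) = 2 * 3 by norm_num, ENNReal.mul_inv (by norm_num) (by norm_num),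
        ← mul_assoc, ENNReal.mul_inv_cancel (by norm_num) (by norm_num), one_mul]
    have h2 : (2 : ℝ≥0∞)⁻¹ = 3 * 6⁻¹ := by
      rw [show (6 : ℝ≥0∞) = 3 * 2 by norm_num, ENNReal.mul_inv (by norm_num) (by norm_num),
        ← mul_assoc, ENNReal.mul_inv_cancel (by norm_num) (by norm_num), one_mul]
    rw [h3, h2]
    ring

/-- Hölder with 1/2 = 1/3 + 1/6 and ‖u⁴‖₃ = ‖u‖₁₂⁴. The fourth power is what the L⁴ norm in time of
the Strichartz space makes integrable. -/
theorem eLpNorm_pow_four_mul_le {μ : Measure E3} {u w : E3 → ℝ} (hu : AEStronglyMeasurable u μ)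
    (hw : AEStronglyMeasurable w μ) :
    eLpNorm (fun x => u x ^ 4 * w x) 2 μ ≤ eLpNorm u 12 μ ^ 4 * eLpNorm w 6 μ := by
  have h1 := eLpNorm_smul_le_mul_eLpNorm (p := 3) (q := 6) (r := 2) hw (hu.pow 4)
  have h2 : eLpNorm (u ^ 4) 3 μ = eLpNorm u 12 μ ^ 4 := by
    have h3 := eLpNorm_norm_rpow (μ := μ) (p := 3) u (q := 4) (by norm_num)
    have h4 : eLpNorm (u ^ 4) 3 μ = eLpNorm (fun x => ‖u x‖ ^ (4 : ℝ)) 3 μ := by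
      refine eLpNorm_congr_norm_ae (ae_of_all _ fun x => ?_)
      have : ‖u x‖ ^ (4 : ℝ) = ‖u x‖ ^ 4 := by exact_mod_cast Real.rpow_natCast ‖u x‖ 4
      rw [this]
      simp
    rw [h4, h3]
    norm_num
  rw [h2] at h1
  exact h1

theorem eLpNorm_nonlinearity_sub_le {f : ℝ → ℝ} {C : ℝ≥0}
    (hC : ∀ a b, |f a - f b| ≤ C * ((1 + a ^ 4 + b ^ 4) * |a - b|)) {μ : Measure E3}
    {u₁ u₂ : E3 → ℝ} (h₁ : AEStronglyMeasurable u₁ μ) (h₂ : AEStronglyMeasurable u₂ μ) :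
    eLpNorm (fun x => f (u₁ x) - f (u₂ x)) 2 μ ≤ C * (eLpNorm (u₁ - u₂) 2 μ +
      (eLpNorm u₁ 12 μ ^ 4 + eLpNorm u₂ 12 μ ^ 4) * eLpNorm (u₁ - u₂) 6 μ) := by
  have hw := h₁.sub h₂
  set w := u₁ - u₂ with hwd
  have h3 : ∀ x, ‖f (u₁ x) - f (u₂ x)‖ ≤
      C * ‖w x + (u₁ x ^ 4 * w x + u₂ x ^ 4 * w x)‖ := by
    intro x
    refine (hC _ _).trans_eq ?_
    rw [show w x + (u₁ x ^ 4 * w x + u₂ x ^ 4 * w x) = (1 + u₁ x ^ 4 + u₂ x ^ 4) * w x by ring,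
      norm_mul, Real.norm_of_nonneg (by positivity)]
    rfl
  have h4 := eLpNorm_le_nnreal_smul_eLpNorm_of_ae_le_mul (μ := μ) (ae_of_all _ h3) 2
  refine h4.trans ?_
  rw [ENNReal.smul_def, smul_eq_mul]
  refine mul_le_mul_right ?_ _
  have h5 : AEStronglyMeasurable (fun x => u₁ x ^ 4 * w x) μ := (h₁.pow 4).mul hw
  have h6 : AEStronglyMeasurable (fun x => u₂ x ^ 4 * w x) μ := (h₂.pow 4).mul hw
  refine (eLpNorm_add_le hw (h5.add h6) (by norm_num)).trans ?_
  refine add_le_add le_rfl ?_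
  refine (eLpNorm_add_le h5 h6 (by norm_num)).trans ?_
  rw [add_mul]
  exact add_le_add (eLpNorm_pow_four_mul_le h₁ hw) (eLpNorm_pow_four_mul_le h₂ hw)

theorem MemLpLoc.lintegral_pow_four_lt_top {u : ℝ → E3 → ℝ} (h : MemLpLoc 4 12 u) (T R : ℝ) :
    ∫⁻ t in Ioo 0 T, eLpNorm (u t) 12 (ballMeasure 0 R) ^ 4 < ⊤ := by
  have h1 := lintegral_rpow_enorm_lt_top_of_eLpNorm_lt_top (by norm_num) (by norm_num)
    (h.norm_lt_top T R)
  refine lt_of_le_of_lt (le_of_eq (lintegral_congr fun t => ?_)) h1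
  rw [enorm_eq_self]
  norm_num

/-- The nonlinearity of a curve in `H¹_loc` with finite local Strichartz norm
is in `L¹_loc(L²_loc)`. -/
theorem memLpLoc_nonlinearity {f : ℝ → ℝ} (hf : QuinticNonlinearity f) {u : ℝ → E3 → ℝ}
    {D : ℝ → E3 → E3} (hu : L2LocCurve fun t => u (max t 0)) (hD : L2LocCurve D)
    (hgrad : ∀ t, IsWeakGradient (u (max t 0)) (D t)) (hs : MemLpLoc 4 12 u) :
    MemLpLoc 1 2 fun t x => f (u t x) where
  aestronglyMeasurable :=
    hf.1.continuous.comp_aestronglyMeasurable hs.aestronglyMeasurable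
  norm_lt_top T R := by
    obtain ⟨C, hC⟩ := hf.exists_lipschitz_bound
    obtain ⟨S, hS⟩ := sobolev_ball_weak
    -- The Sobolev inequality needs a positive radius, whereas R is arbitrary here.
    set R' := max R 1 with hR'
    have hR0 : 0 < R' := by positivity
    obtain ⟨M, hM⟩ := hu.bounded R' T
    obtain ⟨N, hN⟩ := hD.bounded R' T
    rw [eLpNorm_one_eq_lintegral_enorm]
    simp only [enorm_eq_self]
    set K : ℝ≥0∞ := S * (N + M / ENNReal.ofReal R') with hK
    have hKtop : K ≠ ⊤ := by
      refine ENNReal.mul_ne_top ENNReal.coe_ne_top (ENNReal.add_ne_top.2 ⟨ENNReal.coe_ne_top, ?_⟩)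
      exact (ENNReal.div_lt_top ENNReal.coe_ne_top (by simpa using hR0)).ne
    have h1 : ∫⁻ t in Ioo 0 T, eLpNorm (fun x => f (u t x)) 2 (ballMeasure 0 R) ≤
        ∫⁻ t in Ioo 0 T, (C * M + C * K * eLpNorm (u t) 12 (ballMeasure 0 R') ^ 4) := by
      refine setLIntegral_mono' measurableSet_Ioo fun t ht => ?_
      have htu : u (max t 0) = u t := by rw [max_eq_left ht.1.le]
      have hum : AEStronglyMeasurable (u t) (ballMeasure 0 R') := by
        have := (hu.memLp t R').1
        rwa [htu] at this
      have hM' : eLpNorm (u t) 2 (ballMeasure 0 R') ≤ M := by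
        simpa only [htu] using hM t ⟨ht.1.le, ht.2.le⟩
      -- The difference estimate is applied to u and 0, using f(0) = 0.
      have h2 := eLpNorm_nonlinearity_sub_le hC hum
        (aestronglyMeasurable_const (b := (0 : ℝ)))
      simp only [hf.map_zero, sub_zero] at h2
      have h3 : eLpNorm (fun _ : E3 => (0 : ℝ)) 12 (ballMeasure 0 R') ^ 4 = 0 := by simp
      have h4 : (u t - fun _ => (0 : ℝ)) = u t := by ext x; simp
      rw [h3, h4, add_zero] at h2
      have h5 : eLpNorm (u t) 6 (ballMeasure 0 R') ≤ K := by
        have h6 := hS _ _ (hgrad t) 0 R' hR0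
        rw [htu] at h6
        refine h6.trans ?_
        rw [hK]
        gcongr
        exact hN t ⟨ht.1.le, ht.2.le⟩
      calc eLpNorm (fun x => f (u t x)) 2 (ballMeasure 0 R)
          ≤ eLpNorm (fun x => f (u t x)) 2 (ballMeasure 0 R') :=
            eLpNorm_mono_measure _ (ballMeasure_mono (by simp [hR']))
        _ ≤ C * (M + eLpNorm (u t) 12 (ballMeasure 0 R') ^ 4 * K) := by
            refine h2.trans ?_
            gcongr
        _ = _ := by ring
    refine h1.trans_lt ?_
    rw [lintegral_add_left measurable_const, lintegral_const_mul' _ _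
      (ENNReal.mul_ne_top ENNReal.coe_ne_top hKtop), setLIntegral_const]
    refine ENNReal.add_lt_top.2 ⟨ENNReal.mul_lt_top (ENNReal.mul_lt_top ENNReal.coe_lt_top
      ENNReal.coe_lt_top) (by simp), ENNReal.mul_lt_top (ENNReal.mul_lt_top ENNReal.coe_lt_top
      hKtop.lt_top) (hs.lintegral_pow_four_lt_top T R')⟩

/-! ### From the weak formulation to the time-integrated equation -/

theorem integral_linear_combination {μ : Measure ℝ} {a b c d e : ℝ → ℝ} {γ : ℝ}
    (ha : Integrable a μ) (hb : Integrable b μ) (hc : Integrable c μ) (hd : Integrable d μ)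
    (he : Integrable e μ) :
    ∫ t, (-γ * a t - b t - c t + (d t - e t)) ∂μ =
      -γ * (∫ t, a t ∂μ) - (∫ t, b t ∂μ) - (∫ t, c t ∂μ) + ((∫ t, d t ∂μ) - ∫ t, e t ∂μ) := by
  have ha' := ha.const_mul (-γ)
  have h1 : Integrable (fun t => -γ * a t - b t) μ := ha'.sub hb
  have h2 : Integrable (fun t => -γ * a t - b t - c t) μ := h1.sub hc
  have h3 : Integrable (fun t => d t - e t) μ := hd.sub he
  rw [integral_add h2 h3, integral_sub h1 hc, integral_sub ha' hb, integral_sub hd he,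
    integral_const_mul]

theorem isTest_mul {θ : ℝ → ℝ} (hθ : ContDiff ℝ ∞ θ) (hθs : HasCompactSupport θ)
    (hθ0 : tsupport θ ⊆ Ioi 0) {k : E3 → ℝ} (hk : ContDiff ℝ ∞ k) (hks : HasCompactSupport k) :
    IsTest fun z : ℝ × E3 => θ z.1 * k z.2 := by
  have hsub : Function.support (fun z : ℝ × E3 => θ z.1 * k z.2) ⊆ tsupport θ ×ˢ tsupport k := by
    intro z hz
    exact ⟨subset_tsupport θ (left_ne_zero_of_mul hz), subset_tsupport k (right_ne_zero_of_mul hz)⟩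
  have hcl : IsClosed (tsupport θ ×ˢ tsupport k) :=
    (isClosed_tsupport θ).prod (isClosed_tsupport k)
  refine ⟨(hθ.comp contDiff_fst).mul (hk.comp contDiff_snd), ?_, ?_⟩
  · exact HasCompactSupport.of_support_subset_isCompact (hθs.isCompact.prod hks.isCompact) hsub
  · exact (closure_minimal hsub hcl).trans (prod_mono hθ0 (subset_univ _))

theorem dt_mul (θ : ℝ → ℝ) (k : E3 → ℝ) (t : ℝ) (x : E3) :
    dt (fun z : ℝ × E3 => θ z.1 * k z.2) t x = deriv θ t * k x := by
  simp [dt]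

theorem gradx_mul (θ : ℝ → ℝ) {k : E3 → ℝ} (hk : ContDiff ℝ ∞ k) (t : ℝ) (x : E3) :
    gradx (fun z : ℝ × E3 => θ z.1 * k z.2) t x = θ t • gradient k x := by
  unfold gradx gradient
  simp only
  rw [fderiv_const_mul (hk.differentiable (by simp) x), map_smul]

theorem integrableOn_mul_test {a θ : ℝ → ℝ} (ha : ∀ T, IntegrableOn a (Ioo 0 T))
    (hθ : Continuous θ) (hθs : HasCompactSupport θ) :
    IntegrableOn (fun t => a t * θ t) (Ioi 0) := by
  obtain ⟨T, -, hT⟩ := hθs.isBounded.subset_ball_lt 0 0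
  have h1 : IntegrableOn (fun t => a t * θ t) (Ioo 0 T) := by
    obtain ⟨M, hM⟩ := hθs.exists_bound_of_continuous hθ
    exact (ha T).mul_bdd (c := M) hθ.aestronglyMeasurable (ae_of_all _ hM)
  refine h1.of_forall_sdiff_eq_zero measurableSet_Ioi fun t ht => ?_
  have : θ t = 0 := by
    by_contra hcon
    have h2 := hT (subset_tsupport θ hcon)
    rw [mem_ball_zero_iff, Real.norm_eq_abs] at h2
    exact ht.2 ⟨ht.1, (le_abs_self t).trans_lt h2⟩
  rw [this, mul_zero]

theorem MemLpLoc.ae_locallyIntegrable {G : ℝ → E3 → ℝ} (h : MemLpLoc 1 2 G) :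
    ∀ᵐ t ∂volume.restrict (Ioi (0 : ℝ)), LocallyIntegrable (G t) volume := by
  have h1 : ∀ n : ℕ, ∀ᵐ t ∂volume.restrict (Ioo (0 : ℝ) n),
      eLpNorm (G t) 2 (ballMeasure 0 n) < ⊤ := by
    intro n
    refine ae_lt_top' ?_ (h.lintegral_lt_top n n).ne
    exact (h.aemeasurable_eLpNorm two_ne_zero (by norm_num) 0 (fun _ => n)
      measurable_const).mono_measure (Measure.restrict_mono (fun x hx => hx.1) le_rfl)
  rw [ae_restrict_iff' measurableSet_Ioi]
  have h2 : ∀ᵐ t : ℝ, ∀ n : ℕ, t ∈ Ioo (0 : ℝ) n → eLpNorm (G t) 2 (ballMeasure 0 n) < ⊤ :=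
    ae_all_iff.2 fun n => (ae_restrict_iff' measurableSet_Ioo).1 (h1 n)
  have h3 := (ae_restrict_iff' measurableSet_Ioi).1 h.ae_aestronglyMeasurable
  filter_upwards [h2, h3] with t ht htm ht0
  refine locallyIntegrable_of_memLp_ball fun R => ?_
  obtain ⟨n, hn⟩ := exists_nat_gt (max t R)
  have h4 : MemLp (G t) 2 (ballMeasure 0 n) :=
    ⟨(htm ht0).restrict, ht n ⟨ht0, (le_max_left _ _).trans_lt hn⟩⟩
  exact h4.mono_measure (ballMeasure_mono (by simpa using ((le_max_right t R).trans hn.le)))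

theorem MemLpLoc.ae_integral_mul_sub {G H : ℝ → E3 → ℝ} (hG : MemLpLoc 1 2 G)
    (hH : MemLpLoc 1 2 H) {k : E3 → ℝ} (hk : Continuous k) (hks : HasCompactSupport k) :
    ∀ᵐ t ∂volume.restrict (Ioi (0 : ℝ)),
      ∫ y, k y * (G t y - H t y) = (∫ y, k y * G t y) - ∫ y, k y * H t y := by
  filter_upwards [hG.ae_locallyIntegrable, hH.ae_locallyIntegrable] with t h1 h2
  simp only [mul_sub]
  exact integral_sub (integrable_smul_kernel hk hks h1) (integrable_smul_kernel hk hks h2)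

theorem L2LocCurve.continuous_integral_inner {D : ℝ → E3 → E3} (h : L2LocCurve D) {k : E3 → ℝ}
    (hk : ContDiff ℝ ∞ k) (hks : HasCompactSupport k) :
    Continuous fun t => ∫ y, inner ℝ (D t y) (gradient k y) := by
  have h1 : ∀ t, ∫ y, inner ℝ (D t y) (gradient k y) =
      ∑ i, (∫ y, fderiv ℝ k y (EuclideanSpace.single i 1) • D t y) i := by
    intro t
    have hint : ∀ i, Integrable fun y => fderiv ℝ k y (EuclideanSpace.single i 1) • D t y := fun i =>
      integrable_smul_kernel ((hk.continuous_fderiv (by simp)).clm_apply continuous_const)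
        (hks.fderiv_apply (𝕜 := ℝ) _) (h.locallyIntegrable t)
    have h2 : ∀ i, (∫ y, fderiv ℝ k y (EuclideanSpace.single i 1) • D t y) i =
        ∫ y, fderiv ℝ k y (EuclideanSpace.single i 1) * D t y i := by
      intro i
      have h3 := (EuclideanSpace.proj i : E3 →L[ℝ] ℝ).integral_comp_comm (hint i)
      simpa using h3.symm
    simp_rw [h2]
    rw [← integral_finsetSum]
    · refine integral_congr_ae (ae_of_all _ fun y => ?_)
      simp only
      rw [PiLp.inner_apply]
      refine Finset.sum_congr rfl fun i _ => ?_
      have : gradient k y i = fderiv ℝ k y (EuclideanSpace.single i 1) := by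
        rw [← inner_gradient_left, EuclideanSpace.inner_single_right]
        simp
      rw [this]
      simp [mul_comm]
    · intro i _
      exact (EuclideanSpace.proj i : E3 →L[ℝ] ℝ).integrable_comp (hint i)
  simp_rw [h1]
  refine continuous_finsetSum _ fun i _ => ?_
  have h3 := h.continuous_integral_smul (k := fun y => fderiv ℝ k y (EuclideanSpace.single i 1))
    ((hk.fderiv_right (m := ∞) (by simp)).clm_apply contDiff_const) (hks.fderiv_apply (𝕜 := ℝ) _)
  exact (EuclideanSpace.proj i : E3 →L[ℝ] ℝ).continuous.comp h3

theorem continuous_integrableOn_Ioo {a : ℝ → ℝ} (ha : Continuous a) (T : ℝ) :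
    IntegrableOn a (Ioo 0 T) :=
  (ha.integrableOn_Icc (a := 0) (b := T)).mono_set Ioo_subset_Icc_self

namespace ContinuousEnergyLoc

variable {u v : ℝ → E3 → ℝ}

/-- Composition with max(t, 0) freezes the curve at its initial value for negative times, which
turns one-sided continuity at 0 into the two-sided continuity that `L2LocCurve` asks for. -/
theorem tendsto_comp (h : ContinuousEnergyLoc u v) (R t₀ : ℝ) :
    Tendsto (fun t => energyNorm 0 R (u (max t 0) - u (max t₀ 0)) (v (max t 0) - v (max t₀ 0)))
      (𝓝 t₀) (𝓝 0) := by
  refine (h.continuous R (max t₀ 0) (le_max_right _ _)).comp ?_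
  refine tendsto_nhdsWithin_iff.2 ⟨?_, Eventually.of_forall fun t => le_max_right t 0⟩
  exact (by fun_prop : Continuous fun t : ℝ => max t 0).tendsto t₀

theorem curve_fst (h : ContinuousEnergyLoc u v) : L2LocCurve fun t => u (max t 0) where
  memLp _ R := (h.mem _ (le_max_right _ _)).memLp R
  tendsto R t₀ := tendsto_of_tendsto_of_tendsto_of_le_of_le tendsto_const_nhds
    (h.tendsto_comp R t₀) (fun _ => zero_le) fun _ => eLpNorm_fst_le_energyNorm _ _ _ _

theorem curve_snd (h : ContinuousEnergyLoc u v) : L2LocCurve fun t => v (max t 0) where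
  memLp _ R := (h.mem _ (le_max_right _ _)).memLp_snd R
  tendsto R t₀ := tendsto_of_tendsto_of_tendsto_of_le_of_le tendsto_const_nhds
    (h.tendsto_comp R t₀) (fun _ => zero_le) fun _ => eLpNorm_snd_le_energyNorm _ _ _ _

theorem isWeakGradient (h : ContinuousEnergyLoc u v) (t : ℝ) :
    IsWeakGradient (u (max t 0)) (weakGradient (u (max t 0))) :=
  weakGradient_spec (h.mem _ (le_max_right _ _)).hasWeakGradient

theorem curve_grad (h : ContinuousEnergyLoc u v) :
    L2LocCurve fun t => weakGradient (u (max t 0)) where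
  memLp _ R := (h.mem _ (le_max_right _ _)).memLp_grad R
  tendsto R t₀ := by
    refine tendsto_of_tendsto_of_tendsto_of_le_of_le tendsto_const_nhds
      (h.tendsto_comp R t₀) (fun _ => zero_le) fun t => ?_
    refine le_trans (le_of_eq ?_) (eLpNorm_grad_le_energyNorm _ _ _ _)
    -- `weakGradient` is a choice, hence additive only up to null sets.
    exact eLpNorm_congr_ae (ae_restrict_of_ae
      ((h.isWeakGradient t).sub (h.isWeakGradient t₀)).weakGradient_ae_eq.symm)

end ContinuousEnergyLoc

theorem IsSSSolution.memLpLoc_nonlinearity {γ : ℝ} {f : ℝ → ℝ} (hf : QuinticNonlinearity f)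
    {g : ℝ → E3 → ℝ} {a b : E3 → ℝ} {u v : ℝ → E3 → ℝ} (h : IsSSSolution γ f g a b u v) :
    MemLpLoc 1 2 fun t x => f (u t x) :=
  WaveR3.memLpLoc_nonlinearity hf h.continuous.curve_fst h.continuous.curve_grad
    h.continuous.isWeakGradient h.strichartz

/-- Product test functions θ(t)k(x) show that the pairings of u and ∂ₜu with k have known
distributional derivatives on (0, ∞). Both pairings are continuous down to t = 0, so
`sub_eq_integral_of_weak_deriv` integrates these relations from the initial time. -/
theorem IsSSSolution.integratedWave {γ : ℝ} {f : ℝ → ℝ} (hf : QuinticNonlinearity f)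
    {g : ℝ → E3 → ℝ} {a b : E3 → ℝ} {u v : ℝ → E3 → ℝ} (h : IsSSSolution γ f g a b u v) :
    IntegratedWave γ (fun t => u (max t 0)) (fun t => v (max t 0))
      (fun t => weakGradient (u (max t 0))) (g - fun t x => f (u t x)) := by
  have hcu := h.continuous.curve_fst
  have hcv := h.continuous.curve_snd
  have hcD := h.continuous.curve_grad
  have hnl := h.memLpLoc_nonlinearity hf
  refine ⟨hcu, hcv, hcD, h.continuous.isWeakGradient, h.force_mem.sub hnl, ?_, ?_⟩
  · intro k hk hks t ht
    have hA : Continuous fun t => ∫ y, k y * u (max t 0) y := hcu.continuous_integral_smul hk hks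
    have hB : Continuous fun t => ∫ y, k y * v (max t 0) y := hcv.continuous_integral_smul hk hks
    refine sub_eq_integral_of_weak_deriv hA (continuous_integrableOn_Ioo hB) ?_ ht
    intro θ hθ hθs hθ0
    have h1 := h.timeDerivative _ (isTest_mul hθ hθs hθ0 hk hks)
    simp only at h1
    calc ∫ t in Ioi (0 : ℝ), (∫ y, k y * u (max t 0) y) * deriv θ t
        = ∫ t in Ioi (0 : ℝ), ∫ x, u t x * dt (fun z : ℝ × E3 => θ z.1 * k z.2) t x := by
          refine setIntegral_congr_fun measurableSet_Ioi fun t ht => ?_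
          simp only [max_eq_left (mem_Ioi.1 ht).le, dt_mul]
          rw [← integral_mul_const]
          congr 1; ext y; ring
      _ = _ := h1
      _ = _ := by
          congr 1
          refine setIntegral_congr_fun measurableSet_Ioi fun t ht => ?_
          simp only [max_eq_left (mem_Ioi.1 ht).le]
          rw [← integral_mul_const]
          congr 1; ext y; ring
  · intro k hk hks t ht
    have hU : Continuous fun t => ∫ y, k y * u (max t 0) y := hcu.continuous_integral_smul hk hks
    have hV : Continuous fun t => ∫ y, k y * v (max t 0) y := hcv.continuous_integral_smul hk hks
    have hD := hcD.continuous_integral_inner hk hks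
    have hg := fun T => h.force_mem.integrableOn_integral_mul hk.continuous hks T
    have hn := fun T => hnl.integrableOn_integral_mul hk.continuous hks T
    have hgn := fun T => (h.force_mem.sub hnl).integrableOn_integral_mul hk.continuous hks T
    refine sub_eq_integral_of_weak_deriv hV (fun T => ?_) ?_ ht
    · exact (((continuous_integrableOn_Ioo hV T).const_mul (-γ)).sub
        (continuous_integrableOn_Ioo hU T)).sub (continuous_integrableOn_Ioo hD T) |>.add (hgn T)
    intro θ hθ hθs hθ0
    have h1 := h.weak _ (isTest_mul hθ hθs hθ0 hk hks)
    simp only at h1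
    have iU := integrableOn_mul_test (continuous_integrableOn_Ioo hU) hθ.continuous hθs
    have iV := integrableOn_mul_test (continuous_integrableOn_Ioo hV) hθ.continuous hθs
    have iD := integrableOn_mul_test (continuous_integrableOn_Ioo hD) hθ.continuous hθs
    have ig := integrableOn_mul_test hg hθ.continuous hθs
    have inn := integrableOn_mul_test hn hθ.continuous hθs
    have e1 : ∫ t in Ioi (0 : ℝ), ∫ x, v t x * dt (fun z : ℝ × E3 => θ z.1 * k z.2) t x =
        ∫ t in Ioi (0 : ℝ), (∫ y, k y * v (max t 0) y) * deriv θ t := by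
      refine setIntegral_congr_fun measurableSet_Ioi fun t ht => ?_
      simp only [max_eq_left (mem_Ioi.1 ht).le, dt_mul]
      rw [← integral_mul_const]
      congr 1; ext y; ring
    have e2 : ∫ t in Ioi (0 : ℝ), ∫ x, v t x * (θ t * k x) =
        ∫ t in Ioi (0 : ℝ), (∫ y, k y * v (max t 0) y) * θ t := by
      refine setIntegral_congr_fun measurableSet_Ioi fun t ht => ?_
      simp only [max_eq_left (mem_Ioi.1 ht).le]
      rw [← integral_mul_const]
      congr 1; ext y; ring
    have e3 : ∫ t in Ioi (0 : ℝ), ∫ x, inner ℝ (weakGradient (u t) x)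
        (gradx (fun z : ℝ × E3 => θ z.1 * k z.2) t x) =
        ∫ t in Ioi (0 : ℝ), (∫ y, inner ℝ (weakGradient (u (max t 0)) y) (gradient k y)) * θ t := by
      refine setIntegral_congr_fun measurableSet_Ioi fun t ht => ?_
      simp only [max_eq_left (mem_Ioi.1 ht).le, gradx_mul θ hk]
      rw [← integral_mul_const]
      congr 1; ext y; rw [inner_smul_right, mul_comm]
    have e4 : ∫ t in Ioi (0 : ℝ), ∫ x, u t x * (θ t * k x) =
        ∫ t in Ioi (0 : ℝ), (∫ y, k y * u (max t 0) y) * θ t := by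
      refine setIntegral_congr_fun measurableSet_Ioi fun t ht => ?_
      simp only [max_eq_left (mem_Ioi.1 ht).le]
      rw [← integral_mul_const]
      congr 1; ext y; ring
    have e5 : ∫ t in Ioi (0 : ℝ), ∫ x, f (u t x) * (θ t * k x) =
        ∫ t in Ioi (0 : ℝ), (∫ y, k y * f (u t y)) * θ t := by
      refine setIntegral_congr_fun measurableSet_Ioi fun t ht => ?_
      rw [← integral_mul_const]
      congr 1; ext y; ring
    have e6 : ∫ t in Ioi (0 : ℝ), ∫ x, g t x * (θ t * k x) =
        ∫ t in Ioi (0 : ℝ), (∫ y, k y * g t y) * θ t := by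
      refine setIntegral_congr_fun measurableSet_Ioi fun t ht => ?_
      rw [← integral_mul_const]
      congr 1; ext y; ring
    rw [e1, e2, e3, e4, e5, e6] at h1
    have e7 : ∫ t in Ioi (0 : ℝ), (-γ * (∫ y, k y * v (max t 0) y) - (∫ y, k y * u (max t 0) y)
        - (∫ y, inner ℝ (weakGradient (u (max t 0)) y) (gradient k y))
        + ∫ y, k y * (g - fun t x => f (u t x)) t y) * θ t =
        ∫ t in Ioi (0 : ℝ), (-γ * ((∫ y, k y * v (max t 0) y) * θ t)
        - (∫ y, k y * u (max t 0) y) * θ t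
        - (∫ y, inner ℝ (weakGradient (u (max t 0)) y) (gradient k y)) * θ t
        + ((∫ y, k y * g t y) * θ t - (∫ y, k y * f (u t y)) * θ t)) := by
      -- The pairing with g - f(u) splits only for almost every t, since the slices are known to be
      -- locally integrable only almost everywhere in time.
      refine integral_congr_ae ?_
      filter_upwards [h.force_mem.ae_integral_mul_sub hnl hk.continuous hks] with t ht
      simp only [Pi.sub_apply]
      rw [ht]; ring
    rw [e7, integral_linear_combination iV iU iD ig inn]
    linarith

theorem L2LocCurve.integral_smul_sub {F : Type*} [NormedAddCommGroup F] [NormedSpace ℝ F]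
    {a b : ℝ → E3 → F} (ha : L2LocCurve a)
    (hb : L2LocCurve b) {k : E3 → ℝ} (hk : Continuous k) (hks : HasCompactSupport k) (t : ℝ) :
    ∫ y, k y • (a - b) t y = (∫ y, k y • a t y) - ∫ y, k y • b t y := by
  rw [← integral_sub (integrable_smul_kernel hk hks (ha.locallyIntegrable t))
    (integrable_smul_kernel hk hks (hb.locallyIntegrable t))]
  simp only [Pi.sub_apply, smul_sub]

theorem IntegratedWave.sub {γ : ℝ} {w v w' v' G G' : ℝ → E3 → ℝ} {D D' : ℝ → E3 → E3}
    (h : IntegratedWave γ w v D G) (h' : IntegratedWave γ w' v' D' G') :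
    IntegratedWave γ (w - w') (v - v') (D - D') (G - G') := by
  refine ⟨h.curve_fst.sub h'.curve_fst, h.curve_snd.sub h'.curve_snd,
    h.curve_grad.sub h'.curve_grad, fun t => (h.grad t).sub (h'.grad t), h.force.sub h'.force, ?_, ?_⟩
  · intro k hk hks t ht
    have e1 := fun s => h.curve_fst.integral_smul_sub h'.curve_fst hk.continuous hks s
    have e2 := fun s => h.curve_snd.integral_smul_sub h'.curve_snd hk.continuous hks s
    have c1 := h.curve_snd.continuous_integral_smul hk hks
    have c2 := h'.curve_snd.continuous_integral_smul hk hks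
    simp only [smul_eq_mul] at e1 e2 c1 c2
    simp_rw [e1, e2]
    rw [intervalIntegral.integral_sub (c1.intervalIntegrable _ _) (c2.intervalIntegrable _ _),
      ← h.eq_fst k hk hks t ht, ← h'.eq_fst k hk hks t ht]
    ring
  · intro k hk hks t ht
    have e1 := fun s => h.curve_fst.integral_smul_sub h'.curve_fst hk.continuous hks s
    have e2 := fun s => h.curve_snd.integral_smul_sub h'.curve_snd hk.continuous hks s
    have c1 := h.curve_snd.continuous_integral_smul hk hks
    have c2 := h'.curve_snd.continuous_integral_smul hk hks
    have c3 := h.curve_fst.continuous_integral_smul hk hks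
    have c4 := h'.curve_fst.continuous_integral_smul hk hks
    have c5 := h.curve_grad.continuous_integral_inner hk hks
    have c6 := h'.curve_grad.continuous_integral_inner hk hks
    have e3 : ∀ s, ∫ y, inner ℝ ((D - D') s y) (gradient k y) =
        (∫ y, inner ℝ (D s y) (gradient k y)) - ∫ y, inner ℝ (D' s y) (gradient k y) := by
      have hint : ∀ {E : ℝ → E3 → E3}, L2LocCurve E → ∀ s,
          Integrable fun y => inner ℝ (E s y) (gradient k y) := by
        intro E hE s
        have hg := continuous_gradient hk
        have hgs := hasCompactSupport_gradient hks
        obtain ⟨M, hM⟩ := hgs.exists_bound_of_continuous hg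
        have h1 : Integrable fun y => ‖gradient k y‖ • E s y :=
          integrable_smul_kernel hg.norm hgs.norm (hE.locallyIntegrable s)
        refine h1.mono ((hE.aestronglyMeasurable s).inner hg.aestronglyMeasurable)
          (ae_of_all _ fun y => ?_)
        rw [norm_smul, norm_norm, mul_comm]
        exact norm_inner_le_norm _ _
      intro s
      rw [← integral_sub (hint h.curve_grad s) (hint h'.curve_grad s)]
      simp only [Pi.sub_apply, inner_sub_left]
    simp only [smul_eq_mul] at e1 e2 c1 c2 c3 c4
    have i1 : ∀ {H : ℝ → E3 → ℝ}, MemLpLoc 1 2 H →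
        IntervalIntegrable (fun s => ∫ y, k y * H s y) volume 0 t := fun hH => by
      rw [intervalIntegrable_iff_integrableOn_Ioo_of_le ht]
      exact hH.integrableOn_integral_mul hk.continuous hks t
    have e4 : ∫ s in (0 : ℝ)..t, (-γ * (∫ y, k y * (v - v') s y) - (∫ y, k y * (w - w') s y)
        - (∫ y, inner ℝ ((D - D') s y) (gradient k y)) + ∫ y, k y * (G - G') s y) =
        ∫ s in (0 : ℝ)..t, ((-γ * (∫ y, k y * v s y) - (∫ y, k y * w s y)
          - (∫ y, inner ℝ (D s y) (gradient k y)) + ∫ y, k y * G s y) -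
          (-γ * (∫ y, k y * v' s y) - (∫ y, k y * w' s y)
          - (∫ y, inner ℝ (D' s y) (gradient k y)) + ∫ y, k y * G' s y)) := by
      rw [intervalIntegral.integral_of_le ht, intervalIntegral.integral_of_le ht]
      refine integral_congr_ae ?_
      have hle : volume.restrict (Ioc (0 : ℝ) t) ≤ volume.restrict (Ioi 0) :=
        Measure.restrict_mono (fun x hx => hx.1) le_rfl
      filter_upwards [ae_mono hle (h.force.ae_integral_mul_sub h'.force hk.continuous hks)] with s hs
      rw [e1, e2, e3]
      simp only [Pi.sub_apply]
      rw [hs]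
      ring
    rw [e4, intervalIntegral.integral_sub, ← h.eq_snd k hk hks t ht, ← h'.eq_snd k hk hks t ht, e2, e2]
    · ring
    · exact (Continuous.intervalIntegrable (by fun_prop) _ _).add (i1 h.force)
    · exact (Continuous.intervalIntegrable (by fun_prop) _ _).add (i1 h'.force)

/-! ### Growth of weighted squares of primitives in time -/

theorem primitive_absolutelyContinuous {b : ℝ → ℝ} {T : ℝ} (hb : IntervalIntegrable b volume 0 T)
    (a₀ : ℝ) : AbsolutelyContinuousOnInterval (fun t => a₀ + ∫ s in (0 : ℝ)..t, b s) 0 T := by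
  have h1 := hb.absolutelyContinuousOnInterval_intervalIntegral (c := 0) (by simp)
  have h2 : AbsolutelyContinuousOnInterval (fun _ : ℝ => a₀) 0 T :=
    (LipschitzWith.const a₀).lipschitzOnWith.absolutelyContinuousOnInterval
  exact h2.fun_add h1

/-- The product rule for p·a², in absolutely continuous form because b is merely integrable: it will
contain the force, which is only L¹ in time. The functions p and a are replaced by the primitives P
and A, which agree with them on [0, T] and are differentiable almost everywhere. -/
theorem integral_weighted_sq {p p' a b : ℝ → ℝ} {T : ℝ} (hT : 0 ≤ T)
    (hp : IntervalIntegrable p' volume 0 T) (hb : IntervalIntegrable b volume 0 T)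
    (hpe : ∀ t ∈ Icc 0 T, p t = p 0 + ∫ s in (0 : ℝ)..t, p' s)
    (hae : ∀ t ∈ Icc 0 T, a t = a 0 + ∫ s in (0 : ℝ)..t, b s) :
    p T * a T ^ 2 - p 0 * a 0 ^ 2 = ∫ t in (0 : ℝ)..T, (p' t * a t ^ 2 + 2 * p t * a t * b t) := by
  set P : ℝ → ℝ := fun t => p 0 + ∫ s in (0 : ℝ)..t, p' s with hP
  set A : ℝ → ℝ := fun t => a 0 + ∫ s in (0 : ℝ)..t, b s with hA
  have hPac : AbsolutelyContinuousOnInterval P 0 T := primitive_absolutelyContinuous hp _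
  have hAac : AbsolutelyContinuousOnInterval A 0 T := primitive_absolutelyContinuous hb _
  have h1 := (hPac.fun_mul (hAac.fun_mul hAac)).integral_deriv_eq_sub
  have hT' : T ∈ Icc 0 T := ⟨hT, le_rfl⟩
  have h0' : (0 : ℝ) ∈ Icc 0 T := ⟨le_rfl, hT⟩
  have e1 : P T = p T := (hpe T hT').symm
  have e2 : A T = a T := (hae T hT').symm
  have e3 : P 0 = p 0 := (hpe 0 h0').symm
  have e4 : A 0 = a 0 := (hae 0 h0').symm
  rw [e1, e2, e3, e4] at h1
  rw [show p T * a T ^ 2 - p 0 * a 0 ^ 2 = p T * (a T * a T) - p 0 * (a 0 * a 0) by ring, ← h1]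
  refine intervalIntegral.integral_congr_ae ?_
  filter_upwards [hp.ae_hasDerivAt_integral, hb.ae_hasDerivAt_integral] with t h2 h3 ht
  rw [uIoc_of_le hT] at ht
  have ht' : t ∈ uIcc 0 T := by rw [uIcc_of_le hT]; exact ⟨ht.1.le, ht.2⟩
  have h4 : HasDerivAt P (p' t) t := (h2 ht' 0 (by simp)).const_add _
  have h5 : HasDerivAt A (b t) t := (h3 ht' 0 (by simp)).const_add _
  rw [(h4.fun_mul (h5.fun_mul h5)).deriv]
  have e5 : P t = p t := (hpe t ⟨ht.1.le, ht.2⟩).symm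
  have e6 : A t = a t := (hae t ⟨ht.1.le, ht.2⟩).symm
  rw [e5, e6]
  ring

/-- A `C¹` weight on `[0, T] × ℝ³` with time derivative `ψ'`, supported in the ball of radius `ρ`. -/
structure IsWeight (T ρ : ℝ) (ψ ψ' : ℝ → E3 → ℝ) : Prop where
  cont : ContinuousOn (fun z : ℝ × E3 => ψ z.1 z.2) (Icc 0 T ×ˢ univ)
  cont' : ContinuousOn (fun z : ℝ × E3 => ψ' z.1 z.2) (Icc 0 T ×ˢ univ)
  hasDerivAt : ∀ t ∈ Icc 0 T, ∀ x, HasDerivAt (fun s => ψ s x) (ψ' t x) t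
  nonneg : ∀ t ∈ Icc 0 T, ∀ x, 0 ≤ ψ t x
  contDiff : ∀ t ∈ Icc 0 T, ContDiff ℝ 1 (ψ t)
  eq_zero : ∀ t ∈ Icc 0 T, ∀ x, ρ ≤ ‖x‖ → ψ t x = 0
  eq_zero' : ∀ t ∈ Icc 0 T, ∀ x, ρ ≤ ‖x‖ → ψ' t x = 0

/-- `A` is a primitive in time of `B` on `[0, T]`. -/
structure IsPrimitive (T ρ : ℝ) (A B : ℝ → E3 → ℝ) : Prop where
  cont : Continuous fun z : ℝ × E3 => A z.1 z.2
  intervalIntegrable : ∀ x, IntervalIntegrable (fun t => B t x) volume 0 T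
  eq_add : ∀ x, ∀ t ∈ Icc 0 T, A t x = A 0 x + ∫ s in (0 : ℝ)..t, B s x
  meas : AEStronglyMeasurable (fun z : ℝ × E3 => B z.1 z.2)
    ((volume.restrict (Ioc 0 T)).prod (volume : Measure E3))
  bound : ∃ κ : ℝ → ℝ, IntegrableOn κ (Ioc 0 T) ∧
    ∀ᵐ t ∂volume.restrict (Ioc 0 T), ∀ x, ‖x‖ < ρ → |B t x| ≤ κ t

theorem IsWeight.mono {T T' ρ : ℝ} {ψ ψ' : ℝ → E3 → ℝ} (h : IsWeight T ρ ψ ψ') (hT : T' ≤ T) :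
    IsWeight T' ρ ψ ψ' := by
  have hsub : Icc 0 T' ⊆ Icc 0 T := Icc_subset_Icc_right hT
  have hsub' : (Icc 0 T' ×ˢ univ : Set (ℝ × E3)) ⊆ Icc 0 T ×ˢ univ := prod_mono hsub le_rfl
  exact ⟨h.cont.mono hsub', h.cont'.mono hsub', fun t ht => h.hasDerivAt t (hsub ht),
    fun t ht => h.nonneg t (hsub ht), fun t ht => h.contDiff t (hsub ht),
    fun t ht => h.eq_zero t (hsub ht), fun t ht => h.eq_zero' t (hsub ht)⟩

theorem IsPrimitive.mono {T T' ρ : ℝ} {A B : ℝ → E3 → ℝ} (h : IsPrimitive T ρ A B) (h0 : 0 ≤ T')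
    (hT : T' ≤ T) : IsPrimitive T' ρ A B := by
  have hsub : Ioc 0 T' ⊆ Ioc 0 T := Ioc_subset_Ioc_right hT
  have hle : volume.restrict (Ioc (0 : ℝ) T') ≤ volume.restrict (Ioc 0 T) :=
    Measure.restrict_mono hsub le_rfl
  obtain ⟨κ, hκ, hb⟩ := h.bound
  refine ⟨h.cont, fun x => (h.intervalIntegrable x).mono_set ?_, fun x t ht =>
    h.eq_add x t ⟨ht.1, ht.2.trans hT⟩, h.meas.mono_measure (Measure.prod_mono hle le_rfl),
    κ, hκ.mono_set hsub, ae_mono hle hb⟩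
  rw [uIcc_of_le h0, uIcc_of_le (h0.trans hT)]
  exact Icc_subset_Icc_right hT

theorem exists_bound_slab {T ρ : ℝ} {A : ℝ → E3 → ℝ}
    (hA : ContinuousOn (fun z : ℝ × E3 => A z.1 z.2) (Icc 0 T ×ˢ univ)) :
    ∃ M, 0 ≤ M ∧ ∀ t ∈ Icc 0 T, ∀ x, ‖x‖ < ρ → |A t x| ≤ M := by
  obtain ⟨M, hM⟩ := (isCompact_Icc.prod (isCompact_closedBall (0 : E3) ρ)).exists_bound_of_continuousOn
    (hA.mono (prod_mono le_rfl (subset_univ _)))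
  exact ⟨max M 0, le_max_right _ _, fun t ht x hx =>
    (hM (t, x) ⟨ht, by simpa using hx.le⟩).trans (le_max_left _ _)⟩

theorem aestronglyMeasurable_slab {T : ℝ} {A : ℝ → E3 → ℝ}
    (hA : ContinuousOn (fun z : ℝ × E3 => A z.1 z.2) (Icc 0 T ×ˢ univ)) :
    AEStronglyMeasurable (fun z : ℝ × E3 => A z.1 z.2)
      ((volume.restrict (Ioc 0 T)).prod (volume : Measure E3)) := by
  have h1 : ((volume.restrict (Ioc 0 T)).prod (volume : Measure E3)) =
      (volume.prod volume).restrict (Ioc 0 T ×ˢ univ) := by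
    rw [← Measure.prod_restrict, Measure.restrict_univ]
  rw [h1]
  exact (hA.mono (prod_mono Ioc_subset_Icc_self le_rfl)).aestronglyMeasurable
    (measurableSet_Ioc.prod MeasurableSet.univ)

section Weighted

variable {ι : Type*} [Fintype ι] {T ρ : ℝ} {ψ ψ' : ℝ → E3 → ℝ} {A B : ι → ℝ → E3 → ℝ}

/-- The time derivative of the weighted square density. -/
def weightedRate (ψ ψ' : ℝ → E3 → ℝ) (A B : ι → ℝ → E3 → ℝ) (t : ℝ) (x : E3) : ℝ :=
  ∑ i, (ψ' t x * A i t x ^ 2 + 2 * ψ t x * A i t x * B i t x)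

theorem integrable_weightedRate (hψ : IsWeight T ρ ψ ψ') (hA : ∀ i, IsPrimitive T ρ (A i) (B i)) :
    Integrable (fun z : ℝ × E3 => weightedRate ψ ψ' A B z.1 z.2)
      ((volume.restrict (Ioc 0 T)).prod (volume : Measure E3)) := by
  refine integrable_finsetSum _ fun i _ => ?_
  obtain ⟨κ, hκ, hBκ⟩ := (hA i).bound
  obtain ⟨M₁, hM₁, hψM⟩ := exists_bound_slab (ρ := ρ) hψ.cont
  obtain ⟨M₂, hM₂, hψM'⟩ := exists_bound_slab (ρ := ρ) hψ.cont'
  obtain ⟨M₃, hM₃, hAM⟩ := exists_bound_slab (T := T) (ρ := ρ) (hA i).cont.continuousOn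
  have hdom : Integrable (fun z : ℝ × E3 => (M₂ * M₃ ^ 2 + 2 * M₁ * M₃ * κ z.1) *
      (Metric.ball (0 : E3) ρ).indicator (fun _ => (1 : ℝ)) z.2)
      ((volume.restrict (Ioc 0 T)).prod (volume : Measure E3)) := by
    refine Integrable.mul_prod (f := fun t => M₂ * M₃ ^ 2 + 2 * M₁ * M₃ * κ t) ?_ ?_
    · exact (integrable_const _).add (hκ.const_mul _)
    · exact (integrable_indicator_iff measurableSet_ball).2
        (integrableOn_const measure_ball_lt_top.ne)
  have hψm := aestronglyMeasurable_slab hψ.cont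
  have hψm' := aestronglyMeasurable_slab hψ.cont'
  have hAm := aestronglyMeasurable_slab (T := T) (hA i).cont.continuousOn
  refine hdom.mono ((hψm'.mul (hAm.pow 2)).add (((hψm.const_mul 2).mul hAm).mul (hA i).meas)) ?_
  have h1 : ∀ᵐ z : ℝ × E3 ∂((volume.restrict (Ioc 0 T)).prod (volume : Measure E3)),
      z.1 ∈ Ioc 0 T ∧ ∀ x, ‖x‖ < ρ → |B i z.1 x| ≤ κ z.1 :=
    Measure.quasiMeasurePreserving_fst.ae ((ae_restrict_mem measurableSet_Ioc).and hBκ)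
  filter_upwards [h1] with z hz
  have hzT : z.1 ∈ Icc 0 T := ⟨hz.1.1.le, hz.1.2⟩
  by_cases hx : ‖z.2‖ < ρ
  · have h2 : z.2 ∈ Metric.ball (0 : E3) ρ := by simpa using hx
    rw [indicator_of_mem h2, mul_one]
    have b1 := hψM _ hzT _ hx
    have b2 := hψM' _ hzT _ hx
    have b3 := hAM _ hzT _ hx
    have b4 := hz.2 _ hx
    have hκ0 : 0 ≤ κ z.1 := (abs_nonneg _).trans b4
    rw [Real.norm_eq_abs, Real.norm_of_nonneg (by positivity)]
    refine (abs_add_le _ _).trans ?_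
    rw [abs_mul, abs_mul, abs_mul, abs_mul, abs_pow, abs_two]
    gcongr
  · push Not at hx
    rw [hψ.eq_zero _ hzT _ hx, hψ.eq_zero' _ hzT _ hx]
    simp only [zero_mul, mul_zero, add_zero, norm_zero]
    exact norm_nonneg _

/-- The product rule is applied at each fixed x and then integrated in x; Fubini is licensed by the
bound κ(t) on the time derivative over the support of the weight. -/
theorem weighted_identity (hT : 0 ≤ T) (hψ : IsWeight T ρ ψ ψ')
    (hA : ∀ i, IsPrimitive T ρ (A i) (B i)) :
    (∫ x, ψ T x * ∑ i, A i T x ^ 2) - ∫ x, ψ 0 x * ∑ i, A i 0 x ^ 2 =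
      ∫ t in Ioc 0 T, ∫ x, weightedRate ψ ψ' A B t x := by
  rw [integral_integral_swap (integrable_weightedRate hψ hA)]
  have hint : ∀ t ∈ Icc 0 T, Integrable fun x => ψ t x * ∑ i, A i t x ^ 2 := by
    intro t ht
    refine Continuous.integrable_of_hasCompactSupport ?_ ?_
    · refine (hψ.contDiff t ht).continuous.mul (continuous_finsetSum _ fun i _ => ?_)
      exact ((hA i).cont.comp (Continuous.prodMk_right t)).pow 2
    · refine HasCompactSupport.of_support_subset_isCompact (isCompact_closedBall (0 : E3) ρ) ?_
      intro x hx
      by_contra hcon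
      refine hx ?_
      simp only [Metric.mem_closedBall, dist_zero_right, not_le] at hcon
      simp only
      rw [hψ.eq_zero t ht x hcon.le, zero_mul]
  rw [← integral_sub (hint T ⟨hT, le_rfl⟩) (hint 0 ⟨le_rfl, hT⟩)]
  refine integral_congr_ae (ae_of_all _ fun x => ?_)
  have hψ'c : ContinuousOn (fun t => ψ' t x) (Icc 0 T) :=
    hψ.cont'.comp (f := fun t : ℝ => (t, x)) (by fun_prop) fun t ht => ⟨ht, mem_univ _⟩
  have hψc : ContinuousOn (fun t => ψ t x) (Icc 0 T) :=
    hψ.cont.comp (f := fun t : ℝ => (t, x)) (by fun_prop) fun t ht => ⟨ht, mem_univ _⟩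
  have hψi : IntervalIntegrable (fun t => ψ' t x) volume 0 T := by
    refine ContinuousOn.intervalIntegrable ?_
    rwa [uIcc_of_le hT]
  have hψe : ∀ t ∈ Icc 0 T, ψ t x = ψ 0 x + ∫ s in (0 : ℝ)..t, ψ' s x := by
    intro t ht
    have hsub : uIcc 0 t ⊆ Icc 0 T := by rw [uIcc_of_le ht.1]; exact Icc_subset_Icc_right ht.2
    rw [intervalIntegral.integral_eq_sub_of_hasDerivAt (f := fun s => ψ s x)
      (fun s hs => hψ.hasDerivAt s (hsub hs) x)
      (ContinuousOn.intervalIntegrable (hψ'c.mono hsub))]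
    ring
  have h1 : ∀ i, ψ T x * A i T x ^ 2 - ψ 0 x * A i 0 x ^ 2 =
      ∫ t in (0 : ℝ)..T, (ψ' t x * A i t x ^ 2 + 2 * ψ t x * A i t x * B i t x) := fun i =>
    integral_weighted_sq hT hψi ((hA i).intervalIntegrable x) hψe ((hA i).eq_add x)
  simp only [weightedRate]
  rw [← intervalIntegral.integral_of_le hT, intervalIntegral.integral_finsetSum]
  · rw [Finset.mul_sum, Finset.mul_sum, ← Finset.sum_sub_distrib]
    exact Finset.sum_congr rfl fun i _ => h1 i
  · intro i _
    have hAc : Continuous fun t => A i t x := (hA i).cont.comp (Continuous.prodMk_left x)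
    refine IntervalIntegrable.add ?_ ?_
    · refine ContinuousOn.intervalIntegrable ?_
      rw [uIcc_of_le hT]
      exact hψ'c.mul (hAc.pow 2).continuousOn
    · refine IntervalIntegrable.continuousOn_mul ((hA i).intervalIntegrable x) ?_
      rw [uIcc_of_le hT]
      exact (continuousOn_const.mul hψc).mul hAc.continuousOn

/-- If the integrated rate of the weighted square `Q` is at most `2 √Q N`, then `√Q` grows by at
most `2 ∫ N`. -/
theorem sqrt_weighted_le (hT : 0 ≤ T) (hψ : IsWeight T ρ ψ ψ')
    (hA : ∀ i, IsPrimitive T ρ (A i) (B i)) {N : ℝ → ℝ} (hN : IntegrableOn N (Ioc 0 T))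
    (hN0 : ∀ t, 0 ≤ N t)
    (hrate : ∀ᵐ t ∂volume.restrict (Ioc 0 T), ∫ x, weightedRate ψ ψ' A B t x ≤
      2 * √(∫ x, ψ t x * ∑ i, A i t x ^ 2) * N t) :
    √(∫ x, ψ T x * ∑ i, A i T x ^ 2) ≤
      √(∫ x, ψ 0 x * ∑ i, A i 0 x ^ 2) + 2 * ∫ t in Ioc 0 T, N t := by
  set Q : ℝ → ℝ := fun t => ∫ x, ψ t x * ∑ i, A i t x ^ 2 with hQ
  have hQ0 : ∀ t ∈ Icc 0 T, 0 ≤ Q t := fun t ht => integral_nonneg fun x =>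
    mul_nonneg (hψ.nonneg t ht x) (Finset.sum_nonneg fun i _ => sq_nonneg _)
  have hbdd : BddAbove ((fun t => √(Q t)) '' Icc 0 T) := by
    have hc : ContinuousOn (fun z : ℝ × E3 => ψ z.1 z.2 * ∑ i, A i z.1 z.2 ^ 2) (Icc 0 T ×ˢ univ) :=
      hψ.cont.mul (continuous_finsetSum _ fun i _ => (hA i).cont.pow 2).continuousOn
    obtain ⟨M, hM0, hM⟩ := exists_bound_slab (ρ := ρ) (A := fun t x => ψ t x * ∑ i, A i t x ^ 2) hc
    refine ⟨√(M * volume.real (Metric.ball (0 : E3) ρ)), ?_⟩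
    rintro _ ⟨t, ht, rfl⟩
    refine Real.sqrt_le_sqrt ?_
    have h1 : Q t = ∫ x in Metric.ball (0 : E3) ρ, ψ t x * ∑ i, A i t x ^ 2 := by
      refine (setIntegral_eq_integral_of_forall_compl_eq_zero fun x hx => ?_).symm
      rw [hψ.eq_zero t ht x (by simpa using hx), zero_mul]
    have h2 : ‖∫ x in Metric.ball (0 : E3) ρ, ψ t x * ∑ i, A i t x ^ 2‖ ≤
        M * volume.real (Metric.ball (0 : E3) ρ) :=
      norm_setIntegral_le_of_norm_le_const (C := M) measure_ball_lt_top
        (fun x hx => by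
          rw [Real.norm_eq_abs]
          exact hM t ht x (by simpa using hx))
    rw [h1]
    exact (le_abs_self _).trans h2
  set S := sSup ((fun t => √(Q t)) '' Icc 0 T) with hS
  have hSle : ∀ t ∈ Icc 0 T, √(Q t) ≤ S := fun t ht => le_csSup hbdd ⟨t, ht, rfl⟩
  have hS0 : 0 ≤ S := (Real.sqrt_nonneg _).trans (hSle 0 ⟨le_rfl, hT⟩)
  set J := ∫ t in Ioc 0 T, N t with hJ
  have hJ0 : 0 ≤ J := integral_nonneg hN0
  have hmain : ∀ τ ∈ Icc 0 T, Q τ ≤ Q 0 + 2 * S * J := by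
    intro τ hτ
    have hsub : Ioc 0 τ ⊆ Ioc 0 T := Ioc_subset_Ioc_right hτ.2
    have hψτ := hψ.mono hτ.2
    have hAτ := fun i => (hA i).mono hτ.1 hτ.2
    have h1 := weighted_identity hτ.1 hψτ hAτ
    have h2 : ∫ t in Ioc 0 τ, ∫ x, weightedRate ψ ψ' A B t x ≤ ∫ t in Ioc 0 τ, 2 * S * N t := by
      refine integral_mono_ae (integrable_weightedRate hψτ hAτ).integral_prod_left
        ((hN.mono_set hsub).const_mul _) ?_
      filter_upwards [ae_mono (Measure.restrict_mono hsub le_rfl) hrate,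
        ae_restrict_mem measurableSet_Ioc] with t ht htτ
      refine ht.trans ?_
      have := hSle t ⟨htτ.1.le, htτ.2.trans hτ.2⟩
      have := hN0 t
      gcongr
    have h3 : ∫ t in Ioc 0 τ, 2 * S * N t ≤ 2 * S * J := by
      rw [integral_const_mul]
      gcongr
      exact setIntegral_mono_set hN (ae_of_all _ hN0) hsub.eventuallyLE
    have h4 : Q τ - Q 0 = ∫ t in Ioc 0 τ, ∫ x, weightedRate ψ ψ' A B t x := h1
    linarith
  -- Taking the supremum over τ gives S² ≤ Q(0) + 2SJ, hence S ≤ √Q(0) + 2J. This avoids dividing by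
  -- √Q where it may vanish, at the cost of the factor 2 in front of J.
  have hSsq : S ^ 2 ≤ Q 0 + 2 * S * J := by
    rw [← Real.le_sqrt hS0 (by have := hQ0 0 ⟨le_rfl, hT⟩; positivity)]
    refine csSup_le ⟨_, 0, ⟨le_rfl, hT⟩, rfl⟩ ?_
    rintro _ ⟨t, ht, rfl⟩
    exact Real.sqrt_le_sqrt (hmain t ht)
  refine (hSle T ⟨hT, le_rfl⟩).trans ?_
  have hsq := Real.sq_sqrt (hQ0 0 ⟨le_rfl, hT⟩)
  have hs0 := Real.sqrt_nonneg (Q 0)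
  by_contra hcon
  push Not at hcon
  change √(Q 0) + 2 * J < S at hcon
  nlinarith

end Weighted

/-! ### Divergence identities behind the two differential inequalities -/

/-- The `i`-th standard basis vector. -/
noncomputable abbrev basisVec (i : Fin 3) : E3 := EuclideanSpace.single i (1 : ℝ)

theorem continuousLinearMap_apply_eq_sum (L : E3 →L[ℝ] ℝ) (v : E3) :
    L v = ∑ i, L (basisVec i) * v i := by
  have h : v = ∑ i, v i • basisVec i := by
    ext j
    simp [Finset.sum_apply, Pi.single_apply]
  conv_lhs => rw [h]
  simp [mul_comm]

theorem integral_fderiv_eq_zero {p : E3 → ℝ} (hp : ContDiff ℝ 1 p) (hps : HasCompactSupport p)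
    (v : E3) : ∫ x, fderiv ℝ p x v = 0 := by
  have hd : Continuous fun x => fderiv ℝ p x v :=
    (hp.continuous_fderiv one_ne_zero).clm_apply continuous_const
  have hds : HasCompactSupport fun x => fderiv ℝ p x v := hps.fderiv_apply ℝ v
  have h := integral_mul_fderiv_eq_neg_fderiv_mul_of_integrable (𝕜 := ℝ) (μ := (volume : Measure E3))
    (f := fun _ => (1 : ℝ)) (g := p) (v := v) (by simp)
    (by simpa using hd.integrable_of_hasCompactSupport hds)
    (by simpa using hp.continuous.integrable_of_hasCompactSupport hps)
    (fun x _ => differentiableAt_const _) (fun x _ => hp.differentiable one_ne_zero x)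
  simpa using h

theorem integral_weighted_mul_le {p a b : E3 → ℝ} (hp : Continuous p) (hps : HasCompactSupport p)
    (hp0 : ∀ x, 0 ≤ p x) (ha : Continuous a) (hb : Continuous b) :
    ∫ x, p x * |a x| * |b x| ≤ √(∫ x, p x * a x ^ 2) * √(∫ x, p x * b x ^ 2) := by
  have key : ∀ c : E3 → ℝ, Continuous c → MemLp (fun x => √(p x) * |c x|) (ENNReal.ofReal 2) := by
    intro c hc
    refine Continuous.memLp_of_hasCompactSupport (by fun_prop) ?_
    have : HasCompactSupport fun x => √(p x) := hps.comp_left Real.sqrt_zero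
    exact this.mul_right
  have h := integral_mul_le_Lp_mul_Lq_of_nonneg (μ := (volume : Measure E3)) Real.HolderConjugate.two_two
    (f := fun x => √(p x) * |a x|) (g := fun x => √(p x) * |b x|)
    (ae_of_all _ fun x => by positivity) (ae_of_all _ fun x => by positivity) (key a ha) (key b hb)
  have e : ∀ c : E3 → ℝ, ∀ x, (√(p x) * |c x|) ^ (2 : ℝ) = p x * c x ^ 2 := by
    intro c x
    rw [Real.rpow_two, mul_pow, Real.sq_sqrt (hp0 x), sq_abs]
  simp_rw [e] at h
  rw [Real.sqrt_eq_rpow, Real.sqrt_eq_rpow]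
  refine le_trans (le_of_eq ?_) h
  refine integral_congr_ae (ae_of_all _ fun x => ?_)
  simp only
  rw [show √(p x) * |a x| * (√(p x) * |b x|) = (√(p x) * √(p x)) * |a x| * |b x| by ring,
    Real.mul_self_sqrt (hp0 x)]

section WeightNorm

variable {F : Type*} [NormedAddCommGroup F]

theorem toReal_eLpNorm_sq {μ : Measure E3} {b : E3 → F} (hb : MemLp b 2 μ) :
    (eLpNorm b 2 μ).toReal ^ 2 = ∫ x, ‖b x‖ ^ 2 ∂μ := by
  rw [hb.eLpNorm_eq_integral_rpow_norm (by norm_num) (by norm_num)]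
  have h0 : 0 ≤ ∫ x, ‖b x‖ ^ 2 ∂μ := integral_nonneg fun x => by positivity
  simp only [ENNReal.toReal_ofNat, Real.rpow_two]
  rw [ENNReal.toReal_ofReal (by positivity), ← Real.rpow_natCast, ← Real.rpow_mul h0]
  norm_num

theorem memLp_ballMeasure_of_continuous {b : E3 → F} (hb : Continuous b) (x₀ : E3) (r : ℝ) :
    MemLp b 2 (ballMeasure x₀ r) := by
  obtain ⟨M, hM⟩ := (isCompact_closedBall x₀ r).exists_bound_of_continuousOn hb.continuousOn
  refine MemLp.of_bound hb.aestronglyMeasurable M ?_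
  filter_upwards [ae_restrict_mem measurableSet_ball] with x hx
  exact hM x (Metric.ball_subset_closedBall hx)

variable {p : E3 → ℝ} {b : E3 → F} {c r : ℝ} {x₀ : E3}

theorem integrable_weight_mul_norm_sq (hp : Continuous p) (hps : HasCompactSupport p)
    (hb : Continuous b) : Integrable fun x => p x * ‖b x‖ ^ 2 :=
  (hp.mul (hb.norm.pow 2)).integrable_of_hasCompactSupport hps.mul_right

theorem sqrt_integral_weight_le (hp : Continuous p) (hps : HasCompactSupport p)
    (hb : Continuous b) (hc : 0 ≤ c)
    (hpc : ∀ x, p x ≤ c ^ 2) (hp1 : ∀ x, r ≤ ‖x - x₀‖ → p x = 0) :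
    √(∫ x, p x * ‖b x‖ ^ 2) ≤ c * (eLpNorm b 2 (ballMeasure x₀ r)).toReal := by
  refine Real.sqrt_le_iff.2 ⟨by positivity, ?_⟩
  have hbm := memLp_ballMeasure_of_continuous hb x₀ r
  rw [mul_pow, toReal_eLpNorm_sq hbm, ← integral_const_mul]
  have h1 : ∫ x, p x * ‖b x‖ ^ 2 = ∫ x in Metric.ball x₀ r, p x * ‖b x‖ ^ 2 := by
    refine (setIntegral_eq_integral_of_forall_compl_eq_zero fun x hx => ?_).symm
    rw [hp1 x (by simpa [dist_eq_norm] using hx), zero_mul]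
  rw [h1]
  refine integral_mono (integrable_weight_mul_norm_sq hp hps hb).integrableOn
    ((hbm.integrable_norm_pow two_ne_zero).const_mul _) fun x => ?_
  have := hpc x
  simp only
  gcongr

theorem le_sqrt_integral_weight (hp : Continuous p) (hps : HasCompactSupport p)
    (hp0 : ∀ x, 0 ≤ p x) (hb : Continuous b) (hpc : ∀ x, ‖x - x₀‖ < r → c ^ 2 ≤ p x) :
    c * (eLpNorm b 2 (ballMeasure x₀ r)).toReal ≤ √(∫ x, p x * ‖b x‖ ^ 2) := by
  refine Real.le_sqrt_of_sq_le ?_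
  have hbm := memLp_ballMeasure_of_continuous hb x₀ r
  rw [mul_pow, toReal_eLpNorm_sq hbm, ← integral_const_mul]
  have hint := integrable_weight_mul_norm_sq hp hps hb
  refine le_trans (setIntegral_mono_on ((hbm.integrable_norm_pow two_ne_zero).const_mul _)
    hint.integrableOn measurableSet_ball fun x hx => ?_)
    (setIntegral_le_integral hint (ae_of_all _ fun x => mul_nonneg (hp0 x) (by positivity)))
  have := hpc x (by simpa [dist_eq_norm] using hx)
  gcongr

end WeightNorm

theorem fderiv_apply_coord {X : E3 → E3} (hX : ContDiff ℝ 1 X) (x v : E3) (i : Fin 3) :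
    fderiv ℝ (fun x => X x i) x v = (fderiv ℝ X x v) i := by
  have h : HasFDerivAt (fun x => X x i)
      ((EuclideanSpace.proj i : E3 →L[ℝ] ℝ).comp (fderiv ℝ X x)) x :=
    (EuclideanSpace.proj i : E3 →L[ℝ] ℝ).hasFDerivAt.comp x
      (hX.differentiable one_ne_zero x).hasFDerivAt
  rw [h.fderiv]
  rfl

theorem contDiff_coord {X : E3 → E3} (hX : ContDiff ℝ 1 X) (i : Fin 3) :
    ContDiff ℝ 1 fun x => X x i :=
  (EuclideanSpace.proj i : E3 →L[ℝ] ℝ).contDiff.comp hX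

theorem integral_divergence_eq_zero {X : E3 → E3} (hX : ContDiff ℝ 1 X) (hXs : HasCompactSupport X) :
    ∫ x, ∑ i, fderiv ℝ (fun x => X x i) x (basisVec i) = 0 ∧
      Integrable fun x => ∑ i, fderiv ℝ (fun x => X x i) x (basisVec i) := by
  have hs : ∀ i, HasCompactSupport fun x => X x i := fun i =>
    hXs.comp_left (g := fun y : E3 => y i) rfl
  have hint : ∀ i : Fin 3, Integrable fun x => fderiv ℝ (fun x => X x i) x (basisVec i) := fun i =>
    (((contDiff_coord hX i).continuous_fderiv one_ne_zero).clm_apply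
      continuous_const).integrable_of_hasCompactSupport ((hs i).fderiv_apply ℝ _)
  refine ⟨?_, integrable_finsetSum _ fun i _ => hint i⟩
  rw [integral_finsetSum _ fun i _ => hint i]
  exact Finset.sum_eq_zero fun i _ => integral_fderiv_eq_zero (contDiff_coord hX i) (hs i) _

/-- Here W, V, X stand for w, ∂ₜw, ∇w, and q for the time derivative of the weight p. The terms WV
cancel, the damping has a favourable sign, and p(V div X + X·∇V) = div(pVX) - V∇p·X. The last term
is absorbed by q(V² + |X|²), since |∇p| ≤ -q: this is finite speed of propagation. Only the force
remains. -/
theorem integral_energy_rate_le {p q W V G : E3 → ℝ} {X : E3 → E3} {γ : ℝ} (hγ : 0 ≤ γ)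
    (hp : ContDiff ℝ 1 p) (hps : HasCompactSupport p) (hp0 : ∀ x, 0 ≤ p x) (hq : Continuous q)
    (hqs : HasCompactSupport q) (hgrad : ∀ x, ‖fderiv ℝ p x‖ ≤ -q x) (hW : Continuous W)
    (hV : ContDiff ℝ 1 V) (hX : ContDiff ℝ 1 X) (hG : Continuous G) :
    ∫ x, ((q x * W x ^ 2 + 2 * p x * W x * V x) +
      ((q x * V x ^ 2 + 2 * p x * V x *
        (-γ * V x - W x + (∑ i, (fderiv ℝ X x (basisVec i)) i) + G x)) +
      ∑ i, (q x * X x i ^ 2 + 2 * p x * X x i * fderiv ℝ V x (basisVec i)))) ≤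
      2 * ∫ x, p x * |V x| * |G x| := by
  have hpc := hp.continuous
  have hVc := hV.continuous
  have hXc := hX.continuous
  have hVX : ContDiff ℝ 1 fun x => (p x * V x) • X x := (hp.mul hV).smul hX
  have hVXs : HasCompactSupport fun x => (p x * V x) • X x := by
    have : HasCompactSupport fun x => p x * V x := hps.mul_right
    exact this.smul_right
  obtain ⟨hdiv, hdivi⟩ := integral_divergence_eq_zero hVX hVXs
  have hGi : Integrable fun x => p x * |V x| * |G x| := by
    refine Continuous.integrable_of_hasCompactSupport (by fun_prop) ?_
    have : HasCompactSupport fun x => p x * |V x| := hps.mul_right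
    exact this.mul_right
  -- A divergence of zero integral is added to the right side, so that the inequality becomes
  -- pointwise.
  have h1 : 2 * ∫ x, p x * |V x| * |G x| = ∫ x, (2 * (p x * |V x| * |G x|) +
      2 * ∑ i, fderiv ℝ (fun x => ((p x * V x) • X x) i) x (basisVec i)) := by
    rw [integral_add (hGi.const_mul _) (hdivi.const_mul _), integral_const_mul, integral_const_mul,
      hdiv, mul_zero, add_zero]
  rw [h1]
  have hdV : ∀ i, Continuous fun x => fderiv ℝ V x (basisVec i) := fun i =>
    (hV.continuous_fderiv one_ne_zero).clm_apply continuous_const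
  have hdX : ∀ i, Continuous fun x => (fderiv ℝ X x (basisVec i)) i := fun i =>
    (EuclideanSpace.proj i : E3 →L[ℝ] ℝ).continuous.comp
      ((hX.continuous_fderiv one_ne_zero).clm_apply continuous_const)
  have hXi : ∀ i, Continuous fun x => X x i := fun i => (contDiff_coord hX i).continuous
  refine integral_mono ?_ ((hGi.const_mul _).add (hdivi.const_mul _)) fun x => ?_
  · refine Continuous.integrable_of_hasCompactSupport (by fun_prop) ?_
    refine HasCompactSupport.of_support_subset_isCompact (hps.isCompact.union hqs.isCompact) ?_
    intro x hx
    by_contra hcon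
    simp only [mem_union, not_or] at hcon
    refine hx ?_
    simp only
    rw [image_eq_zero_of_notMem_tsupport hcon.1, image_eq_zero_of_notMem_tsupport hcon.2]
    simp
  · have hprod : ∀ i, fderiv ℝ (fun x => ((p x * V x) • X x) i) x (basisVec i) =
        p x * V x * (fderiv ℝ X x (basisVec i)) i + p x * (fderiv ℝ V x (basisVec i) * X x i) +
          V x * (fderiv ℝ p x (basisVec i) * X x i) := by
      intro i
      have hp' := (hp.differentiable one_ne_zero x).hasFDerivAt
      have hV' := (hV.differentiable one_ne_zero x).hasFDerivAt
      have hX' := ((contDiff_coord hX i).differentiable one_ne_zero x).hasFDerivAt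
      have h2 := (hp'.mul hV').mul hX'
      have h3 : fderiv ℝ (fun x => ((p x * V x) • X x) i) x = _ := h2.fderiv
      rw [h3, ← fderiv_apply_coord hX]
      simp
      ring
    simp_rw [hprod]
    have hsum1 : ∑ i, fderiv ℝ p x (basisVec i) * X x i = fderiv ℝ p x (X x) :=
      (continuousLinearMap_apply_eq_sum _ _).symm
    have hns : ‖X x‖ ^ 2 = ∑ i, X x i ^ 2 := EuclideanSpace.real_norm_sq_eq _
    have h4 : |fderiv ℝ p x (X x)| ≤ -q x * ‖X x‖ :=
      ((fderiv ℝ p x).le_opNorm _).trans (mul_le_mul_of_nonneg_right (hgrad x) (norm_nonneg _))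
    have hq0 : 0 ≤ -q x := (norm_nonneg _).trans (hgrad x)
    have h5 : -(2 * V x * fderiv ℝ p x (X x)) ≤ -q x * (V x ^ 2 + ‖X x‖ ^ 2) := by
      refine (neg_le_abs _).trans ?_
      rw [abs_mul, abs_mul, abs_two]
      calc 2 * |V x| * |fderiv ℝ p x (X x)| ≤ 2 * |V x| * (-q x * ‖X x‖) := by gcongr
        _ = -q x * (2 * |V x| * ‖X x‖) := by ring
        _ ≤ -q x * (V x ^ 2 + ‖X x‖ ^ 2) := by
          gcongr
          rw [← sq_abs (V x)]
          exact two_mul_le_add_sq _ _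
    have h6 : p x * (V x * G x) ≤ p x * (|V x| * |G x|) := by
      rw [← abs_mul]
      exact mul_le_mul_of_nonneg_left (le_abs_self _) (hp0 x)
    have h7 : 0 ≤ p x * (γ * V x ^ 2) := mul_nonneg (hp0 x) (by positivity)
    have h8 : 0 ≤ -q x * W x ^ 2 := mul_nonneg hq0 (by positivity)
    simp only [Finset.sum_add_distrib, ← Finset.mul_sum]
    rw [hsum1]
    have h9 : ∑ i, 2 * p x * X x i * fderiv ℝ V x (basisVec i) =
        2 * p x * ∑ i, fderiv ℝ V x (basisVec i) * X x i := by
      rw [Finset.mul_sum]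
      exact Finset.sum_congr rfl fun i _ => by ring
    rw [h9, ← hns]
    nlinarith

/-- With q = div(pb), integration by parts gives ∫ qW² = -2∫ pW b·∇W, so the rate is the integral of
2pW(V - b·X) with |b| ≤ 1. This is the time derivative of W seen along the flow of -b, and no
derivative of the weight survives. -/
theorem integral_moment_rate_le {p q W V : E3 → ℝ} {X b : E3 → E3}
    (hp : ContDiff ℝ 1 p) (hps : HasCompactSupport p) (hp0 : ∀ x, 0 ≤ p x)
    (hb : ContDiff ℝ 1 b) (hb1 : ∀ x, p x ≠ 0 → ‖b x‖ ≤ 1)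
    (hq : ∀ x, q x = ∑ i, fderiv ℝ (fun x => p x * b x i) x (basisVec i))
    (hW : ContDiff ℝ 1 W) (hWX : ∀ x i, fderiv ℝ W x (basisVec i) = X x i)
    (hV : Continuous V) (hX : Continuous X) :
    ∫ x, (q x * W x ^ 2 + 2 * p x * W x * V x) ≤ 2 * ∫ x, p x * |W x| * |(|V x| + ‖X x‖)| := by
  have hpc := hp.continuous
  have hWc := hW.continuous
  have hBX : ContDiff ℝ 1 fun x => (p x * W x ^ 2) • b x := (hp.mul (hW.pow 2)).smul hb
  have hBXs : HasCompactSupport fun x => (p x * W x ^ 2) • b x := by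
    have : HasCompactSupport fun x => p x * W x ^ 2 := hps.mul_right
    exact this.smul_right
  obtain ⟨hdiv, hdivi⟩ := integral_divergence_eq_zero hBX hBXs
  have hprod : ∀ x i, fderiv ℝ (fun x => ((p x * W x ^ 2) • b x) i) x (basisVec i) =
      W x ^ 2 * fderiv ℝ (fun x => p x * b x i) x (basisVec i) +
        2 * p x * W x * (b x i * X x i) := by
    intro x i
    have hpb : HasFDerivAt (fun x => p x * b x i) (fderiv ℝ (fun x => p x * b x i) x) x :=
      ((hp.mul (contDiff_coord hb i)).differentiable one_ne_zero x).hasFDerivAt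
    have hW' := (hW.differentiable one_ne_zero x).hasFDerivAt
    have h2 := (hW'.mul hW').mul hpb
    have h3 : (fun x => ((p x * W x ^ 2) • b x) i) = W * W * fun x => p x * b x i := by
      funext y
      simp
      ring
    rw [h3, h2.fderiv, ← hWX]
    simp
    ring
  have hsumeq : ∀ x, ∑ i, fderiv ℝ (fun x => ((p x * W x ^ 2) • b x) i) x (basisVec i) =
      q x * W x ^ 2 + 2 * p x * W x * inner ℝ (X x) (b x) := by
    intro x
    simp_rw [hprod]
    rw [Finset.sum_add_distrib, ← Finset.mul_sum, ← Finset.mul_sum, ← hq, PiLp.inner_apply]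
    simp [mul_comm]
  have hbc := hb.continuous
  have hpW : HasCompactSupport fun x => p x * W x := hps.mul_right
  have h2pW : HasCompactSupport fun x => 2 * p x * W x := by
    simp_rw [mul_assoc]
    exact hpW.mul_left
  have hIi : Integrable fun x => 2 * p x * W x * V x - 2 * p x * W x * inner ℝ (X x) (b x) :=
    (Continuous.integrable_of_hasCompactSupport (by fun_prop) h2pW.mul_right).sub
      (Continuous.integrable_of_hasCompactSupport (by fun_prop) h2pW.mul_right)
  have h1 : ∫ x, (q x * W x ^ 2 + 2 * p x * W x * V x) =
      ∫ x, (2 * p x * W x * V x - 2 * p x * W x * inner ℝ (X x) (b x)) := by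
    have h := integral_add hdivi hIi
    rw [hdiv, zero_add] at h
    rw [← h]
    refine integral_congr_ae (ae_of_all _ fun x => ?_)
    simp only
    rw [hsumeq]
    ring
  rw [h1, ← integral_const_mul]
  refine integral_mono hIi ?_ fun x => ?_
  · refine Continuous.integrable_of_hasCompactSupport (by fun_prop) ?_
    have h2 : HasCompactSupport fun x => p x * |W x| := hps.mul_right
    have h3 : HasCompactSupport fun x => p x * |W x| * |(|V x| + ‖X x‖)| := h2.mul_right
    exact h3.mul_left
  · simp only
    by_cases h0 : p x = 0
    · simp [h0]
    have hi : |inner ℝ (X x) (b x)| ≤ ‖X x‖ :=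
      (abs_real_inner_le_norm _ _).trans
        (mul_le_of_le_one_right (norm_nonneg _) (hb1 x h0))
    rw [abs_of_nonneg (by positivity : 0 ≤ |V x| + ‖X x‖)]
    have h2 : |W x * (V x - inner ℝ (X x) (b x))| ≤ |W x| * (|V x| + ‖X x‖) := by
      rw [abs_mul]
      gcongr
      exact (abs_sub _ _).trans (by gcongr)
    calc 2 * p x * W x * V x - 2 * p x * W x * inner ℝ (X x) (b x)
        = 2 * p x * (W x * (V x - inner ℝ (X x) (b x))) := by ring
      _ ≤ 2 * p x * (|W x| * (|V x| + ‖X x‖)) :=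
        mul_le_mul_of_nonneg_left ((le_abs_self _).trans h2) (by linarith [hp0 x])
      _ = _ := by ring

/-! ### The mollified equation, pointwise in space -/

theorem gradient_apply (a : E3 → ℝ) (x : E3) (i : Fin 3) :
    gradient a x i = fderiv ℝ a x (basisVec i) := by
  have h : inner ℝ (gradient a x) (basisVec i) = fderiv ℝ a x (basisVec i) := by
    rw [gradient, InnerProductSpace.toDual_symm_apply]
  rw [← h, EuclideanSpace.inner_single_right]
  simp

theorem contDiff_fderiv_kernel {k : E3 → ℝ} (hk : ContDiff ℝ ∞ k) (v : E3) :
    ContDiff ℝ ∞ fun z => fderiv ℝ k z v :=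
  (hk.fderiv_right (m := ∞) (by simp)).clm_apply contDiff_const

theorem hasCompactSupport_fderiv_kernel {k : E3 → ℝ} (hks : HasCompactSupport k) (v : E3) :
    HasCompactSupport fun z => fderiv ℝ k z v := hks.fderiv_apply ℝ v

theorem contDiff_comp_sub {k : E3 → ℝ} (hk : ContDiff ℝ ∞ k) (x : E3) :
    ContDiff ℝ ∞ fun y => k (x - y) := hk.comp (contDiff_const.sub contDiff_id)

theorem IsPrimitive.of_continuous {T ρ : ℝ} {A B : ℝ → E3 → ℝ}
    (hA : Continuous fun z : ℝ × E3 => A z.1 z.2) (hB : Continuous fun z : ℝ × E3 => B z.1 z.2)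
    (h : ∀ x t, 0 ≤ t → A t x - A 0 x = ∫ s in (0 : ℝ)..t, B s x) : IsPrimitive T ρ A B where
  cont := hA
  intervalIntegrable x := (hB.comp (Continuous.prodMk_left x)).intervalIntegrable _ _
  eq_add x t ht := by rw [← h x t ht.1]; ring
  meas := hB.aestronglyMeasurable
  bound := by
    obtain ⟨M, hM0, hM⟩ := exists_bound_slab (T := T) (ρ := ρ) hB.continuousOn
    refine ⟨fun _ => M, integrableOn_const measure_Ioc_lt_top.ne, ?_⟩
    filter_upwards [ae_restrict_mem measurableSet_Ioc] with t ht x hx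
    exact hM t ⟨ht.1.le, ht.2⟩ x hx

theorem integral_inner_gradient_eq_divergence {D : E3 → E3} (hD : LocallyIntegrable D volume)
    {k : E3 → ℝ} (hk : ContDiff ℝ ∞ k) (hks : HasCompactSupport k) (x : E3) :
    ∫ y, inner ℝ (D y) (gradient (fun y => k (x - y)) y) =
      -∑ i, (fderiv ℝ (conv k D) x (basisVec i)) i := by
  have h1 : ∀ i, Integrable fun y => fderiv ℝ k (x - y) (basisVec i) • D y := fun i =>
    integrable_conv_kernel (contDiff_fderiv_kernel hk (basisVec i)).continuous
      (hasCompactSupport_fderiv_kernel hks (basisVec i)) hD x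
  have h2 : ∀ i, (fderiv ℝ (conv k D) x (basisVec i)) i =
      ∫ y, fderiv ℝ k (x - y) (basisVec i) * D y i := by
    intro i
    rw [fderiv_conv hk hks hD]
    exact ((EuclideanSpace.proj i : E3 →L[ℝ] ℝ).integral_comp_comm (h1 i)).symm
  have h3 : ∀ i, Integrable fun y => fderiv ℝ k (x - y) (basisVec i) * D y i := fun i =>
    (EuclideanSpace.proj i : E3 →L[ℝ] ℝ).integrable_comp (h1 i)
  simp_rw [h2, gradient_comp_sub hk, inner_neg_right]
  rw [integral_neg, ← integral_finsetSum _ fun i _ => h3 i]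
  congr 1
  refine integral_congr_ae (ae_of_all _ fun y => ?_)
  simp only [PiLp.inner_apply]
  refine Finset.sum_congr rfl fun i _ => ?_
  rw [gradient_apply]
  simp

theorem aestronglyMeasurable_conv_slab {G : ℝ → E3 → ℝ} (hG : MemLpLoc 1 2 G) {k : E3 → ℝ}
    (hk : Continuous k) (T : ℝ) :
    AEStronglyMeasurable (fun z : ℝ × E3 => conv k (G z.1) z.2)
      ((volume.restrict (Ioc 0 T)).prod (volume : Measure E3)) := by
  have h1 : AEStronglyMeasurable (fun z : ℝ × E3 => G z.1 z.2)
      ((volume.restrict (Ioc 0 T)).prod (volume : Measure E3)) :=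
    hG.aestronglyMeasurable_prod.mono_measure
      (Measure.prod_mono (Measure.restrict_mono Ioc_subset_Ioi_self le_rfl) le_rfl)
  have h2 : Measure.QuasiMeasurePreserving (fun z : (ℝ × E3) × E3 => (z.1.1, z.2))
      (((volume.restrict (Ioc 0 T)).prod (volume : Measure E3)).prod (volume : Measure E3))
      ((volume.restrict (Ioc 0 T)).prod (volume : Measure E3)) :=
    QuasiMeasurePreserving.prodMap Measure.quasiMeasurePreserving_fst
      (Measure.QuasiMeasurePreserving.id _)
  have h3 := h1.comp_quasiMeasurePreserving h2
  have h4 : AEStronglyMeasurable (fun z : (ℝ × E3) × E3 => k (z.1.2 - z.2))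
      (((volume.restrict (Ioc 0 T)).prod (volume : Measure E3)).prod (volume : Measure E3)) :=
    Continuous.aestronglyMeasurable (by fun_prop)
  exact (h4.smul h3).integral_prod_right'

theorem exists_bound_conv_slab {G : ℝ → E3 → ℝ} (hG : MemLpLoc 1 2 G) {k : E3 → ℝ}
    (hk : Continuous k) (hks : HasCompactSupport k) (T ρ : ℝ) :
    ∃ κ : ℝ → ℝ, IntegrableOn κ (Ioc 0 T) ∧
      ∀ᵐ t ∂volume.restrict (Ioc 0 T), ∀ x, ‖x‖ < ρ → |conv k (G t) x| ≤ κ t := by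
  obtain ⟨M, δ, hδ, hM, hkδ⟩ := exists_kernel_bound hk hks
  set c : ℝ≥0∞ := M * volume (Metric.ball (0 : E3) (ρ + δ)) ^ (1 / 2 : ℝ) with hc
  have hc' : c ≠ ⊤ := ENNReal.mul_ne_top ENNReal.coe_ne_top
    (ENNReal.rpow_ne_top_of_nonneg (by norm_num) measure_ball_lt_top.ne)
  have hm : AEMeasurable (fun t => c * eLpNorm (G t) 2 (ballMeasure 0 (ρ + δ)))
      (volume.restrict (Ioc 0 T)) :=
    ((hG.aemeasurable_eLpNorm two_ne_zero ENNReal.ofNat_ne_top 0 _ measurable_const).mono_measure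
      (Measure.restrict_mono Ioc_subset_Ioi_self le_rfl)).const_mul _
  have hfin : ∫⁻ t in Ioc 0 T, c * eLpNorm (G t) 2 (ballMeasure 0 (ρ + δ)) ≠ ⊤ := by
    rw [lintegral_const_mul' _ _ hc', restrict_Ioo_eq_restrict_Ioc.symm]
    exact ENNReal.mul_ne_top hc' (hG.lintegral_lt_top T _).ne
  refine ⟨fun t => (c * eLpNorm (G t) 2 (ballMeasure 0 (ρ + δ))).toReal,
    integrable_toReal_of_lintegral_ne_top hm hfin, ?_⟩
  filter_upwards [ae_lt_top' hm hfin, ae_mono (Measure.restrict_mono Ioc_subset_Ioi_self le_rfl)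
    hG.ae_aestronglyMeasurable] with t ht htm x hx
  have h1 := enorm_integral_smul_le (k := fun y => k (x - y)) (ρ := ρ + δ) (fun y => hM (x - y))
    (fun y hy => by
      have h2 := hkδ _ hy
      have h3 : ‖y‖ ≤ ‖x‖ + ‖x - y‖ := by
        have := norm_sub_le x (x - y)
        simpa using this
      linarith) htm
  have h2 : ‖conv k (G t) x‖ₑ ≤ c * eLpNorm (G t) 2 (ballMeasure 0 (ρ + δ)) :=
    (enorm_integral_le_lintegral_enorm _).trans h1
  have h3 := ENNReal.toReal_mono ht.ne h2
  simpa using h3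

namespace IntegratedWave

variable {γ : ℝ} {w v G : ℝ → E3 → ℝ} {D : ℝ → E3 → E3} {k : E3 → ℝ} {T ρ : ℝ}

theorem isPrimitive_fst (h : IntegratedWave γ w v D G) (hk : ContDiff ℝ ∞ k)
    (hks : HasCompactSupport k) :
    IsPrimitive T ρ (fun t => conv k (w t)) (fun t => conv k (v t)) :=
  IsPrimitive.of_continuous (h.curve_fst.continuous_conv hk hks)
    (h.curve_snd.continuous_conv hk hks)
    fun x t ht => h.eq_fst _ (contDiff_comp_sub hk x) (hasCompactSupport_comp_sub hks x) t ht

theorem conv_grad_apply (h : IntegratedWave γ w v D G) (hk : ContDiff ℝ ∞ k)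
    (hks : HasCompactSupport k) (t : ℝ) (x : E3) (i : Fin 3) :
    fderiv ℝ (conv k (w t)) x (basisVec i) = conv k (D t) x i := by
  rw [← gradient_apply, (h.grad t).gradient_conv hk hks]

/-- A space derivative of a mollified function falls on the kernel, and ∂ᵢk is again a smooth
compactly supported kernel, so this is the first-component statement for ∂ᵢk. -/
theorem isPrimitive_grad (h : IntegratedWave γ w v D G) (hk : ContDiff ℝ ∞ k)
    (hks : HasCompactSupport k) (i : Fin 3) :
    IsPrimitive T ρ (fun t x => conv k (D t) x i)
      (fun t x => fderiv ℝ (conv k (v t)) x (basisVec i)) := by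
  have h1 := h.isPrimitive_fst (T := T) (ρ := ρ) (contDiff_fderiv_kernel hk (basisVec i))
    (hasCompactSupport_fderiv_kernel hks (basisVec i))
  have e1 : (fun t x => conv k (D t) x i) =
      fun t => conv (fun z => fderiv ℝ k z (basisVec i)) (w t) := by
    funext t x
    rw [← h.conv_grad_apply hk hks, fderiv_conv hk hks (h.curve_fst.locallyIntegrable t)]
  have e2 : (fun t x => fderiv ℝ (conv k (v t)) x (basisVec i)) =
      fun t => conv (fun z => fderiv ℝ k z (basisVec i)) (v t) := by
    funext t x
    rw [fderiv_conv hk hks (h.curve_snd.locallyIntegrable t)]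
  rw [e1, e2]
  exact h1

/-- The integrated equation is tested against y ↦ k(x - y). Everything but the force is jointly
continuous; the force contributes a function integrable in time and bounded locally uniformly in x.
-/
theorem isPrimitive_snd (h : IntegratedWave γ w v D G) (hk : ContDiff ℝ ∞ k)
    (hks : HasCompactSupport k) (hT : 0 ≤ T) :
    IsPrimitive T ρ (fun t => conv k (v t)) (fun t x => -γ * conv k (v t) x - conv k (w t) x +
      (∑ i, (fderiv ℝ (conv k (D t)) x (basisVec i)) i) + conv k (G t) x) := by
  have hdiv : Continuous fun z : ℝ × E3 =>
      ∑ i, (fderiv ℝ (conv k (D z.1)) z.2 (basisVec i)) i := by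
    refine continuous_finsetSum _ fun i _ => (EuclideanSpace.proj i : E3 →L[ℝ] ℝ).continuous.comp ?_
    have h1 := h.curve_grad.continuous_conv (contDiff_fderiv_kernel hk (basisVec i))
      (hasCompactSupport_fderiv_kernel hks (basisVec i))
    refine h1.congr fun z => ?_
    rw [fderiv_conv hk hks (h.curve_grad.locallyIntegrable _)]
  have hreg : Continuous fun z : ℝ × E3 => -γ * conv k (v z.1) z.2 - conv k (w z.1) z.2 +
      (∑ i, (fderiv ℝ (conv k (D z.1)) z.2 (basisVec i)) i) :=
    (((h.curve_snd.continuous_conv hk hks).const_mul _).sub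
      (h.curve_fst.continuous_conv hk hks)).add hdiv
  refine ⟨h.curve_snd.continuous_conv hk hks, fun x => ?_, fun x t ht => ?_,
    hreg.aestronglyMeasurable.add (aestronglyMeasurable_conv_slab h.force hk.continuous T), ?_⟩
  · have h1 := h.force.integrableOn_integral_mul (contDiff_comp_sub hk x).continuous
      (hasCompactSupport_comp_sub hks x) T
    have h2 : IntervalIntegrable (fun t => conv k (G t) x) volume 0 T := by
      rw [intervalIntegrable_iff_integrableOn_Ioo_of_le hT]
      exact h1
    exact ((hreg.comp (Continuous.prodMk_left x)).intervalIntegrable _ _).add h2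
  · have h1 := h.eq_snd _ (contDiff_comp_sub hk x) (hasCompactSupport_comp_sub hks x) t ht.1
    rw [sub_eq_iff_eq_add'] at h1
    refine h1.trans ?_
    congr 1
    refine intervalIntegral.integral_congr fun s _ => ?_
    simp only
    rw [integral_inner_gradient_eq_divergence (h.curve_grad.locallyIntegrable s) hk hks x,
      sub_neg_eq_add]
    rfl
  · obtain ⟨M, hM0, hM⟩ := exists_bound_slab (T := T) (ρ := ρ)
      (A := fun t x => -γ * conv k (v t) x - conv k (w t) x +
        (∑ i, (fderiv ℝ (conv k (D t)) x (basisVec i)) i)) hreg.continuousOn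
    obtain ⟨κ, hκ, hκb⟩ := exists_bound_conv_slab h.force hk.continuous hks T ρ
    refine ⟨fun t => M + κ t, (integrableOn_const measure_Ioc_lt_top.ne).add hκ, ?_⟩
    filter_upwards [hκb, ae_restrict_mem measurableSet_Ioc] with t ht htT x hx
    exact (abs_add_le _ _).trans (add_le_add (hM t ⟨htT.1.le, htT.2⟩ x hx) (ht x hx))

end IntegratedWave

/-! ### The cone weight and the energy inequality -/

/-- A smooth nondecreasing function vanishing on `(-∞, 0]` and equal to `1` on `[1 / m, ∞)`. -/
noncomputable def cutoff (m s : ℝ) : ℝ := Real.smoothTransition (m * s)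

theorem contDiff_cutoff (m : ℝ) : ContDiff ℝ ∞ (cutoff m) :=
  Real.smoothTransition.contDiff.comp (contDiff_const.mul contDiff_id)

theorem cutoff_nonneg (m s : ℝ) : 0 ≤ cutoff m s := Real.smoothTransition.nonneg _

theorem cutoff_le_one (m s : ℝ) : cutoff m s ≤ 1 := Real.smoothTransition.le_one _

theorem cutoff_eq_one {m s : ℝ} (h : 1 ≤ m * s) : cutoff m s = 1 :=
  Real.smoothTransition.one_of_one_le h

theorem cutoff_eq_zero {m s : ℝ} (hm : 0 ≤ m) (hs : s ≤ 0) : cutoff m s = 0 :=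
  Real.smoothTransition.zero_of_nonpos (mul_nonpos_of_nonneg_of_nonpos hm hs)

theorem hasDerivAt_cutoff (m s : ℝ) : HasDerivAt (cutoff m) (deriv (cutoff m) s) s :=
  ((contDiff_cutoff m).differentiable (by simp) s).hasDerivAt

theorem continuous_deriv_cutoff (m : ℝ) : Continuous (deriv (cutoff m)) :=
  (contDiff_cutoff m).continuous_deriv (by simp)

theorem deriv_cutoff_nonneg {m : ℝ} (hm : 0 ≤ m) (s : ℝ) : 0 ≤ deriv (cutoff m) s :=
  Monotone.deriv_nonneg fun _ _ h => Real.smoothTransition.monotone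
    (mul_le_mul_of_nonneg_left h hm)

theorem deriv_cutoff_eq_zero {m s : ℝ} (hm : 0 ≤ m) (hs : s ≤ 0) : deriv (cutoff m) s = 0 := by
  -- Such a point is a global minimum; this argument covers the endpoint s = 0 as well.
  have h : IsLocalMin (cutoff m) s := Eventually.of_forall fun y => by
    rw [cutoff_eq_zero hm hs]
    exact cutoff_nonneg m y
  exact h.deriv_eq_zero

theorem hasFDerivAt_norm_sub_sq (x₀ x : E3) :
    HasFDerivAt (fun x : E3 => ‖x - x₀‖ ^ 2) (2 • innerSL ℝ (x - x₀)) x := by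
  simpa using ((hasFDerivAt_id x).sub_const x₀).norm_sq

section ConeWeight

variable {m R T : ℝ} {x₀ : E3}

/-- A smooth approximation of the indicator of the backward cone with base `B^R_{x₀}`. -/
noncomputable def coneWeight (m R : ℝ) (x₀ : E3) (t : ℝ) (x : E3) : ℝ :=
  cutoff m ((R - t) ^ 2 - ‖x - x₀‖ ^ 2)

/-- The time derivative of `coneWeight`. -/
noncomputable def coneWeightDeriv (m R : ℝ) (x₀ : E3) (t : ℝ) (x : E3) : ℝ :=
  deriv (cutoff m) ((R - t) ^ 2 - ‖x - x₀‖ ^ 2) * (-2 * (R - t))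

theorem sq_sub_norm_sq_nonpos {r : ℝ} (hr : 0 ≤ r) {x : E3} (hx : r ≤ ‖x - x₀‖) :
    r ^ 2 - ‖x - x₀‖ ^ 2 ≤ 0 := by
  have : r ^ 2 ≤ ‖x - x₀‖ ^ 2 := by gcongr
  linarith

theorem coneWeight_eq_zero (hm : 0 ≤ m) {t : ℝ} (ht : t ≤ R) {x : E3} (hx : R - t ≤ ‖x - x₀‖) :
    coneWeight m R x₀ t x = 0 :=
  cutoff_eq_zero hm (sq_sub_norm_sq_nonpos (sub_nonneg.2 ht) hx)

theorem coneWeightDeriv_eq_zero (hm : 0 ≤ m) {t : ℝ} (ht : t ≤ R) {x : E3}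
    (hx : R - t ≤ ‖x - x₀‖) : coneWeightDeriv m R x₀ t x = 0 := by
  rw [coneWeightDeriv, deriv_cutoff_eq_zero hm (sq_sub_norm_sq_nonpos (sub_nonneg.2 ht) hx), zero_mul]

theorem sub_le_norm_sub {t : ℝ} (ht : 0 ≤ t) {x : E3} (hx : ‖x₀‖ + R ≤ ‖x‖) :
    R - t ≤ ‖x - x₀‖ := by
  have := norm_sub_norm_le x x₀
  linarith

theorem isWeight_coneWeight (hm : 0 ≤ m) (hT : T ≤ R) :
    IsWeight T (‖x₀‖ + R) (coneWeight m R x₀) (coneWeightDeriv m R x₀) where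
  cont := by
    refine Continuous.continuousOn ((contDiff_cutoff m).continuous.comp ?_)
    fun_prop
  cont' := by
    refine Continuous.continuousOn (((continuous_deriv_cutoff m).comp ?_).mul ?_) <;> fun_prop
  hasDerivAt t _ x := by
    refine (hasDerivAt_cutoff m _).comp t ?_
    convert! (((hasDerivAt_id t).const_sub R).pow 2).sub_const (‖x - x₀‖ ^ 2) using 1
    simp
  nonneg t _ x := cutoff_nonneg _ _
  contDiff t _ := by
    refine ((contDiff_cutoff m).of_le (by simp)).comp (contDiff_const.sub ?_)
    exact (contDiff_id.sub contDiff_const).norm_sq ℝ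
  eq_zero t ht x hx := coneWeight_eq_zero hm (ht.2.trans hT) (sub_le_norm_sub ht.1 hx)
  eq_zero' t ht x hx := coneWeightDeriv_eq_zero hm (ht.2.trans hT) (sub_le_norm_sub ht.1 hx)

/-- On the support of the derivative |x - x₀| ≤ R - t, so the gradient, of size 2|x - x₀| times the
derivative of the cutoff, is dominated by the factor 2(R - t) of the time derivative. Using squares
in the weight keeps it smooth at x₀. -/
theorem norm_fderiv_coneWeight_le (hm : 0 ≤ m) {t : ℝ} (ht : t ≤ R) (x : E3) :
    ‖fderiv ℝ (coneWeight m R x₀ t) x‖ ≤ -coneWeightDeriv m R x₀ t x := by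
  have h : HasFDerivAt (coneWeight m R x₀ t) (deriv (cutoff m) ((R - t) ^ 2 - ‖x - x₀‖ ^ 2) •
      -((2 : ℕ) • (innerSL ℝ (x - x₀) : E3 →L[ℝ] ℝ))) x :=
    (hasDerivAt_cutoff m _).comp_hasFDerivAt x
      ((hasFDerivAt_norm_sub_sq x₀ x).const_sub ((R - t) ^ 2))
  have hd := deriv_cutoff_nonneg hm ((R - t) ^ 2 - ‖x - x₀‖ ^ 2)
  rw [h.fderiv, norm_smul, norm_neg, Real.norm_of_nonneg hd, coneWeightDeriv]
  by_cases hx : R - t ≤ ‖x - x₀‖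
  · rw [deriv_cutoff_eq_zero hm (sq_sub_norm_sq_nonpos (sub_nonneg.2 ht) hx)]
    simp
  · push Not at hx
    have h2 : ‖(2 : ℕ) • innerSL ℝ (x - x₀)‖ ≤ 2 * (R - t) := by
      refine (norm_nsmul_le).trans ?_
      rw [innerSL_apply_norm]
      push_cast
      linarith
    nlinarith

end ConeWeight

/-- The components of the state `(w, v, ∇w)` smoothed by the kernel `k`. -/
noncomputable def smoothedState (k : E3 → ℝ) (w v : ℝ → E3 → ℝ) (D : ℝ → E3 → E3) :
    Option (Option (Fin 3)) → ℝ → E3 → ℝ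
  | none => fun t => conv k (w t)
  | some none => fun t => conv k (v t)
  | some (some i) => fun t x => conv k (D t) x i

/-- The time derivative of the smoothed state of a solution. -/
noncomputable def smoothedStateDeriv (γ : ℝ) (k : E3 → ℝ) (w v : ℝ → E3 → ℝ) (D : ℝ → E3 → E3)
    (G : ℝ → E3 → ℝ) : Option (Option (Fin 3)) → ℝ → E3 → ℝ
  | none => fun t => conv k (v t)
  | some none => fun t x => -γ * conv k (v t) x - conv k (w t) x +
      (∑ i, (fderiv ℝ (conv k (D t)) x (basisVec i)) i) + conv k (G t) x
  | some (some i) => fun t x => fderiv ℝ (conv k (v t)) x (basisVec i)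

theorem sum_smoothedState_sq (k : E3 → ℝ) (w v : ℝ → E3 → ℝ) (D : ℝ → E3 → E3) (t : ℝ) (x : E3) :
    ∑ i, smoothedState k w v D i t x ^ 2 =
      ‖conv k (w t) x‖ ^ 2 + (‖conv k (v t) x‖ ^ 2 + ‖conv k (D t) x‖ ^ 2) := by
  rw [Fintype.sum_option, Fintype.sum_option, EuclideanSpace.real_norm_sq_eq]
  simp [smoothedState]

theorem hasCompactSupport_of_eq_zero {p : E3 → ℝ} {ρ : ℝ} (h : ∀ x, ρ ≤ ‖x‖ → p x = 0) :
    HasCompactSupport p := by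
  refine HasCompactSupport.of_support_subset_isCompact (isCompact_closedBall (0 : E3) ρ) ?_
  intro x hx
  by_contra hcon
  simp only [Metric.mem_closedBall, dist_zero_right, not_le] at hcon
  exact hx (h x hcon.le)

section WeightSlice

variable {T ρ : ℝ} {ψ ψ' : ℝ → E3 → ℝ} {t : ℝ}

theorem IsWeight.hasCompactSupport (h : IsWeight T ρ ψ ψ') (ht : t ∈ Icc 0 T) :
    HasCompactSupport (ψ t) := hasCompactSupport_of_eq_zero (h.eq_zero t ht)

theorem IsWeight.hasCompactSupport_deriv (h : IsWeight T ρ ψ ψ') (ht : t ∈ Icc 0 T) :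
    HasCompactSupport (ψ' t) := hasCompactSupport_of_eq_zero (h.eq_zero' t ht)

theorem IsWeight.continuous_deriv (h : IsWeight T ρ ψ ψ') (ht : t ∈ Icc 0 T) :
    Continuous (ψ' t) :=
  h.cont'.comp_continuous (f := fun x : E3 => (t, x)) (by fun_prop) fun x => ⟨ht, mem_univ _⟩

end WeightSlice

theorem integral_weighted_sum_sq {p : E3 → ℝ} (hp : Continuous p) (hps : HasCompactSupport p)
    {w v : E3 → ℝ} {D : E3 → E3} (hw : Continuous w) (hv : Continuous v) (hD : Continuous D) :
    ∫ x, p x * (‖w x‖ ^ 2 + (‖v x‖ ^ 2 + ‖D x‖ ^ 2)) =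
      (∫ x, p x * ‖w x‖ ^ 2) + ((∫ x, p x * ‖v x‖ ^ 2) + ∫ x, p x * ‖D x‖ ^ 2) := by
  have hw' := integrable_weight_mul_norm_sq hp hps hw
  have hv' := integrable_weight_mul_norm_sq hp hps hv
  have hD' := integrable_weight_mul_norm_sq hp hps hD
  rw [← integral_add hv' hD']
  refine Eq.trans ?_ (integral_add hw' (hv'.add hD'))
  refine integral_congr_ae (ae_of_all _ fun x => ?_)
  simp only
  ring

theorem sqrt_add_add_le {a b c : ℝ} (ha : 0 ≤ a) (hb : 0 ≤ b) (hc : 0 ≤ c) :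
    √(a + (b + c)) ≤ √a + √b + √c := by
  refine Real.sqrt_le_iff.2 ⟨by positivity, ?_⟩
  have h1 := Real.sq_sqrt ha
  have h2 := Real.sq_sqrt hb
  have h3 := Real.sq_sqrt hc
  have h4 := Real.sqrt_nonneg a
  have h5 := Real.sqrt_nonneg b
  have h6 := Real.sqrt_nonneg c
  nlinarith [mul_nonneg h4 h5, mul_nonneg h4 h6, mul_nonneg h5 h6]

namespace IntegratedWave

variable {γ : ℝ} {w v G : ℝ → E3 → ℝ} {D : ℝ → E3 → E3} {k : E3 → ℝ} {T R : ℝ} {x₀ : E3}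

theorem isPrimitive_smoothedState {ρ : ℝ} (h : IntegratedWave γ w v D G) (hk : ContDiff ℝ ∞ k)
    (hks : HasCompactSupport k) (hT : 0 ≤ T) (i : Option (Option (Fin 3))) :
    IsPrimitive T ρ (smoothedState k w v D i) (smoothedStateDeriv γ k w v D G i) :=
  match i with
  | none => h.isPrimitive_fst hk hks
  | some none => h.isPrimitive_snd hk hks hT
  | some (some i) => h.isPrimitive_grad hk hks i

theorem smoothed_energy_le (h : IntegratedWave γ w v D G) (hγ : 0 ≤ γ) (hk : ContDiff ℝ ∞ k)
    (hks : HasCompactSupport k) {m : ℝ} (hm : 0 ≤ m) (hT : 0 ≤ T) (hTR : T ≤ R) {N : ℝ → ℝ}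
    (hN : IntegrableOn N (Ioc 0 T)) (hN0 : ∀ t, 0 ≤ N t)
    (hGN : ∀ᵐ t ∂volume.restrict (Ioc 0 T),
      (eLpNorm (conv k (G t)) 2 (ballMeasure x₀ (R - t))).toReal ≤ N t) :
    √(∫ x, coneWeight m R x₀ T x * ∑ i, smoothedState k w v D i T x ^ 2) ≤
      √(∫ x, coneWeight m R x₀ 0 x * ∑ i, smoothedState k w v D i 0 x ^ 2) +
        2 * ∫ t in Ioc 0 T, N t := by
  have hψ := isWeight_coneWeight (x₀ := x₀) hm hTR
  refine sqrt_weighted_le hT hψ (fun i => h.isPrimitive_smoothedState hk hks hT i) hN hN0 ?_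
  filter_upwards [hGN, ae_restrict_mem measurableSet_Ioc,
    ae_mono (Measure.restrict_mono Ioc_subset_Ioi_self le_rfl) h.force.ae_locallyIntegrable]
    with t hGt ht hGl
  have htT : t ∈ Icc 0 T := ⟨ht.1.le, ht.2⟩
  have hp := hψ.contDiff t htT
  have hps := hψ.hasCompactSupport htT
  have hp0 := hψ.nonneg t htT
  have hW := contDiff_conv hk hks (h.curve_fst.locallyIntegrable t)
  have hV := contDiff_conv hk hks (h.curve_snd.locallyIntegrable t)
  have hX := contDiff_conv hk hks (h.curve_grad.locallyIntegrable t)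
  have hGk := (contDiff_conv hk hks hGl).continuous
  have h1 := integral_energy_rate_le hγ hp hps hp0 (hψ.continuous_deriv htT)
    (hψ.hasCompactSupport_deriv htT) (norm_fderiv_coneWeight_le hm (ht.2.trans hTR))
    hW.continuous (hV.of_le (by simp)) (hX.of_le (by simp)) hGk
  have h2 : ∀ x, weightedRate (coneWeight m R x₀) (coneWeightDeriv m R x₀)
      (smoothedState k w v D) (smoothedStateDeriv γ k w v D G) t x = _ := fun x => by
    rw [weightedRate, Fintype.sum_option, Fintype.sum_option]
  simp_rw [h2]
  refine h1.trans ?_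
  rw [mul_assoc]
  refine mul_le_mul_of_nonneg_left ?_ zero_le_two
  refine (integral_weighted_mul_le hp.continuous hps hp0 hV.continuous hGk).trans ?_
  refine mul_le_mul ?_ ?_ (Real.sqrt_nonneg _) (Real.sqrt_nonneg _)
  · refine Real.sqrt_le_sqrt ?_
    simp_rw [sum_smoothedState_sq]
    rw [integral_weighted_sum_sq hp.continuous hps hW.continuous hV.continuous hX.continuous]
    have e1 : 0 ≤ ∫ x, coneWeight m R x₀ t x * ‖conv k (w t) x‖ ^ 2 :=
      integral_nonneg fun x => mul_nonneg (hp0 x) (by positivity)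
    have e2 : 0 ≤ ∫ x, coneWeight m R x₀ t x * ‖conv k (D t) x‖ ^ 2 :=
      integral_nonneg fun x => mul_nonneg (hp0 x) (by positivity)
    simp only [Real.norm_eq_abs, sq_abs] at e1 e2 ⊢
    linarith
  · have h3 := sqrt_integral_weight_le (r := R - t) (x₀ := x₀) (c := 1) hp.continuous hps hGk
      zero_le_one (fun x => by rw [one_pow]; exact cutoff_le_one _ _)
      (fun x hx => coneWeight_eq_zero hm (ht.2.trans hTR) hx)
    simp only [Real.norm_eq_abs, sq_abs, one_mul] at h3
    exact h3.trans hGt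

theorem smoothed_norm_le (h : IntegratedWave γ w v D G) (hγ : 0 ≤ γ) (hk : ContDiff ℝ ∞ k)
    (hks : HasCompactSupport k) (hT : 0 ≤ T) (hTR : T < R) {N : ℝ → ℝ}
    (hN : IntegrableOn N (Ioc 0 T)) (hN0 : ∀ t, 0 ≤ N t)
    (hGN : ∀ᵐ t ∂volume.restrict (Ioc 0 T),
      (eLpNorm (conv k (G t)) 2 (ballMeasure x₀ (R - t))).toReal ≤ N t) {r S : ℝ} (hr : r < R - T)
    (hS : (eLpNorm (conv k (w 0)) 2 (ballMeasure x₀ R)).toReal +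
      (eLpNorm (conv k (v 0)) 2 (ballMeasure x₀ R)).toReal +
      (eLpNorm (conv k (D 0)) 2 (ballMeasure x₀ R)).toReal ≤ S) :
    (eLpNorm (conv k (w T)) 2 (ballMeasure x₀ r)).toReal ≤ S + 2 * ∫ t in Ioc 0 T, N t ∧
    (eLpNorm (conv k (v T)) 2 (ballMeasure x₀ r)).toReal ≤ S + 2 * ∫ t in Ioc 0 T, N t ∧
    (eLpNorm (conv k (D T)) 2 (ballMeasure x₀ r)).toReal ≤ S + 2 * ∫ t in Ioc 0 T, N t := by
  -- With m = 1/δ the weight at time T equals 1 on the ball of radius r; max(r, 0) handles a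
  -- negative r.
  set δ := (R - T) ^ 2 - (max r 0) ^ 2 with hδ
  have hδ0 : 0 < δ := by
    have h1 : max r 0 < R - T := max_lt hr (by linarith)
    have h2 : (max r 0) ^ 2 < (R - T) ^ 2 := by
      gcongr
    linarith
  have hm : 0 ≤ 1 / δ := by positivity
  have h1 := h.smoothed_energy_le hγ hk hks hm hT hTR.le hN hN0 hGN
  simp_rw [sum_smoothedState_sq] at h1
  have hψ := isWeight_coneWeight (x₀ := x₀) hm hTR.le
  have h0T : (0 : ℝ) ∈ Icc 0 T := ⟨le_rfl, hT⟩
  have hTT : T ∈ Icc 0 T := ⟨hT, le_rfl⟩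
  have hw := fun t => (contDiff_conv hk hks (h.curve_fst.locallyIntegrable t)).continuous
  have hv := fun t => (contDiff_conv hk hks (h.curve_snd.locallyIntegrable t)).continuous
  have hD := fun t => (contDiff_conv hk hks (h.curve_grad.locallyIntegrable t)).continuous
  have pos : ∀ {F : Type} [NormedAddCommGroup F] (b : E3 → F) (t : ℝ), t ∈ Icc 0 T →
      0 ≤ ∫ x, coneWeight (1 / δ) R x₀ t x * ‖b x‖ ^ 2 := fun b t ht =>
    integral_nonneg fun x => mul_nonneg (hψ.nonneg t ht x) (by positivity)
  rw [integral_weighted_sum_sq (hψ.contDiff 0 h0T).continuous (hψ.hasCompactSupport h0T) (hw 0)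
    (hv 0) (hD 0), integral_weighted_sum_sq (hψ.contDiff T hTT).continuous
    (hψ.hasCompactSupport hTT) (hw T) (hv T) (hD T)] at h1
  have init : ∀ {F : Type} [NormedAddCommGroup F] (b : E3 → F), Continuous b →
      √(∫ x, coneWeight (1 / δ) R x₀ 0 x * ‖b x‖ ^ 2) ≤
        (eLpNorm b 2 (ballMeasure x₀ R)).toReal := fun b hb => by
    have := sqrt_integral_weight_le (r := R) (x₀ := x₀) (c := 1) (hψ.contDiff 0 h0T).continuous
      (hψ.hasCompactSupport h0T) hb zero_le_one
      (fun x => by rw [one_pow]; exact cutoff_le_one _ _)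
      (fun x hx => coneWeight_eq_zero hm (hT.trans hTR.le) (by simpa using hx))
    rwa [one_mul] at this
  have final : ∀ {F : Type} [NormedAddCommGroup F] (b : E3 → F), Continuous b →
      (eLpNorm b 2 (ballMeasure x₀ r)).toReal ≤
        √(∫ x, coneWeight (1 / δ) R x₀ T x * ‖b x‖ ^ 2) := fun b hb => by
    have := le_sqrt_integral_weight (r := r) (x₀ := x₀) (c := 1) (hψ.contDiff T hTT).continuous
      (hψ.hasCompactSupport hTT) (hψ.nonneg T hTT) hb (fun x hx => by
        rw [one_pow, coneWeight, cutoff_eq_one]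
        have h2 : ‖x - x₀‖ ^ 2 ≤ (max r 0) ^ 2 := by
          gcongr
          exact hx.le.trans (le_max_left _ _)
        rw [one_div, ← div_eq_inv_mul, one_le_div hδ0]
        linarith)
    rwa [one_mul] at this
  have h2 := (sqrt_add_add_le (pos (conv k (w 0)) 0 h0T) (pos (conv k (v 0)) 0 h0T)
    (pos (conv k (D 0)) 0 h0T)).trans (add_le_add_three (init _ (hw 0)) (init _ (hv 0))
      (init _ (hD 0)))
  have h3 := h1.trans (add_le_add_left (h2.trans hS) _)
  have p1 := pos (conv k (w T)) T hTT
  have p2 := pos (conv k (v T)) T hTT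
  have p3 := pos (conv k (D T)) T hTT
  exact ⟨((final _ (hw T)).trans (Real.sqrt_le_sqrt (by linarith))).trans h3,
    ((final _ (hv T)).trans (Real.sqrt_le_sqrt (by linarith))).trans h3,
    ((final _ (hD T)).trans (Real.sqrt_le_sqrt (by linarith))).trans h3⟩

end IntegratedWave

theorem MemLpLoc.cone_lintegral_ne_top {G : ℝ → E3 → ℝ} (hG : MemLpLoc 1 2 G) (x₀ : E3) (R T : ℝ) :
    ∫⁻ t in Ioc 0 T, eLpNorm (G t) 2 (ballMeasure x₀ (R - t)) ≠ ⊤ := by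
  rw [← restrict_Ioo_eq_restrict_Ioc]
  refine ne_top_of_le_ne_top (hG.lintegral_lt_top T (‖x₀‖ + R)).ne ?_
  refine setLIntegral_mono' measurableSet_Ioo fun t ht => eLpNorm_mono_measure _ ?_
  refine ballMeasure_mono ?_
  have := ht.1
  rw [dist_zero_right]
  linarith

theorem MemLpLoc.cone_aemeasurable {G : ℝ → E3 → ℝ} (hG : MemLpLoc 1 2 G) (x₀ : E3) (R T : ℝ) :
    AEMeasurable (fun t => eLpNorm (G t) 2 (ballMeasure x₀ (R - t)))
      (volume.restrict (Ioc 0 T)) :=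
  (hG.aemeasurable_eLpNorm two_ne_zero ENNReal.ofNat_ne_top x₀ (fun t => R - t)
    (by fun_prop)).mono_measure (Measure.restrict_mono Ioc_subset_Ioi_self le_rfl)

theorem tendsto_sub_const_div (r c : ℝ) :
    Tendsto (fun n : ℕ => r - c * (1 / ((n : ℝ) + 1))) atTop (𝓝 r) := by
  simpa using tendsto_const_nhds.sub ((tendsto_one_div_add_atTop_nhds_zero_nat (𝕜 := ℝ)).const_mul c)

theorem eventually_lt_sub_one_div {T R : ℝ} (h : T < R) :
    ∀ᶠ n : ℕ in atTop, T < R - 1 / ((n : ℝ) + 1) := by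
  have := tendsto_sub_const_div R 1
  simp only [one_mul] at this
  exact this.eventually_const_lt h

theorem eLpNorm_le_ofReal_of_continuous {F : Type*} [NormedAddCommGroup F] {b : E3 → F}
    (hb : Continuous b) {x₀ : E3} {r c : ℝ} (h : (eLpNorm b 2 (ballMeasure x₀ r)).toReal ≤ c) :
    eLpNorm b 2 (ballMeasure x₀ r) ≤ ENNReal.ofReal c := by
  rw [← ENNReal.ofReal_toReal (memLp_ballMeasure_of_continuous hb x₀ r).eLpNorm_ne_top]
  exact ENNReal.ofReal_le_ofReal h

theorem toReal_eLpNorm_mollify_le {F : Type*} [NormedAddCommGroup F] [NormedSpace ℝ F]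
    (n : ℕ) {a : E3 → F} (ha : AEStronglyMeasurable a volume)
    {x₀ : E3} {r s : ℝ} (hf : eLpNorm a 2 (ballMeasure x₀ r) ≠ ⊤)
    (hs : s = r - 1 / ((n : ℝ) + 1)) :
    (eLpNorm (conv (mollifier n) a) 2 (ballMeasure x₀ s)).toReal ≤
      (eLpNorm a 2 (ballMeasure x₀ r)).toReal := by
  rw [hs]
  exact ENNReal.toReal_mono hf (eLpNorm_mollify_le n ha x₀ r)

/-- Energy inequality in the cone for the unsmoothed curve: the smoothed inequality is used on the
cone with base radius R - 1/(n+1), where mollified norms are bounded by the original ones on the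
full cone, and then n → ∞. Each of the three norms is bounded separately by the full right side. -/
theorem IntegratedWave.eLpNorm_le {γ : ℝ} {w v G : ℝ → E3 → ℝ} {D : ℝ → E3 → E3} {T R : ℝ}
    (h : IntegratedWave γ w v D G) (hγ : 0 ≤ γ) (x₀ : E3) (hT : 0 ≤ T) (hTR : T < R) {E : ℝ≥0∞}
    (hE : eLpNorm (w 0) 2 (ballMeasure x₀ R) + eLpNorm (v 0) 2 (ballMeasure x₀ R) +
        eLpNorm (D 0) 2 (ballMeasure x₀ R) +
        2 * ∫⁻ t in Ioc 0 T, eLpNorm (G t) 2 (ballMeasure x₀ (R - t)) ≤ E) :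
    eLpNorm (w T) 2 (ballMeasure x₀ (R - T)) ≤ E ∧
    eLpNorm (v T) 2 (ballMeasure x₀ (R - T)) ≤ E ∧
    eLpNorm (D T) 2 (ballMeasure x₀ (R - T)) ≤ E := by
  set N : ℝ → ℝ := fun t => (eLpNorm (G t) 2 (ballMeasure x₀ (R - t))).toReal with hN
  have hm := h.force.cone_aemeasurable x₀ R T
  have hfin := h.force.cone_lintegral_ne_top x₀ R T
  have hNi : IntegrableOn N (Ioc 0 T) := integrable_toReal_of_lintegral_ne_top hm hfin
  have hL : ∫ t in Ioc 0 T, N t =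
      (∫⁻ t in Ioc 0 T, eLpNorm (G t) 2 (ballMeasure x₀ (R - t))).toReal :=
    integral_toReal hm (ae_lt_top' hm hfin)
  have hw := (h.curve_fst.memLp_ball 0 x₀ R).eLpNorm_ne_top
  have hv := (h.curve_snd.memLp_ball 0 x₀ R).eLpNorm_ne_top
  have hD := (h.curve_grad.memLp_ball 0 x₀ R).eLpNorm_ne_top
  set S : ℝ := (eLpNorm (w 0) 2 (ballMeasure x₀ R)).toReal +
    (eLpNorm (v 0) 2 (ballMeasure x₀ R)).toReal + (eLpNorm (D 0) 2 (ballMeasure x₀ R)).toReal with hS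
  have hSE : ENNReal.ofReal (S + 2 * ∫ t in Ioc 0 T, N t) ≤ E := by
    refine le_trans (le_of_eq ?_) hE
    rw [hL, ENNReal.ofReal_add (by positivity) (by positivity), hS,
      ENNReal.ofReal_add (by positivity) (by positivity),
      ENNReal.ofReal_add (by positivity) (by positivity), ENNReal.ofReal_mul zero_le_two,
      ENNReal.ofReal_toReal hw, ENNReal.ofReal_toReal hv, ENNReal.ofReal_toReal hD,
      ENNReal.ofReal_toReal hfin, ENNReal.ofReal_ofNat]
  -- One 1/(n+1) is lost to mollification, the other because the weight equals 1 only on a ball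
  -- strictly inside the slice.
  have key : ∀ᶠ n : ℕ in atTop,
      ((eLpNorm (conv (mollifier n) (w T)) 2
        (ballMeasure x₀ (R - T - 2 * (1 / ((n : ℝ) + 1))))).toReal ≤ S + 2 * ∫ t in Ioc 0 T, N t) ∧
      ((eLpNorm (conv (mollifier n) (v T)) 2
        (ballMeasure x₀ (R - T - 2 * (1 / ((n : ℝ) + 1))))).toReal ≤ S + 2 * ∫ t in Ioc 0 T, N t) ∧
      ((eLpNorm (conv (mollifier n) (D T)) 2
        (ballMeasure x₀ (R - T - 2 * (1 / ((n : ℝ) + 1))))).toReal ≤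
          S + 2 * ∫ t in Ioc 0 T, N t) := by
    filter_upwards [eventually_lt_sub_one_div hTR] with n hn
    have hpos : 0 < 1 / ((n : ℝ) + 1) := by positivity
    refine h.smoothed_norm_le (R := R - 1 / ((n : ℝ) + 1)) hγ (mollifier_contDiff n)
      (mollifier_hasCompactSupport n) hT hn hNi (fun t => ENNReal.toReal_nonneg) ?_
      (by linarith) ?_
    · filter_upwards [ae_lt_top' hm hfin, ae_mono (Measure.restrict_mono Ioc_subset_Ioi_self le_rfl)
        h.force.ae_aestronglyMeasurable] with t ht htm
      exact toReal_eLpNorm_mollify_le n htm ht.ne (by ring)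
    · exact add_le_add_three
        (toReal_eLpNorm_mollify_le n (h.curve_fst.aestronglyMeasurable 0) hw rfl)
        (toReal_eLpNorm_mollify_le n (h.curve_snd.aestronglyMeasurable 0) hv rfl)
        (toReal_eLpNorm_mollify_le n (h.curve_grad.aestronglyMeasurable 0) hD rfl)
  have hρ := tendsto_sub_const_div (R - T) 2
  have cont : ∀ {F : Type} [NormedAddCommGroup F] [NormedSpace ℝ F] [CompleteSpace F]
      {a : E3 → F}, LocallyIntegrable a volume → ∀ n, Continuous (conv (mollifier n) a) :=
    fun ha n => (contDiff_conv (mollifier_contDiff n) (mollifier_hasCompactSupport n) ha).continuous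
  have lw := h.curve_fst.locallyIntegrable T
  have lv := h.curve_snd.locallyIntegrable T
  have lD := h.curve_grad.locallyIntegrable T
  exact ⟨eLpNorm_le_of_mollify_le lw hρ tendsto_const_nhds (key.mono fun n hn =>
      (eLpNorm_le_ofReal_of_continuous (cont lw n) hn.1).trans hSE),
    eLpNorm_le_of_mollify_le lv hρ tendsto_const_nhds (key.mono fun n hn =>
      (eLpNorm_le_ofReal_of_continuous (cont lv n) hn.2.1).trans hSE),
    eLpNorm_le_of_mollify_le lD hρ tendsto_const_nhds (key.mono fun n hn =>
      (eLpNorm_le_ofReal_of_continuous (cont lD n) hn.2.2).trans hSE)⟩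

/-! ### Smallness of the L² norm of w near the tip of the cone -/

section MomentWeight

variable {m R T t : ℝ} {x₀ : E3}

/-- The weight `(R - t)⁻³` cut off to the backward cone with base `B^R_{x₀}`. -/
noncomputable def momentWeight (m R : ℝ) (x₀ : E3) (t : ℝ) (x : E3) : ℝ :=
  ((R - t) ^ 3)⁻¹ * cutoff m (1 - ‖x - x₀‖ ^ 2 * ((R - t) ^ 2)⁻¹)

/-- The time derivative of `momentWeight`. -/
noncomputable def momentWeightDeriv (m R : ℝ) (x₀ : E3) (t : ℝ) (x : E3) : ℝ :=
  3 * ((R - t) ^ 4)⁻¹ * cutoff m (1 - ‖x - x₀‖ ^ 2 * ((R - t) ^ 2)⁻¹) -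
    2 * ((R - t) ^ 6)⁻¹ * ‖x - x₀‖ ^ 2 *
      deriv (cutoff m) (1 - ‖x - x₀‖ ^ 2 * ((R - t) ^ 2)⁻¹)

theorem one_sub_norm_sq_nonpos (ht : t < R) {x : E3} (hx : R - t ≤ ‖x - x₀‖) :
    1 - ‖x - x₀‖ ^ 2 * ((R - t) ^ 2)⁻¹ ≤ 0 := by
  have h0 : 0 < R - t := sub_pos.2 ht
  have h1 : (R - t) ^ 2 ≤ ‖x - x₀‖ ^ 2 := by gcongr
  rw [sub_nonpos, ← div_eq_mul_inv, one_le_div (by positivity)]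
  exact h1

theorem momentWeight_eq_zero (hm : 0 ≤ m) (ht : t < R) {x : E3} (hx : R - t ≤ ‖x - x₀‖) :
    momentWeight m R x₀ t x = 0 := by
  rw [momentWeight, cutoff_eq_zero hm (one_sub_norm_sq_nonpos ht hx), mul_zero]

theorem momentWeightDeriv_eq_zero (hm : 0 ≤ m) (ht : t < R) {x : E3} (hx : R - t ≤ ‖x - x₀‖) :
    momentWeightDeriv m R x₀ t x = 0 := by
  rw [momentWeightDeriv, cutoff_eq_zero hm (one_sub_norm_sq_nonpos ht hx),
    deriv_cutoff_eq_zero hm (one_sub_norm_sq_nonpos ht hx)]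
  ring

theorem momentWeight_nonneg (ht : t ≤ R) (x : E3) : 0 ≤ momentWeight m R x₀ t x := by
  have : 0 ≤ R - t := sub_nonneg.2 ht
  exact mul_nonneg (by positivity) (cutoff_nonneg _ _)

theorem momentWeight_le (ht : t ≤ R) (x : E3) :
    momentWeight m R x₀ t x ≤ ((√(R - t) ^ 3)⁻¹) ^ 2 := by
  have h0 : 0 ≤ R - t := sub_nonneg.2 ht
  have h1 : ((√(R - t) ^ 3)⁻¹) ^ 2 = ((R - t) ^ 3)⁻¹ := by
    rw [inv_pow, ← pow_mul, mul_comm, pow_mul, Real.sq_sqrt h0]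
  rw [h1]
  exact mul_le_of_le_one_right (by positivity) (cutoff_le_one _ _)

theorem contDiff_momentWeight (m R : ℝ) (x₀ : E3) (t : ℝ) :
    ContDiff ℝ 1 (momentWeight m R x₀ t) := by
  refine contDiff_const.mul (((contDiff_cutoff m).of_le (by simp)).comp
    (contDiff_const.sub (ContDiff.mul ?_ contDiff_const)))
  exact (contDiff_id.sub contDiff_const).norm_sq ℝ

theorem isWeight_momentWeight (hm : 0 ≤ m) (hT : T < R) :
    IsWeight T (‖x₀‖ + R) (momentWeight m R x₀) (momentWeightDeriv m R x₀) := by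
  have hne : ∀ t ∈ Icc 0 T, R - t ≠ 0 := fun t ht => by linarith [ht.2]
  have hinv : ∀ j : ℕ, ContinuousOn (fun z : ℝ × E3 => ((R - z.1) ^ j)⁻¹) (Icc 0 T ×ˢ univ) :=
    fun j => ContinuousOn.inv₀ (by fun_prop) fun z hz => pow_ne_zero _ (hne _ hz.1)
  have hs : ContinuousOn (fun z : ℝ × E3 => 1 - ‖z.2 - x₀‖ ^ 2 * ((R - z.1) ^ 2)⁻¹)
      (Icc 0 T ×ˢ univ) := continuousOn_const.sub (ContinuousOn.mul (by fun_prop) (hinv 2))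
  have hc := (contDiff_cutoff m).continuous.comp_continuousOn hs
  have hc' := (continuous_deriv_cutoff m).comp_continuousOn hs
  refine ⟨(hinv 3).mul hc, ?_, fun t ht x => ?_, fun t ht x => momentWeight_nonneg
    (ht.2.trans hT.le) x, fun t _ => contDiff_momentWeight m R x₀ t,
    fun t ht x hx => momentWeight_eq_zero hm (ht.2.trans_lt hT) (sub_le_norm_sub ht.1 hx),
    fun t ht x hx => momentWeightDeriv_eq_zero hm (ht.2.trans_lt hT) (sub_le_norm_sub ht.1 hx)⟩
  · exact ((continuousOn_const.mul (hinv 4)).mul hc).sub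
      (((continuousOn_const.mul (hinv 6)).mul (by fun_prop)).mul hc')
  · have hr : HasDerivAt (fun t => R - t) (-1) t := (hasDerivAt_id t).const_sub R
    have h0 := hne t ht
    have h3 := (hr.fun_pow 3).fun_inv (pow_ne_zero 3 h0)
    have h2 := (((hr.fun_pow 2).fun_inv (pow_ne_zero 2 h0)).const_mul (‖x - x₀‖ ^ 2)).const_sub 1
    have h4 := h3.fun_mul ((hasDerivAt_cutoff m _).comp t h2)
    refine h4.congr_deriv ?_
    rw [momentWeightDeriv]
    simp only [Function.comp_apply]
    generalize cutoff m (1 - ‖x - x₀‖ ^ 2 * ((R - t) ^ 2)⁻¹) = c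
    generalize deriv (cutoff m) (1 - ‖x - x₀‖ ^ 2 * ((R - t) ^ 2)⁻¹) = d
    push_cast
    field_simp
    ring

theorem sum_sq_coord_mul (y : E3) : ∑ i, y i * y i = ‖y‖ ^ 2 := by
  rw [EuclideanSpace.real_norm_sq_eq]
  exact Finset.sum_congr rfl fun i _ => by ring

/-- The weight is r^{-3}χ((x - x₀)/r) with r = R - t: a fixed profile carried, with constant mass,
by the contraction of velocity -(x - x₀)/r. The identity is the continuity equation of that flow. -/
theorem momentWeightDeriv_eq_divergence (ht : t < R) (x : E3) :
    momentWeightDeriv m R x₀ t x = ∑ i, fderiv ℝ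
      (fun x => momentWeight m R x₀ t x * ((R - t)⁻¹ • (x - x₀)) i) x (basisVec i) := by
  have h0 : R - t ≠ 0 := by linarith
  have hp : HasFDerivAt (momentWeight m R x₀ t) (((R - t) ^ 3)⁻¹ •
      (deriv (cutoff m) (1 - ‖x - x₀‖ ^ 2 * ((R - t) ^ 2)⁻¹) •
        -(((R - t) ^ 2)⁻¹ • ((2 : ℕ) • (innerSL ℝ (x - x₀) : E3 →L[ℝ] ℝ))))) x :=
    ((hasDerivAt_cutoff m _).comp_hasFDerivAt x
      (((hasFDerivAt_norm_sub_sq x₀ x).mul_const _).const_sub 1)).const_mul _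
  have hb : ∀ i : Fin 3, HasFDerivAt (fun x : E3 => ((R - t)⁻¹ • (x - x₀)) i)
      ((R - t)⁻¹ • (EuclideanSpace.proj i : E3 →L[ℝ] ℝ)) x := fun i =>
    (((EuclideanSpace.proj i : E3 →L[ℝ] ℝ).hasFDerivAt (x := x)).sub_const (x₀ i)).const_mul _
  have hterm : ∀ i : Fin 3, fderiv ℝ
      (fun x => momentWeight m R x₀ t x * ((R - t)⁻¹ • (x - x₀)) i) x (basisVec i) =
      momentWeight m R x₀ t x * (R - t)⁻¹ - 2 * ((R - t) ^ 6)⁻¹ *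
        deriv (cutoff m) (1 - ‖x - x₀‖ ^ 2 * ((R - t) ^ 2)⁻¹) * ((x - x₀) i * (x - x₀) i) := by
    intro i
    rw [(hp.fun_mul (hb i)).fderiv]
    generalize deriv (cutoff m) (1 - ‖x - x₀‖ ^ 2 * ((R - t) ^ 2)⁻¹) = d
    simp [EuclideanSpace.inner_single_right]
    field_simp
    ring
  simp_rw [hterm]
  rw [Finset.sum_sub_distrib,
    ← Finset.mul_sum Finset.univ (fun i => (x - x₀) i * (x - x₀) i), sum_sq_coord_mul,
    momentWeightDeriv, momentWeight]
  simp only [Finset.sum_const, Finset.card_univ, Fintype.card_fin]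
  generalize deriv (cutoff m) (1 - ‖x - x₀‖ ^ 2 * ((R - t) ^ 2)⁻¹) = d
  generalize cutoff m (1 - ‖x - x₀‖ ^ 2 * ((R - t) ^ 2)⁻¹) = c
  rw [nsmul_eq_mul]
  push_cast
  field_simp

end MomentWeight

theorem integral_inv_sqrt_cube_le {T R : ℝ} (hT : 0 ≤ T) (hTR : T < R) :
    IntegrableOn (fun t => (√(R - t) ^ 3)⁻¹) (Ioc 0 T) ∧
      ∫ t in Ioc 0 T, (√(R - t) ^ 3)⁻¹ ≤ 2 * (√(R - T))⁻¹ := by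
  have hpos : ∀ t ∈ Icc 0 T, 0 < √(R - t) := fun t ht => Real.sqrt_pos.2 (by linarith [ht.2])
  have hcont : ContinuousOn (fun t => (√(R - t) ^ 3)⁻¹) (Icc 0 T) :=
    ContinuousOn.inv₀ (by fun_prop) fun t ht => pow_ne_zero _ (hpos t ht).ne'
  refine ⟨(hcont.integrableOn_Icc).mono_set Ioc_subset_Icc_self, ?_⟩
  have hd : ∀ t ∈ uIcc 0 T, HasDerivAt (fun t => 2 * (√(R - t))⁻¹) ((√(R - t) ^ 3)⁻¹) t := by
    intro t ht
    rw [uIcc_of_le hT] at ht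
    have h0 := hpos t ht
    have hr : HasDerivAt (fun t => R - t) (-1) t := (hasDerivAt_id t).const_sub R
    refine (((hr.sqrt (by linarith [ht.2])).fun_inv h0.ne').const_mul 2).congr_deriv ?_
    field_simp
  rw [← intervalIntegral.integral_of_le hT, intervalIntegral.integral_eq_sub_of_hasDerivAt hd
    (ContinuousOn.intervalIntegrable (by rwa [uIcc_of_le hT]))]
  have := hpos 0 ⟨le_rfl, hT⟩
  have : 0 ≤ 2 * (√(R - 0))⁻¹ := by positivity
  linarith

theorem toReal_eLpNorm_abs_add_norm_le {μ : Measure E3} {V : E3 → ℝ} {X : E3 → E3}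
    (hV : MemLp V 2 μ) (hX : MemLp X 2 μ) :
    (eLpNorm (fun x => |V x| + ‖X x‖) 2 μ).toReal ≤
      (eLpNorm V 2 μ).toReal + (eLpNorm X 2 μ).toReal := by
  rw [← ENNReal.toReal_add hV.eLpNorm_ne_top hX.eLpNorm_ne_top]
  refine ENNReal.toReal_mono (ENNReal.add_ne_top.2 ⟨hV.eLpNorm_ne_top, hX.eLpNorm_ne_top⟩) ?_
  have h := eLpNorm_add_le hV.norm.aestronglyMeasurable hX.norm.aestronglyMeasurable one_le_two
  simp only [eLpNorm_norm] at h
  exact h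

namespace IntegratedWave

variable {γ : ℝ} {w v G : ℝ → E3 → ℝ} {D : ℝ → E3 → E3} {k : E3 → ℝ} {T R : ℝ} {x₀ : E3}

/-- Under the square root, the weight contributes (R - t)^{-3/2} to the L² norms of ∂ₜw and ∇w,
which are at most S in total. Integration in time gives 2(R - T)^{-1/2}, and the factor 2 of
`sqrt_weighted_le` makes this 4. -/
theorem smoothed_moment_le (h : IntegratedWave γ w v D G) (hk : ContDiff ℝ ∞ k)
    (hks : HasCompactSupport k) {m : ℝ} (hm : 0 ≤ m) (hT : 0 ≤ T) (hTR : T < R) {S : ℝ}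
    (hS : ∀ t ∈ Icc 0 T, (eLpNorm (conv k (v t)) 2 (ballMeasure x₀ (R - t))).toReal +
      (eLpNorm (conv k (D t)) 2 (ballMeasure x₀ (R - t))).toReal ≤ S) :
    √(∫ x, momentWeight m R x₀ T x * conv k (w T) x ^ 2) ≤
      √(∫ x, momentWeight m R x₀ 0 x * conv k (w 0) x ^ 2) + 4 * S * (√(R - T))⁻¹ := by
  have hψ := isWeight_momentWeight (x₀ := x₀) hm hTR
  have hS0 : 0 ≤ S := (add_nonneg ENNReal.toReal_nonneg ENNReal.toReal_nonneg).trans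
    (hS 0 ⟨le_rfl, hT⟩)
  obtain ⟨hi, hile⟩ := integral_inv_sqrt_cube_le hT hTR
  have h1 := sqrt_weighted_le (ι := Unit) (A := fun _ t => conv k (w t))
    (B := fun _ t => conv k (v t)) (N := fun t => (√(R - t) ^ 3)⁻¹ * S) hT hψ
    (fun _ => h.isPrimitive_fst hk hks) (hi.mul_const S) (fun t => by positivity) ?_
  · simp only [Finset.univ_unique, Finset.sum_const, Finset.card_singleton, one_smul] at h1
    rw [integral_mul_const] at h1
    have h2 := mul_le_mul_of_nonneg_right hile hS0
    linarith
  · filter_upwards [ae_restrict_mem measurableSet_Ioc] with t ht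
    have htT : t ∈ Icc 0 T := ⟨ht.1.le, ht.2⟩
    have htR : t < R := ht.2.trans_lt hTR
    have hp := hψ.contDiff t htT
    have hps := hψ.hasCompactSupport htT
    have hp0 := hψ.nonneg t htT
    have hW := contDiff_conv hk hks (h.curve_fst.locallyIntegrable t)
    have hV := (contDiff_conv hk hks (h.curve_snd.locallyIntegrable t)).continuous
    have hX := (contDiff_conv hk hks (h.curve_grad.locallyIntegrable t)).continuous
    have h2 := integral_moment_rate_le (b := fun x => (R - t)⁻¹ • (x - x₀)) hp hps hp0
      ((contDiff_id.sub contDiff_const).const_smul _) (fun x hx => by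
        have h0 : 0 < R - t := sub_pos.2 htR
        rw [norm_smul, norm_inv, Real.norm_of_nonneg h0.le, inv_mul_le_one₀ h0]
        by_contra hcon
        push Not at hcon
        exact hx (momentWeight_eq_zero hm htR hcon.le))
      (momentWeightDeriv_eq_divergence htR) (hW.of_le (by simp)) (h.conv_grad_apply hk hks t) hV hX
    simp only [weightedRate, Finset.univ_unique, Finset.sum_const, Finset.card_singleton, one_smul]
    refine h2.trans ?_
    rw [mul_assoc]
    refine mul_le_mul_of_nonneg_left ?_ zero_le_two
    have hVX : Continuous fun x => |conv k (v t) x| + ‖conv k (D t) x‖ := hV.abs.add hX.norm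
    refine (integral_weighted_mul_le hp.continuous hps hp0 hW.continuous hVX).trans ?_
    refine mul_le_mul_of_nonneg_left ?_ (Real.sqrt_nonneg _)
    have h3 := sqrt_integral_weight_le (r := R - t) (x₀ := x₀) (c := (√(R - t) ^ 3)⁻¹)
      hp.continuous hps hVX (by positivity) (momentWeight_le htR.le)
      (fun x hx => momentWeight_eq_zero hm htR hx)
    simp only [Real.norm_eq_abs, sq_abs] at h3
    refine h3.trans (mul_le_mul_of_nonneg_left ?_ (by positivity))
    exact (toReal_eLpNorm_abs_add_norm_le (memLp_ballMeasure_of_continuous hV _ _)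
      (memLp_ballMeasure_of_continuous hX _ _)).trans (hS t htT)

theorem smoothed_moment_norm_le (h : IntegratedWave γ w v D G) (hk : ContDiff ℝ ∞ k)
    (hks : HasCompactSupport k) (hT : 0 ≤ T) (hTR : T < R) {S : ℝ}
    (hS : ∀ t ∈ Icc 0 T, (eLpNorm (conv k (v t)) 2 (ballMeasure x₀ (R - t))).toReal +
      (eLpNorm (conv k (D t)) 2 (ballMeasure x₀ (R - t))).toReal ≤ S) {r : ℝ} (hr : r < R - T) :
    (eLpNorm (conv k (w T)) 2 (ballMeasure x₀ r)).toReal ≤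
      (R - T) * ((eLpNorm (conv k (w 0)) 2 (ballMeasure x₀ R)).toReal / R + 4 * S) := by
  have hRT : 0 < R - T := sub_pos.2 hTR
  have hR : 0 < R := hT.trans_lt hTR
  set δ := 1 - (max r 0) ^ 2 * ((R - T) ^ 2)⁻¹ with hδ
  have hδ0 : 0 < δ := by
    have h1 : max r 0 < R - T := max_lt hr hRT
    have h2 : (max r 0) ^ 2 < (R - T) ^ 2 := by gcongr
    rw [hδ, sub_pos, ← div_eq_mul_inv, div_lt_one (by positivity)]
    exact h2
  have hm : 0 ≤ 1 / δ := by positivity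
  have h1 := h.smoothed_moment_le hk hks hm hT hTR hS
  have hψ := isWeight_momentWeight (x₀ := x₀) hm hTR
  have h0T : (0 : ℝ) ∈ Icc 0 T := ⟨le_rfl, hT⟩
  have hTT : T ∈ Icc 0 T := ⟨hT, le_rfl⟩
  have hw := fun t => (contDiff_conv hk hks (h.curve_fst.locallyIntegrable t)).continuous
  have init := sqrt_integral_weight_le (r := R - 0) (x₀ := x₀) (c := (√(R - 0) ^ 3)⁻¹)
    (hψ.contDiff 0 h0T).continuous (hψ.hasCompactSupport h0T) (hw 0) (by positivity)
    (momentWeight_le hR.le) (fun x hx => momentWeight_eq_zero hm hR hx)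
  have final := le_sqrt_integral_weight (r := r) (x₀ := x₀) (c := (√(R - T) ^ 3)⁻¹)
    (hψ.contDiff T hTT).continuous (hψ.hasCompactSupport hTT) (hψ.nonneg T hTT) (hw T) (fun x hx => by
      have h2 : ‖x - x₀‖ ^ 2 ≤ (max r 0) ^ 2 := by
        gcongr
        exact hx.le.trans (le_max_left _ _)
      have h3 : ‖x - x₀‖ ^ 2 * ((R - T) ^ 2)⁻¹ ≤ (max r 0) ^ 2 * ((R - T) ^ 2)⁻¹ := by gcongr
      rw [momentWeight, cutoff_eq_one, mul_one, inv_pow, ← pow_mul, mul_comm, pow_mul,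
        Real.sq_sqrt hRT.le]
      rw [one_div, ← div_eq_inv_mul, one_le_div hδ0]
      linarith)
  simp only [Real.norm_eq_abs, sq_abs] at init final
  rw [sub_zero] at init
  have h2 := final.trans (h1.trans (add_le_add_left init _))
  -- The weight is undone by multiplying with (R - T)^{3/2}. The term in S becomes 4S(R - T); the
  -- initial term becomes (R - T)a/R times √((R - T)/R) ≤ 1.
  set a := (eLpNorm (conv k (w 0)) 2 (ballMeasure x₀ R)).toReal
  have ha : 0 ≤ a := ENNReal.toReal_nonneg
  have hs : 0 < √(R - T) := Real.sqrt_pos.2 hRT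
  have hsR : 0 < √R := Real.sqrt_pos.2 hR
  have hle : √(R - T) ≤ √R := Real.sqrt_le_sqrt (by linarith)
  have e1 := Real.sq_sqrt hRT.le
  have e2 := Real.sq_sqrt hR.le
  rw [inv_mul_le_iff₀ (by positivity)] at h2
  refine h2.trans ?_
  have h3 : √(R - T) ^ 3 * (4 * S * (√(R - T))⁻¹) = (R - T) * (4 * S) := by
    rw [← e1, Real.sqrt_sq hs.le]
    field_simp
  have h4 : √(R - T) ^ 3 * ((√R ^ 3)⁻¹ * a) ≤ (R - T) * (a / R) := by
    have h5 : √(R - T) ^ 3 * ((√R ^ 3)⁻¹ * a) = (√(R - T) / √R) * ((R - T) * (a / R)) := by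
      rw [show (R - T) * (a / R) = √(R - T) ^ 2 * (a / √R ^ 2) by rw [e1, e2]]
      field_simp
    rw [h5]
    exact mul_le_of_le_one_left (by positivity) ((div_le_one hsR).2 hle)
  rw [mul_add, mul_add, h3]
  linarith

/-- The factor R - T is the whole point: it compensates the inverse radius in the Sobolev inequality
on the slice, uniformly up to the tip. -/
theorem eLpNorm_fst_le (h : IntegratedWave γ w v D G) (x₀ : E3) (hT : 0 ≤ T) (hTR : T < R)
    {S : ℝ≥0} (hS : ∀ t ∈ Icc 0 T, eLpNorm (v t) 2 (ballMeasure x₀ (R - t)) +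
      eLpNorm (D t) 2 (ballMeasure x₀ (R - t)) ≤ S) :
    eLpNorm (w T) 2 (ballMeasure x₀ (R - T)) ≤ ENNReal.ofReal (R - T) *
      (eLpNorm (w 0) 2 (ballMeasure x₀ R) / ENNReal.ofReal R + 4 * S) := by
  have hRT : 0 < R - T := sub_pos.2 hTR
  have hR : 0 < R := hT.trans_lt hTR
  have hw := (h.curve_fst.memLp_ball 0 x₀ R).eLpNorm_ne_top
  set a := (eLpNorm (w 0) 2 (ballMeasure x₀ R)).toReal with ha
  have hconst : ENNReal.ofReal ((R - T) * (a / R + 4 * S)) = ENNReal.ofReal (R - T) *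
      (eLpNorm (w 0) 2 (ballMeasure x₀ R) / ENNReal.ofReal R + 4 * S) := by
    rw [ENNReal.ofReal_mul hRT.le, ENNReal.ofReal_add (by positivity) (by positivity),
      ENNReal.ofReal_div_of_pos hR, ha, ENNReal.ofReal_toReal hw, ENNReal.ofReal_mul (by norm_num),
      ENNReal.ofReal_coe_nnreal, ENNReal.ofReal_ofNat]
  rw [← hconst]
  refine eLpNorm_le_of_mollify_le (h.curve_fst.locallyIntegrable T)
    (tendsto_sub_const_div (R - T) 2) tendsto_const_nhds ?_
  filter_upwards [eventually_lt_sub_one_div hTR] with n hn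
  have hpos : 0 < 1 / ((n : ℝ) + 1) := by positivity
  refine eLpNorm_le_ofReal_of_continuous (contDiff_conv (mollifier_contDiff n)
    (mollifier_hasCompactSupport n) (h.curve_fst.locallyIntegrable T)).continuous ?_
  refine (h.smoothed_moment_norm_le (R := R - 1 / ((n : ℝ) + 1)) (S := S) (mollifier_contDiff n)
    (mollifier_hasCompactSupport n) hT hn (fun t ht => ?_) (by linarith)).trans ?_
  · have hv := (h.curve_snd.memLp_ball t x₀ (R - t)).eLpNorm_ne_top
    have hD := (h.curve_grad.memLp_ball t x₀ (R - t)).eLpNorm_ne_top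
    refine (add_le_add
      (toReal_eLpNorm_mollify_le n (h.curve_snd.aestronglyMeasurable t) hv (by ring))
      (toReal_eLpNorm_mollify_le n (h.curve_grad.aestronglyMeasurable t) hD (by ring))).trans ?_
    rw [← ENNReal.toReal_add hv hD]
    exact ENNReal.toReal_mono ENNReal.coe_ne_top (hS t ht)
  · have h1 : (eLpNorm (conv (mollifier n) (w 0)) 2
        (ballMeasure x₀ (R - 1 / ((n : ℝ) + 1)))).toReal ≤ a :=
      toReal_eLpNorm_mollify_le n (h.curve_fst.aestronglyMeasurable 0) hw rfl
    have hRn : 0 < R - 1 / ((n : ℝ) + 1) := hT.trans_lt hn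
    set ε := 1 / ((n : ℝ) + 1)
    have ha0 : 0 ≤ a := ENNReal.toReal_nonneg
    rw [mul_add, mul_add]
    refine add_le_add ?_ (by gcongr; linarith)
    rw [← mul_div_assoc, ← mul_div_assoc, div_le_div_iff₀ hRn hR]
    -- The ratio (R - T)/R decreases when R is lowered by ε, so the bound on the smaller cone
    -- implies the one with R.
    have h2 : (R - ε - T) * R ≤ (R - T) * (R - ε) := by nlinarith
    calc (R - ε - T) * _ * R ≤ (R - ε - T) * a * R := by
          have : 0 ≤ R - ε - T := by linarith
          gcongr
      _ = ((R - ε - T) * R) * a := by ring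
      _ ≤ ((R - T) * (R - ε)) * a := by gcongr
      _ = _ := by ring

end IntegratedWave

/-! ### Grönwall with an integrable kernel -/

/-- The primitive of κ is continuous, so it takes the value c at some time unless its total stays
below c. -/
theorem exists_lintegral_split {κ : ℝ → ℝ≥0∞} {T : ℝ} (hT : 0 ≤ T)
    (hκ : AEMeasurable κ (volume.restrict (Ioc 0 T))) {c d : ℝ≥0∞} (hc : c ≠ ⊤) (hd : d ≠ ⊤)
    (h : ∫⁻ t in Ioc 0 T, κ t ≤ c + d) :
    ∃ s ∈ Icc 0 T, ∫⁻ t in Ioc 0 s, κ t ≤ c ∧ ∫⁻ t in Ioc s T, κ t ≤ d := by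
  have hfin : ∫⁻ t in Ioc 0 T, κ t ≠ ⊤ := ne_top_of_le_ne_top (ENNReal.add_ne_top.2 ⟨hc, hd⟩) h
  rcases le_total (∫⁻ t in Ioc 0 T, κ t) c with hle | hle
  · exact ⟨T, ⟨hT, le_rfl⟩, hle, by simp⟩
  have hi : IntegrableOn (fun t => (κ t).toReal) (Ioc 0 T) :=
    integrable_toReal_of_lintegral_ne_top hκ hfin
  have hF : ∀ s ∈ Icc 0 T,
      ∫⁻ t in Ioc 0 s, κ t = ENNReal.ofReal (∫ t in Ioc 0 s, (κ t).toReal) := by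
    intro s hs
    have hsub : Ioc 0 s ⊆ Ioc 0 T := Ioc_subset_Ioc_right hs.2
    rw [ofReal_integral_eq_lintegral_ofReal (hi.mono_set hsub)
      (ae_of_all _ fun t => ENNReal.toReal_nonneg)]
    refine lintegral_congr_ae ?_
    filter_upwards [ae_mono (Measure.restrict_mono hsub le_rfl) (ae_lt_top' hκ hfin)] with t ht
    rw [ENNReal.ofReal_toReal ht.ne]
  have hcont : ContinuousOn (fun s => ∫⁻ t in Ioc 0 s, κ t) (Icc 0 T) := by
    have h1 : ContinuousOn (fun s => ∫ t in Ioc 0 s, (κ t).toReal) (Icc 0 T) :=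
      intervalIntegral.continuousOn_primitive (by rwa [integrableOn_Icc_iff_integrableOn_Ioc])
    exact (ENNReal.continuous_ofReal.comp_continuousOn h1).congr hF
  obtain ⟨s, hs, hsc⟩ := intermediate_value_Icc hT hcont ⟨by simp, hle⟩
  refine ⟨s, hs, hsc.le, ?_⟩
  simp only at hsc
  rw [← Ioc_union_Ioc_eq_Ioc hs.1 hs.2, lintegral_union measurableSet_Ioc
    (Ioc_disjoint_Ioc_of_le le_rfl), hsc] at h
  exact (ENNReal.add_le_add_iff_left hc).1 h

theorem setLIntegral_mul_monotone_le {κ y : ℝ → ℝ≥0∞} (hy : Monotone y) {s t : ℝ}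
    (hyt : y t ≠ ⊤) : ∫⁻ σ in Ioc s t, κ σ * y σ ≤ (∫⁻ σ in Ioc s t, κ σ) * y t := by
  rw [← lintegral_mul_const' _ _ hyt]
  exact setLIntegral_mono' measurableSet_Ioc fun σ hσ => mul_le_mul_right (hy hσ.2) _

/-- A Grönwall inequality for monotone functions and integrable kernels. -/
theorem exists_gronwall_bound (n : ℕ) : ∃ c : ℝ≥0, ∀ (y κ : ℝ → ℝ≥0∞) (a : ℝ≥0∞) (T : ℝ),
    Monotone y → y T ≠ ⊤ → 0 ≤ T → AEMeasurable κ (volume.restrict (Ioc 0 T)) →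
    ∫⁻ t in Ioc 0 T, κ t ≤ (n : ℝ≥0∞) / 2 →
    (∀ t ∈ Icc 0 T, y t ≤ a + ∫⁻ σ in Ioc 0 t, κ σ * y σ) → y T ≤ c * a := by
  induction n with
  | zero =>
    refine ⟨1, fun y κ a T hy hyT hT hκ hn h => ?_⟩
    have h1 := setLIntegral_mul_monotone_le (κ := κ) hy (s := 0) hyT
    have h2 : ∫⁻ t in Ioc 0 T, κ t = 0 := by simpa using hn
    rw [h2, zero_mul] at h1
    simpa [le_antisymm h1 zero_le] using h T ⟨hT, le_rfl⟩
  | succ n ih =>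
    obtain ⟨c, hc⟩ := ih
    -- The time interval is cut so that κ has mass at most n/2 on the first piece, handled by
    -- induction, and at most 1/2 on the last. There monotonicity bounds the integral by y(T)/2,
    -- which the left side absorbs because y(T) is finite; this doubles the constant.
    refine ⟨2 * (1 + n / 2 * c), fun y κ a T hy hyT hT hκ hn h => ?_⟩
    have hsplit : ((n + 1 : ℕ) : ℝ≥0∞) / 2 = (n : ℝ≥0∞) / 2 + 1 / 2 := by
      rw [ENNReal.div_add_div_same]
      push_cast
      rfl
    rw [hsplit] at hn
    obtain ⟨s, hs, hs1, hs2⟩ := exists_lintegral_split hT hκ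
      (ENNReal.div_ne_top (ENNReal.natCast_ne_top n) two_ne_zero)
      (ENNReal.div_ne_top ENNReal.one_ne_top two_ne_zero) hn
    have hys : y s ≠ ⊤ := ne_top_of_le_ne_top hyT (hy hs.2)
    have h1 := hc y κ a s hy hys hs.1
      (hκ.mono_measure (Measure.restrict_mono (Ioc_subset_Ioc_right hs.2) le_rfl)) hs1
      fun t ht => h t ⟨ht.1, ht.2.trans hs.2⟩
    have h2 : y T ≤ a + n / 2 * (c * a) + 1 / 2 * y T := by
      refine (h T ⟨hT, le_rfl⟩).trans ?_
      rw [← Ioc_union_Ioc_eq_Ioc hs.1 hs.2, add_assoc]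
      refine add_le_add_right ((lintegral_union_le _ _ _).trans (add_le_add ?_ ?_)) _
      · exact (setLIntegral_mul_monotone_le hy hys).trans (mul_le_mul' hs1 h1)
      · exact (setLIntegral_mul_monotone_le hy hyT).trans (mul_le_mul' hs2 le_rfl)
    have h3 : 1 / 2 * y T ≤ a + n / 2 * (c * a) := by
      have h4 : y T = 1 / 2 * y T + 1 / 2 * y T := by
        rw [← add_mul, ENNReal.add_halves, one_mul]
      have h5 : 1 / 2 * y T ≠ ⊤ :=
        ENNReal.mul_ne_top (ENNReal.div_ne_top ENNReal.one_ne_top two_ne_zero) hyT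
      refine (ENNReal.add_le_add_iff_right h5).1 ?_
      rwa [← h4]
    calc y T = 2 * (1 / 2 * y T) := by
          rw [← mul_assoc, one_div, ENNReal.mul_inv_cancel two_ne_zero ENNReal.ofNat_ne_top, one_mul]
      _ ≤ 2 * (a + n / 2 * (c * a)) := by gcongr
      _ = _ := by
        have : ((2 * (1 + n / 2 * c) : ℝ≥0) : ℝ≥0∞) = 2 * (1 + n / 2 * c) := by
          have h2 : (((n : ℝ≥0) / 2 : ℝ≥0) : ℝ≥0∞) = n / 2 := by
            rw [ENNReal.coe_div two_ne_zero]
            simp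
          rw [ENNReal.coe_mul, ENNReal.coe_add, ENNReal.coe_mul, h2]
          simp
        rw [this]
        ring

/-! ### The a priori bound on slices of the cone -/

/-- The sum of the `L²` norms of `w(t)`, `v(t)`, `D(t)` over the slice at time `t` of the backward
cone with base `B^R_{x₀}`. -/
noncomputable def sliceNorm (x₀ : E3) (R : ℝ) (w v : ℝ → E3 → ℝ) (D : ℝ → E3 → E3) (t : ℝ) :
    ℝ≥0∞ :=
  eLpNorm (w t) 2 (ballMeasure x₀ (R - t)) + eLpNorm (v t) 2 (ballMeasure x₀ (R - t)) +
    eLpNorm (D t) 2 (ballMeasure x₀ (R - t))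

theorem L2LocCurve.exists_slice_bound {F : Type*} [NormedAddCommGroup F] {a : ℝ → E3 → F}
    (h : L2LocCurve a) (x₀ : E3) (R T : ℝ) :
    ∃ M : ℝ≥0, ∀ t ∈ Icc 0 T, eLpNorm (a t) 2 (ballMeasure x₀ (R - t)) ≤ M := by
  obtain ⟨M, hM⟩ := h.bounded (‖x₀‖ + R) T
  refine ⟨M, fun t ht => (eLpNorm_mono_measure _ (ballMeasure_mono ?_)).trans (hM t ht)⟩
  rw [dist_zero_right]
  linarith [ht.1]

/-- The closed linear estimate: q plays the role of ‖u₁‖₁₂⁴ + ‖u₂‖₁₂⁴, of which only the integral is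
controlled. The energy inequality, the Sobolev inequality with the compensated radius, and Grönwall
are combined here; the constant is chosen before the curve and the final time. -/
theorem exists_sliceNorm_bound {γ : ℝ} (hγ : 0 ≤ γ) {R : ℝ} (hR : 0 < R) (C Q : ℝ≥0) :
    ∃ K : ℝ≥0, ∀ (w v : ℝ → E3 → ℝ) (D : ℝ → E3 → E3) (G : ℝ → E3 → ℝ) (x₀ : E3) (T : ℝ)
      (g q : ℝ → ℝ≥0∞), IntegratedWave γ w v D G → 0 ≤ T → T < R →
      AEMeasurable q (volume.restrict (Ioc 0 T)) → ∫⁻ t in Ioc 0 T, q t ≤ Q →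
      (∀ᵐ t ∂volume.restrict (Ioc 0 T), eLpNorm (G t) 2 (ballMeasure x₀ (R - t)) ≤ g t +
        C * (eLpNorm (w t) 2 (ballMeasure x₀ (R - t)) +
          q t * eLpNorm (w t) 6 (ballMeasure x₀ (R - t)))) →
      sliceNorm x₀ R w v D T ≤ K * (sliceNorm x₀ R w v D 0 + ∫⁻ t in Ioc 0 T, g t) := by
  obtain ⟨CS, hCS⟩ := sobolev_ball_weak
  -- In 5 = 1 + 4, the 1 comes from ∇w and the 4 from `eLpNorm_fst_le`; the inverse of R comes from
  -- the initial value of w in that lemma.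
  set c₆ : ℝ≥0 := CS * (5 + (Real.toNNReal R)⁻¹) with hc₆
  set L : ℝ≥0 := 6 * C * (Real.toNNReal R + c₆ * Q) with hL
  -- `L` bounds the mass of the Grönwall kernel over (0, T], so n/2 does too.
  obtain ⟨n, hn⟩ := exists_nat_ge (2 * L)
  obtain ⟨c, hc⟩ := exists_gronwall_bound n
  refine ⟨c * 6, fun w v D G x₀ T g q h hT hTR hq hqQ hG => ?_⟩
  set e : ℝ → ℝ≥0∞ := sliceNorm x₀ R w v D with he
  -- The running supremum is monotone, hence measurable without regularity of the slice norm in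
  -- time, and it is the supremum over earlier times that `eLpNorm_fst_le` requires.
  set y : ℝ → ℝ≥0∞ := fun t => ⨆ s ∈ Icc 0 t, e s with hy
  have hymono : Monotone y := fun s t hst =>
    biSup_mono fun σ hσ => ⟨hσ.1, hσ.2.trans hst⟩
  have hey : ∀ {s t}, s ∈ Icc 0 t → e s ≤ y t := fun {s t} hs =>
    le_iSup₂ (f := fun s (_ : s ∈ Icc 0 t) => e s) s hs
  have hyT : y T ≠ ⊤ := by
    obtain ⟨M₁, hM₁⟩ := h.curve_fst.exists_slice_bound x₀ R T
    obtain ⟨M₂, hM₂⟩ := h.curve_snd.exists_slice_bound x₀ R T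
    obtain ⟨M₃, hM₃⟩ := h.curve_grad.exists_slice_bound x₀ R T
    refine ne_top_of_le_ne_top (b := (M₁ : ℝ≥0∞) + M₂ + M₃) (by finiteness) ?_
    exact iSup₂_le fun s hs => add_le_add_three (hM₁ s hs) (hM₂ s hs) (hM₃ s hs)
  have hw_le : ∀ t, eLpNorm (w t) 2 (ballMeasure x₀ (R - t)) ≤ e t := fun t =>
    le_self_add.trans le_self_add
  have hD_le : ∀ t, eLpNorm (D t) 2 (ballMeasure x₀ (R - t)) ≤ e t := fun t => le_add_self
  have hvD_le : ∀ t, eLpNorm (v t) 2 (ballMeasure x₀ (R - t)) +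
      eLpNorm (D t) 2 (ballMeasure x₀ (R - t)) ≤ e t := fun t => by
    rw [he, sliceNorm, add_assoc]
    exact le_add_self
  have hsix : ∀ t ∈ Icc 0 T, eLpNorm (w t) 6 (ballMeasure x₀ (R - t)) ≤ c₆ * y t := by
    intro t ht
    have hRt : 0 < R - t := by linarith [ht.2]
    have hyt : y t ≠ ⊤ := ne_top_of_le_ne_top hyT (hymono ht.2)
    have htt : t ∈ Icc 0 t := ⟨ht.1, le_rfl⟩
    have h0t : (0 : ℝ) ∈ Icc 0 t := ⟨le_rfl, ht.1⟩
    have h1 := h.eLpNorm_fst_le x₀ ht.1 (by linarith : t < R) (S := (y t).toNNReal) (fun s hs => by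
      rw [ENNReal.coe_toNNReal hyt]
      exact (hvD_le s).trans (hey hs))
    rw [ENNReal.coe_toNNReal hyt] at h1
    have h0 : eLpNorm (w 0) 2 (ballMeasure x₀ R) ≤ y t := by
      have := (hw_le 0).trans (hey h0t)
      rwa [sub_zero] at this
    refine (hCS (w t) (D t) (h.grad t) x₀ (R - t) hRt).trans ?_
    have hinv : ((Real.toNNReal R)⁻¹ : ℝ≥0) = (ENNReal.ofReal R)⁻¹ := by
      rw [ENNReal.coe_inv (by simpa using hR)]
      rfl
    calc (CS : ℝ≥0∞) * (eLpNorm (D t) 2 (ballMeasure x₀ (R - t)) +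
          eLpNorm (w t) 2 (ballMeasure x₀ (R - t)) / ENNReal.ofReal (R - t))
        ≤ CS * (y t + (y t / ENNReal.ofReal R + 4 * y t)) := by
          gcongr
          · exact (hD_le t).trans (hey htt)
          · refine ENNReal.div_le_of_le_mul ?_
            rw [mul_comm]
            refine h1.trans ?_
            gcongr
      _ = c₆ * y t := by
          rw [hc₆]
          push_cast
          rw [hinv, ENNReal.div_eq_inv_mul]
          ring
  set κ : ℝ → ℝ≥0∞ := fun t => 6 * C * (1 + c₆ * q t) with hκ
  have hκm : AEMeasurable κ (volume.restrict (Ioc 0 T)) := by fun_prop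
  have hκL : ∫⁻ t in Ioc 0 T, κ t ≤ (n : ℝ≥0∞) / 2 := by
    have h1 : ∫⁻ t in Ioc 0 T, κ t ≤ L := by
      rw [hκ, lintegral_const_mul' _ _ (by finiteness), lintegral_add_left measurable_const,
        lintegral_const_mul' _ _ (by finiteness), hL]
      push_cast
      gcongr
      simp only [lintegral_const, one_mul, Measure.restrict_apply_univ, Real.volume_Ioc, sub_zero]
      exact ENNReal.ofReal_le_ofReal hTR.le
    refine h1.trans ?_
    rw [ENNReal.le_div_iff_mul_le (by simp) (by simp), mul_comm]
    exact_mod_cast hn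
  have hgron : ∀ t ∈ Icc 0 T, y t ≤
      (3 * e 0 + 6 * ∫⁻ t in Ioc 0 T, g t) + ∫⁻ σ in Ioc 0 t, κ σ * y σ := by
    intro t ht
    have hsub : Ioc 0 t ⊆ Ioc 0 T := Ioc_subset_Ioc_right ht.2
    have hG' : 6 * ∫⁻ σ in Ioc 0 t, eLpNorm (G σ) 2 (ballMeasure x₀ (R - σ)) ≤
        6 * (∫⁻ t in Ioc 0 T, g t) + ∫⁻ σ in Ioc 0 t, κ σ * y σ := by
      -- The bound g is not assumed measurable, so the integral of the sum is split using the
      -- measurability of the other term.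
      have hm : AEMeasurable (fun σ => κ σ * y σ) (volume.restrict (Ioc 0 t)) :=
        (hκm.mono_measure (Measure.restrict_mono hsub le_rfl)).mul hymono.measurable.aemeasurable
      rw [← lintegral_const_mul' _ _ (by finiteness)]
      calc ∫⁻ σ in Ioc 0 t, 6 * eLpNorm (G σ) 2 (ballMeasure x₀ (R - σ))
          ≤ ∫⁻ σ in Ioc 0 t, (6 * g σ + κ σ * y σ) := by
            refine lintegral_mono_ae ?_
            filter_upwards [ae_mono (Measure.restrict_mono hsub le_rfl) hG,
              ae_restrict_mem measurableSet_Ioc] with σ hσ hσt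
            have hσT : σ ∈ Icc 0 T := ⟨hσt.1.le, hσt.2.trans ht.2⟩
            calc 6 * eLpNorm (G σ) 2 (ballMeasure x₀ (R - σ))
                ≤ 6 * (g σ + C * (y σ + q σ * (c₆ * y σ))) := by
                  gcongr
                  refine hσ.trans ?_
                  gcongr
                  · exact (hw_le σ).trans (hey ⟨hσT.1, le_rfl⟩)
                  · exact hsix σ hσT
              _ = 6 * g σ + κ σ * y σ := by rw [hκ]; ring
        _ = (∫⁻ σ in Ioc 0 t, 6 * g σ) + ∫⁻ σ in Ioc 0 t, κ σ * y σ := lintegral_add_right' _ hm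
        _ ≤ _ := by
            rw [lintegral_const_mul' _ _ (by finiteness)]
            gcongr
    refine iSup₂_le fun s hs => ?_
    -- Three norms, each at most e(0) + 2∫‖G‖, give the factors 3 and 6.
    have h1 := h.eLpNorm_le hγ x₀ hs.1 (by linarith [hs.2, ht.2] : s < R) (E := e 0 +
      2 * ∫⁻ σ in Ioc 0 t, eLpNorm (G σ) 2 (ballMeasure x₀ (R - σ))) (by
        rw [he, sliceNorm, sub_zero]
        gcongr
        exact hs.2)
    calc e s ≤ _ := add_le_add_three h1.1 h1.2.1 h1.2.2
      _ = 3 * e 0 + 6 * ∫⁻ σ in Ioc 0 t, eLpNorm (G σ) 2 (ballMeasure x₀ (R - σ)) := by ring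
      _ ≤ 3 * e 0 + (6 * (∫⁻ t in Ioc 0 T, g t) + ∫⁻ σ in Ioc 0 t, κ σ * y σ) := by gcongr
      _ = _ := by ring
  have hfinal := hc y κ _ T hymono hyT hT hκm hκL hgron
  refine (hey ⟨hT, le_rfl⟩).trans (hfinal.trans ?_)
  push_cast
  rw [mul_assoc]
  gcongr
  rw [mul_add]
  gcongr
  norm_num

/-! ### Strichartz norms over cones and differences of two solutions -/

theorem coneStrichartzNorm_lintegral_le {x₀ : E3} {R : ℝ} {u : ℝ → E3 → ℝ} {M : ℝ≥0}
    (h : coneStrichartzNorm x₀ R u ≤ M) :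
    ∫⁻ s in Ioo 0 R, eLpNorm (u s) 12 (ballMeasure x₀ (R - s)) ^ 4 ≤ M ^ 4 := by
  rw [coneStrichartzNorm, eLpNorm_eq_lintegral_rpow_enorm_toReal (by norm_num) (by norm_num)] at h
  simp only [enorm_eq_self, ENNReal.toReal_ofNat] at h
  rw [one_div, ENNReal.rpow_inv_le_iff (by norm_num)] at h
  exact_mod_cast h

theorem coneStrichartzNorm_lt_top {u : ℝ → E3 → ℝ} (h : MemLpLoc 4 12 u) (R : ℝ) :
    coneStrichartzNorm 0 R u < ⊤ := by
  refine lt_of_le_of_lt (eLpNorm_mono_enorm_ae ?_) (h.norm_lt_top R R)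
  filter_upwards [ae_restrict_mem measurableSet_Ioo] with s hs
  simp only [enorm_eq_self]
  refine eLpNorm_mono_measure _ (ballMeasure_mono ?_)
  rw [dist_self]
  linarith [hs.1]

section Difference

variable {γ : ℝ} {f : ℝ → ℝ} {g₁ g₂ : ℝ → E3 → ℝ} {a₁ b₁ a₂ b₂ : E3 → ℝ} {u₁ v₁ u₂ v₂ : ℝ → E3 → ℝ}

theorem IsSSSolution.weakGradient_sub (h₁ : IsSSSolution γ f g₁ a₁ b₁ u₁ v₁)
    (h₂ : IsSSSolution γ f g₂ a₂ b₂ u₂ v₂) {t : ℝ} (ht : 0 ≤ t) :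
    weakGradient (u₁ t - u₂ t) =ᵐ[volume] weakGradient (u₁ t) - weakGradient (u₂ t) :=
  ((weakGradient_spec (h₁.continuous.mem t ht).hasWeakGradient).sub
    (weakGradient_spec (h₂.continuous.mem t ht).hasWeakGradient)).weakGradient_ae_eq

/-- The slice norm of the difference of two solutions. -/
noncomputable def diffSliceNorm (x₀ : E3) (R : ℝ) (u₁ v₁ u₂ v₂ : ℝ → E3 → ℝ) (t : ℝ) : ℝ≥0∞ :=
  sliceNorm x₀ R ((fun t => u₁ (max t 0)) - fun t => u₂ (max t 0))
    ((fun t => v₁ (max t 0)) - fun t => v₂ (max t 0))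
    ((fun t => weakGradient (u₁ (max t 0))) - fun t => weakGradient (u₂ (max t 0))) t

theorem IsSSSolution.diffSliceNorm_eq (h₁ : IsSSSolution γ f g₁ a₁ b₁ u₁ v₁)
    (h₂ : IsSSSolution γ f g₂ a₂ b₂ u₂ v₂) (x₀ : E3) (R : ℝ) {t : ℝ} (ht : 0 ≤ t) :
    diffSliceNorm x₀ R u₁ v₁ u₂ v₂ t = eLpNorm (u₁ t - u₂ t) 2 (ballMeasure x₀ (R - t)) +
      eLpNorm (v₁ t - v₂ t) 2 (ballMeasure x₀ (R - t)) +
      eLpNorm (weakGradient (u₁ t - u₂ t)) 2 (ballMeasure x₀ (R - t)) := by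
  rw [eLpNorm_congr_ae (ae_ballMeasure_of_ae (h₁.weakGradient_sub h₂ ht) x₀ (R - t))]
  simp [diffSliceNorm, sliceNorm, max_eq_left ht]

theorem IsSSSolution.energyNorm_sub_le (h₁ : IsSSSolution γ f g₁ a₁ b₁ u₁ v₁)
    (h₂ : IsSSSolution γ f g₂ a₂ b₂ u₂ v₂) (x₀ : E3) (R : ℝ) {t : ℝ} (ht : 0 ≤ t) :
    energyNorm x₀ (R - t) (u₁ t - u₂ t) (v₁ t - v₂ t) ≤ diffSliceNorm x₀ R u₁ v₁ u₂ v₂ t := by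
  rw [h₁.diffSliceNorm_eq h₂ x₀ R ht, add_right_comm]
  exact energyNorm_le_add _ _ _ _

theorem IsSSSolution.diffSliceNorm_le (h₁ : IsSSSolution γ f g₁ a₁ b₁ u₁ v₁)
    (h₂ : IsSSSolution γ f g₂ a₂ b₂ u₂ v₂) (x₀ : E3) (R : ℝ) :
    diffSliceNorm x₀ R u₁ v₁ u₂ v₂ 0 ≤ 3 * energyNorm x₀ R (u₁ 0 - u₂ 0) (v₁ 0 - v₂ 0) := by
  rw [h₁.diffSliceNorm_eq h₂ x₀ R le_rfl, sub_zero]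
  have h (a b : E3 → ℝ) := add_le_add_three (eLpNorm_fst_le_energyNorm x₀ R a b)
    (eLpNorm_snd_le_energyNorm x₀ R a b) (eLpNorm_grad_le_energyNorm x₀ R a b)
  refine (h _ _).trans (le_of_eq ?_)
  ring

theorem IsSSSolution.ae_aestronglyMeasurable (h : IsSSSolution γ f g₁ a₁ b₁ u₁ v₁) {t : ℝ}
    (ht : 0 ≤ t) : AEStronglyMeasurable (u₁ t) volume := by
  simpa [max_eq_left ht] using h.continuous.curve_fst.aestronglyMeasurable t

theorem IsSSSolution.aemeasurable_strichartz (h : IsSSSolution γ f g₁ a₁ b₁ u₁ v₁) (x₀ : E3)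
    (R T : ℝ) : AEMeasurable (fun t => eLpNorm (u₁ t) 12 (ballMeasure x₀ (R - t)) ^ 4)
      (volume.restrict (Ioc 0 T)) :=
  ((h.strichartz.aemeasurable_eLpNorm (by norm_num) (by norm_num) x₀ (fun t => R - t)
    (by fun_prop)).mono_measure (Measure.restrict_mono Ioc_subset_Ioi_self le_rfl)).pow_const 4

theorem IsSSSolution.ae_eLpNorm_force_le (hf : QuinticNonlinearity f) {C : ℝ≥0}
    (hC : ∀ a b, |f a - f b| ≤ C * ((1 + a ^ 4 + b ^ 4) * |a - b|))
    (h₁ : IsSSSolution γ f g₁ a₁ b₁ u₁ v₁) (h₂ : IsSSSolution γ f g₂ a₂ b₂ u₂ v₂)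
    (μ : ℝ → Measure E3) (hμ : ∀ t, μ t ≤ volume) :
    ∀ᵐ t ∂volume.restrict (Ioi (0 : ℝ)),
      eLpNorm (((g₁ - fun t x => f (u₁ t x)) - (g₂ - fun t x => f (u₂ t x))) t) 2 (μ t) ≤
        eLpNorm (g₁ t - g₂ t) 2 (μ t) + C * (eLpNorm (u₁ t - u₂ t) 2 (μ t) +
          (eLpNorm (u₁ t) 12 (μ t) ^ 4 + eLpNorm (u₂ t) 12 (μ t) ^ 4) *
            eLpNorm (u₁ t - u₂ t) 6 (μ t)) := by
  filter_upwards [h₁.force_mem.ae_aestronglyMeasurable, h₂.force_mem.ae_aestronglyMeasurable,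
    ae_restrict_mem measurableSet_Ioi] with t hg₁ hg₂ ht
  have ht0 : 0 ≤ t := (mem_Ioi.1 ht).le
  have hu₁ := (h₁.ae_aestronglyMeasurable ht0).mono_measure (hμ t)
  have hu₂ := (h₂.ae_aestronglyMeasurable ht0).mono_measure (hμ t)
  have hfm := (hf.1.continuous.comp_aestronglyMeasurable hu₁).sub
    (hf.1.continuous.comp_aestronglyMeasurable hu₂)
  have h3 : ((g₁ - fun t x => f (u₁ t x)) - (g₂ - fun t x => f (u₂ t x))) t =
      (g₁ t - g₂ t) - fun x => f (u₁ t x) - f (u₂ t x) := by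
    funext x
    simp only [Pi.sub_apply]
    ring
  rw [h3]
  exact (eLpNorm_sub_le ((hg₁.sub hg₂).mono_measure (hμ t)) hfm one_le_two).trans
    (add_le_add_right (eLpNorm_nonlinearity_sub_le hC hu₁ hu₂) _)

end Difference

/-! ### Stability in cones and uniqueness -/

/-- Lipschitz dependence of solutions on the data in backward cones. -/
theorem exists_cone_stability_bound {γ : ℝ} (hγ : 0 < γ) {f : ℝ → ℝ} (hf : QuinticNonlinearity f)
    {R : ℝ} (hR : 0 < R) (x₀ : E3) (M : ℝ≥0) : ∃ C : ℝ≥0,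
      ∀ (g₁ g₂ : ℝ → E3 → ℝ) (a₁ b₁ a₂ b₂ : E3 → ℝ) (u₁ v₁ u₂ v₂ : ℝ → E3 → ℝ),
        IsSSSolution γ f g₁ a₁ b₁ u₁ v₁ → IsSSSolution γ f g₂ a₂ b₂ u₂ v₂ →
        coneStrichartzNorm x₀ R u₁ ≤ M → coneStrichartzNorm x₀ R u₂ ≤ M →
        ∀ t : ℝ, 0 < t → t < R →
          energyNorm x₀ (R - t) (u₁ t - u₂ t) (v₁ t - v₂ t) ≤
            C * energyNorm x₀ R (u₁ 0 - u₂ 0) (v₁ 0 - v₂ 0) +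
            C * ∫⁻ s in Ioo 0 t, eLpNorm (g₁ s - g₂ s) 2 (ballMeasure x₀ (R - s)) := by
  obtain ⟨C, hC⟩ := hf.exists_lipschitz_bound
  obtain ⟨K, hK⟩ := exists_sliceNorm_bound hγ.le hR C (M ^ 4 + M ^ 4)
  -- The 3 compares the sum of the three initial norms with the energy norm; the kernel mass is at
  -- most M⁴ + M⁴.
  refine ⟨3 * K, fun g₁ g₂ a₁ b₁ a₂ b₂ u₁ v₁ u₂ v₂ h₁ h₂ hM₁ hM₂ t ht htR => ?_⟩
  have hw := (h₁.integratedWave hf).sub (h₂.integratedWave hf)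
  have hm₁ := h₁.aemeasurable_strichartz x₀ R t
  have hm₂ := h₂.aemeasurable_strichartz x₀ R t
  have hsub : Ioo 0 t ⊆ Ioo 0 R := Ioo_subset_Ioo_right htR.le
  have hq : ∫⁻ s in Ioc 0 t, (eLpNorm (u₁ s) 12 (ballMeasure x₀ (R - s)) ^ 4 +
      eLpNorm (u₂ s) 12 (ballMeasure x₀ (R - s)) ^ 4) ≤ ((M ^ 4 + M ^ 4 : ℝ≥0) : ℝ≥0∞) := by
    rw [lintegral_add_left' hm₁, ← restrict_Ioo_eq_restrict_Ioc]
    push_cast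
    exact add_le_add
      ((lintegral_mono_set hsub).trans (coneStrichartzNorm_lintegral_le hM₁))
      ((lintegral_mono_set hsub).trans (coneStrichartzNorm_lintegral_le hM₂))
  have hforce := ae_mono 
    (Measure.restrict_mono (show Ioc 0 t ⊆ Ioi 0 from Ioc_subset_Ioi_self) le_rfl)
    (h₁.ae_eLpNorm_force_le hf hC h₂ (fun s => ballMeasure x₀ (R - s))
      fun s => Measure.restrict_le_self)
  have h3 := hK _ _ _ _ x₀ t (fun s => eLpNorm (g₁ s - g₂ s) 2 (ballMeasure x₀ (R - s))) _ hw ht.le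
    htR (hm₁.add hm₂) hq (by
      filter_upwards [hforce, ae_restrict_mem measurableSet_Ioc] with s hs hst
      simpa [max_eq_left hst.1.le] using hs)
  rw [← restrict_Ioo_eq_restrict_Ioc] at h3
  refine (h₁.energyNorm_sub_le h₂ x₀ R ht.le).trans (h3.trans ?_)
  push_cast
  rw [mul_add, mul_comm (3 : ℝ≥0∞), mul_assoc]
  gcongr
  · exact h₁.diffSliceNorm_le h₂ x₀ R
  · exact le_mul_of_one_le_right zero_le (by norm_num)

theorem IsSSSolution.energyNorm_sub_zero_eq_zero {γ : ℝ} {f : ℝ → ℝ} {g₁ g₂ : ℝ → E3 → ℝ}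
    {a b : E3 → ℝ} {u₁ v₁ u₂ v₂ : ℝ → E3 → ℝ} (h₁ : IsSSSolution γ f g₁ a b u₁ v₁)
    (h₂ : IsSSSolution γ f g₂ a b u₂ v₂) (x₀ : E3) (R : ℝ) :
    energyNorm x₀ R (u₁ 0 - u₂ 0) (v₁ 0 - v₂ 0) = 0 := by
  have hu : u₁ 0 =ᵐ[volume] u₂ 0 := h₁.initial_fst.trans h₂.initial_fst.symm
  have hv : v₁ 0 =ᵐ[volume] v₂ 0 := h₁.initial_snd.trans h₂.initial_snd.symm
  have hD : weakGradient (u₁ 0) =ᵐ[volume] weakGradient (u₂ 0) :=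
    ((weakGradient_spec (h₁.continuous.mem 0 le_rfl).hasWeakGradient).congr hu).ae_eq
      (weakGradient_spec (h₂.continuous.mem 0 le_rfl).hasWeakGradient)
  have hD0 : weakGradient (u₁ 0 - u₂ 0) =ᵐ[volume] 0 :=
    (h₁.weakGradient_sub h₂ le_rfl).trans hD.sub_eq
  have key : ∀ {F : Type} [NormedAddCommGroup F] {c : E3 → F}, c =ᵐ[volume] 0 →
      eLpNorm c 2 (ballMeasure x₀ R) = 0 := fun hc => by
    rw [eLpNorm_congr_ae (ae_ballMeasure_of_ae hc x₀ R)]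
    exact eLpNorm_zero
  refine le_antisymm ((energyNorm_le_add _ _ _ _).trans ?_) zero_le
  rw [key hu.sub_eq, key hv.sub_eq, key hD0]
  simp

theorem IsSSSolution.unique {γ : ℝ} (hγ : 0 < γ) {f : ℝ → ℝ} (hf : QuinticNonlinearity f)
    {g : ℝ → E3 → ℝ} {a b : E3 → ℝ} {u₁ v₁ u₂ v₂ : ℝ → E3 → ℝ}
    (h₁ : IsSSSolution γ f g a b u₁ v₁) (h₂ : IsSSSolution γ f g a b u₂ v₂) {t : ℝ} (ht : 0 ≤ t) :
    u₁ t =ᵐ[volume] u₂ t ∧ v₁ t =ᵐ[volume] v₂ t := by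
  rcases ht.eq_or_lt with rfl | ht
  · exact ⟨h₁.initial_fst.trans h₂.initial_fst.symm, h₁.initial_snd.trans h₂.initial_snd.symm⟩
  have hzero : ∀ n : ℕ, energyNorm 0 (n + 1) (u₁ t - u₂ t) (v₁ t - v₂ t) = 0 := by
    intro n
    have hn : (0 : ℝ) < n + 1 := by positivity
    -- At time t the slice of this cone is the ball of radius n + 1. The constant may depend on n
    -- and on the two solutions, since the right side of the estimate vanishes.
    set R : ℝ := t + (n + 1) with hRdef
    have hRt : R - t = n + 1 := by rw [hRdef]; ring
    have hM₁ := coneStrichartzNorm_lt_top h₁.strichartz R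
    have hM₂ := coneStrichartzNorm_lt_top h₂.strichartz R
    obtain ⟨C, hC⟩ := exists_cone_stability_bound hγ hf (R := R) (by positivity) 0
      (max (coneStrichartzNorm 0 R u₁).toNNReal (coneStrichartzNorm 0 R u₂).toNNReal)
    have h3 := hC g g a b a b u₁ v₁ u₂ v₂ h₁ h₂
      ((ENNReal.coe_toNNReal hM₁.ne).symm.le.trans (ENNReal.coe_le_coe.2 (le_max_left _ _)))
      ((ENNReal.coe_toNNReal hM₂.ne).symm.le.trans (ENNReal.coe_le_coe.2 (le_max_right _ _)))
      t ht (by linarith)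
    rw [h₁.energyNorm_sub_zero_eq_zero h₂, hRt] at h3
    simpa using h3
  have hae : ∀ {c d : E3 → ℝ}, AEStronglyMeasurable c volume → AEStronglyMeasurable d volume →
      (∀ n : ℕ, eLpNorm (c - d) 2 (ballMeasure 0 (n + 1)) = 0) → c =ᵐ[volume] d := by
    intro c d hc hd h
    refine ae_of_forall_ae_ballMeasure fun n => ?_
    have h4 := (eLpNorm_eq_zero_iff ((hc.sub hd).mono_measure Measure.restrict_le_self)
      two_ne_zero).1 (h n)
    have h5 : ballMeasure (0 : E3) n ≤ ballMeasure 0 (n + 1) := ballMeasure_mono (by simp)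
    filter_upwards [ae_mono h5 h4] with x hx
    exact sub_eq_zero.1 hx
  have hv : ∀ {u v : ℝ → E3 → ℝ}, IsSSSolution γ f g a b u v → AEStronglyMeasurable (v t) volume :=
    fun h => by simpa [max_eq_left ht.le] using h.continuous.curve_snd.aestronglyMeasurable t
  exact ⟨hae (h₁.ae_aestronglyMeasurable ht.le) (h₂.ae_aestronglyMeasurable ht.le) fun n =>
      le_antisymm ((eLpNorm_fst_le_energyNorm _ _ _ _).trans (hzero n).le) zero_le,
    hae (hv h₁) (hv h₂) fun n =>
      le_antisymm ((eLpNorm_snd_le_energyNorm _ _ _ _).trans (hzero n).le) zero_le⟩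

end WaveR3

theorem proposition4p1 (γ : ℝ) (hγ : 0 < γ) (f : ℝ → ℝ) (hf : WaveR3.QuinticNonlinearity f) :
    (∀ R : ℝ, 0 < R → ∀ (x₀ : WaveR3.E3) (M : ℝ≥0), ∃ C : ℝ≥0,
      ∀ (g₁ g₂ : ℝ → WaveR3.E3 → ℝ) (a₁ b₁ a₂ b₂ : WaveR3.E3 → ℝ)
        (u₁ v₁ u₂ v₂ : ℝ → WaveR3.E3 → ℝ),
        WaveR3.IsSSSolution γ f g₁ a₁ b₁ u₁ v₁ →
        WaveR3.IsSSSolution γ f g₂ a₂ b₂ u₂ v₂ →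
        WaveR3.coneStrichartzNorm x₀ R u₁ ≤ M →
        WaveR3.coneStrichartzNorm x₀ R u₂ ≤ M →
        ∀ t : ℝ, 0 < t → t < R →
          WaveR3.energyNorm x₀ (R - t) (u₁ t - u₂ t) (v₁ t - v₂ t) ≤
            C * WaveR3.energyNorm x₀ R (u₁ 0 - u₂ 0) (v₁ 0 - v₂ 0) +
            C * ∫⁻ s in Ioo 0 t, eLpNorm (g₁ s - g₂ s) 2 (WaveR3.ballMeasure x₀ (R - s))) ∧
    (∀ (g : ℝ → WaveR3.E3 → ℝ) (a b : WaveR3.E3 → ℝ) (u₁ v₁ u₂ v₂ : ℝ → WaveR3.E3 → ℝ),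
      WaveR3.IsSSSolution γ f g a b u₁ v₁ →
      WaveR3.IsSSSolution γ f g a b u₂ v₂ →
      ∀ t : ℝ, 0 ≤ t → u₁ t =ᵐ[volume] u₂ t ∧ v₁ t =ᵐ[volume] v₂ t) :=
  ⟨fun _ hR x₀ M => WaveR3.exists_cone_stability_bound hγ hf hR x₀ M,
    fun _ _ _ _ _ _ _ h₁ h₂ _ ht => WaveR3.IsSSSolution.unique hγ hf h₁ h₂ ht⟩
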